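/- Fix an integer $n\ge 1$ and put $u_1,\dots,u_n$ for the standard idempotents of the ring $\mathbb Z_2^n$. **Algebras.** $P_m$ is the semigroup of all $m\times m$ matrices with entries in $\{0,u_1,\dots,u_n\}$ that have at most one non-zero entry in each row and in each column and have no $2\times2$ submatrix $\begin{pmatrix}0&u_i\\u_i&0\end{pmatrix}$ (planar diagrams: an entry $u_i$ in position $(a,b)$ is an edge of colour $i$ from the top vertex $a$ to the bottom vertex $b$). $\mathbb CP_m$ is its semigroup algebra, with identity element $e_m=e_1^{\otimes m}$, $e_1=\sum_{i=1}^n I_i-(n-1)I_0$, where $I_0=(0)$, $I_i=(u_i)\in P_1$ and $\otimes$ is juxtaposition of diagrams. For $d\in P_m$ let $x_d=\sum_{d'\subseteq d}(-1)^{|d|-|d'|}d'$, where $d'$ runs over the diagrams obtained from $d$ by deleting edges and $|\cdot|$ is the number of edges. For $m=m_0+\dots+m_n$ let $W^m_{m_0,\dots,m_n}$ be the left ideal of $\mathbb CP_m$ spanned by the $x_d$ such that the first $m_0$ bottom vertices of $d$ are isolated, the next $m_1$ lie on edges of colour $1$, ..., the last $m_n$ on edges of colour $n$. **Functors.** Let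 $\psi_{0}(x)=x\otimes I_0$ and $\psi_{i}(x)=x\otimes(I_i-I_0)$ for $1\le i\le n$; these are (non-unital) embeddings $\mathbb CP_m\to\mathbb CP_{m+1}$. For $0\le i\le n$ let $\mathrm{Res}_i(M)=\psi_i(e_m)M$ with $\mathbb CP_m$ acting through $\psi_i$, and $\mathrm{Ind}_i(N)=\mathbb CP_{m+1}\otimes_{\mathbb CP_m}N$, formed along $\psi_i$. For $1\le i\le n$ put $\tilde{\mathscr E}_i=\mathrm{Res}_i\circ\mathrm{Ind}_{i-1}$ and $\tilde{\mathscr F}_i=\mathrm{Res}_{i-1}\circ\mathrm{Ind}_i$, as functors on finite-dimensional $\mathbb CP_m$-modules. **The crystal $[\mathscr C_\lambda]$.** Let $\lambda=(\lambda_1\ge\dots\ge\lambda_k>0)$ be a partition with $k\le n+1$ parts, and $\mathbb CP_\lambda=\mathbb CP_{\lambda_1}\otimes\dots\otimes\mathbb CP_{\lambda_k}$. $[\mathscr C_\lambda]$ is the set of isomorphism classes of irreducible finite-dimensional $\mathbb CP_\lambda$-modules; each is $[M_c]$, $M_c=W^{\lambda_1}_{c_{10},\dots,c_{1n}}\otimes\dots\otimes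 W^{\lambda_k}_{c_{k0},\dots,c_{kn}}$, for exactly one array $c=(c_{ji})$ of natural numbers with $\sum_i c_{ji}=\lambda_j$. For $1\le i\le n$ write down, for $j=1,\dots,k$ in turn, $c_{ji}$ signs $-$ and then $c_{j,i-1}$ signs $+$, and delete $(+,-)$-pairs until a sequence $(-,\dots,-,+,\dots,+)$ is left. $\tilde e_i[M_c]$ is the class obtained by applying $\tilde{\mathscr E}_i$ to the tensor factor to which the rightmost remaining $-$ belongs ($0$ if there is none); $\tilde f_i[M_c]$ is obtained by applying $\tilde{\mathscr F}_i$ to the tensor factor to which the leftmost remaining $+$ belongs ($0$ if there is none). Moreover $wt[M_c]=\sum_{j}\sum_{i=0}^n c_{ji}\epsilon_{i+1}$, $\varepsilon_i(b)=\max\{r:\tilde e_i^r b\ne0\}$, $\varphi_i(b)=\max\{r:\tilde f_i^r b\ne0\}$. **The crystal $B(\lambda)$.** $B(\epsilon_1)$ is the crystal of boxes $0\xrightarrow{\tilde f_1}1\xrightarrow{\tilde f_2}\cdots\xrightarrow{\tilde f_n}n$ with $wt(j)=\epsilon_{j+1}$, $\varepsilon_i(j)=\delta_{i,j}$, $\varphi_i(j)=\delta_{i,j+1}$,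 and $B(\epsilon_1)^{\otimes N}$ carries the tensor product structure for which $\tilde e_i(b_1\otimes b_2)=\tilde e_ib_1\otimes b_2$ if $\varphi_i(b_1)\ge\varepsilon_i(b_2)$ and $b_1\otimes\tilde e_ib_2$ otherwise, $\tilde f_i(b_1\otimes b_2)=\tilde f_ib_1\otimes b_2$ if $\varphi_i(b_1)>\varepsilon_i(b_2)$ and $b_1\otimes\tilde f_ib_2$ otherwise, $wt(b_1\otimes b_2)=wt(b_1)+wt(b_2)$, and, with $h_i=E_{ii}-E_{i+1,i+1}$, $\varepsilon_i(b_1\otimes b_2)=\max\{\varepsilon_i(b_1),\varepsilon_i(b_2)-wt(b_1)(h_i)\}$, $\varphi_i(b_1\otimes b_2)=\max\{\varphi_i(b_2),\varphi_i(b_1)+wt(b_2)(h_i)\}$. $B(\lambda)$ is the set of semistandard Young tableaux of shape $\lambda$ with entries in $\{0,\dots,n\}$, with the structure lifted from $B(\epsilon_1)^{\otimes|\lambda|}$ along the Middle-Eastern reading $\Psi$, which reads the rows from top to bottom and each row from right to left. **Claim.** $\Psi$ is injective, its image together with $0$ is stable under all $\tilde e_i,\tilde f_i$ (so that $B(\lambda)$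 is well defined and $\Psi$ commutes with all structure maps), and $B(\lambda)$ and $[\mathscr C_\lambda]$ are $gl_{n+1}(\mathbb C)$-crystals. The connected component of the crystal graph of $[\mathscr C_\lambda]$ that contains $$[W^{\lambda_1}_{\lambda_1,0,\dots,0}\otimes W^{\lambda_2}_{0,\lambda_2,0,\dots,0}\otimes\dots\otimes W^{\lambda_k}_{0,\dots,0,\lambda_k,0,\dots,0}]$$ (the entry $\lambda_j$ being in position $j-1$ of $0,\dots,n$) is isomorphic to $B(\lambda)$ as a crystal. An isomorphism from $B(\lambda)$ onto this component sends a tableau $T$ to $[M_c]$, where $c_{ji}$ is the number of entries $i$ in the $j$-th row of $T$. -/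

import Mathlib

namespace PlanarRook

/-- The element `u_i` of `(ℤ/2)^n`. -/
def u {n : ℕ} (i : Fin n) : Fin n → ZMod 2 := Pi.single i 1

/-- The matrices over `(ℤ/2)^n` that form `P_m^n`. -/
structure IsPlanar {n m : ℕ} (A : Matrix (Fin m) (Fin m) (Fin n → ZMod 2)) : Prop where
  entry : ∀ r c, A r c = 0 ∨ ∃ i, A r c = u i
  row : ∀ r c c', A r c ≠ 0 → A r c' ≠ 0 → c = c'
  col : ∀ r r' c, A r c ≠ 0 → A r' c ≠ 0 → r = r'
  planar : ∀ (i : Fin n) (r s c d : Fin m), r < s → c < d →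
    ¬ (A r c = 0 ∧ A r d = u i ∧ A s c = u i ∧ A s d = 0)

theorem u_ne_zero {n : ℕ} (i : Fin n) : u i ≠ 0 := by
  simp [u]

theorem u_mul_u {n : ℕ} (i j : Fin n) : u i * u j = if i = j then u i else 0 := by
  ext k
  simp only [u, Pi.mul_apply]
  by_cases h : i = j
  · subst h; by_cases hk : k = i <;> simp [hk]
  · by_cases hk : k = i
    · subst hk; simp [h]
    · simp [hk, h]

theorem u_inj {n : ℕ} {i j : Fin n} (h : u i = u j) : i = j := by
  by_contra hne
  have := congrFun h i
  simp [u, hne] at this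

theorem IsPlanar.mul_eq_u_iff {n m : ℕ} {A B : Matrix (Fin m) (Fin m) (Fin n → ZMod 2)}
    (hA : IsPlanar A) (hB : IsPlanar B) (r c : Fin m) :
    ((A * B) r c = 0 ∨ ∃ i, (A * B) r c = u i) ∧
    ∀ i, (A * B) r c = u i ↔ ∃ k, A r k = u i ∧ B k c = u i := by
  rw [Matrix.mul_apply]
  by_cases h : ∃ k, A r k ≠ 0
  · obtain ⟨k, hk⟩ := h
    have hz : ∀ l, l ≠ k → A r l = 0 := fun l hl => by
      by_contra h'; exact hl (hA.row r l k h' hk)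
    rw [Finset.sum_eq_single k (fun l _ hl => by rw [hz l hl, zero_mul]) (by simp)]
    obtain ⟨j, hj⟩ := (hA.entry r k).resolve_left hk
    have key : ∀ i, (∃ l, A r l = u i ∧ B l c = u i) ↔ i = j ∧ B k c = u j := by
      intro i
      constructor
      · rintro ⟨l, h1, h2⟩
        have : l = k := by
          by_contra hl; rw [hz l hl] at h1; exact u_ne_zero i h1.symm
        subst this
        have := u_inj (h1.symm.trans hj)
        subst this
        exact ⟨rfl, h2⟩
      · rintro ⟨rfl, h2⟩
        exact ⟨k, hj, h2⟩
    simp only [key]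
    rw [hj]
    rcases hB.entry k c with h0 | ⟨i', hi'⟩
    · rw [h0, mul_zero]
      exact ⟨Or.inl rfl, fun i => ⟨fun h => absurd h.symm (u_ne_zero i),
        fun h => absurd h.2.symm (u_ne_zero j)⟩⟩
    · rw [hi', u_mul_u]
      by_cases hji : j = i'
      · subst hji
        simp only [if_true]
        exact ⟨Or.inr ⟨_, rfl⟩, fun i => ⟨fun h => ⟨(u_inj h).symm, trivial⟩, fun h => by rw [h.1]⟩⟩
      · simp only [hji, if_false, true_or, true_and]
        exact fun i => ⟨fun h => absurd h.symm (u_ne_zero i),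
          fun h => absurd (u_inj h.2).symm hji⟩
  · push Not at h
    rw [Finset.sum_eq_zero (fun l _ => by rw [h l, zero_mul])]
    refine ⟨Or.inl rfl, fun i => ⟨fun h => absurd h.symm (u_ne_zero i), ?_⟩⟩
    rintro ⟨k, hk, -⟩
    rw [h k] at hk
    exact absurd hk.symm (u_ne_zero i)

theorem IsPlanar.mul {n m : ℕ} {A B : Matrix (Fin m) (Fin m) (Fin n → ZMod 2)}
    (hA : IsPlanar A) (hB : IsPlanar B) : IsPlanar (A * B) := by
  have nz : ∀ {r c}, (A * B) r c ≠ 0 → ∃ i k, A r k = u i ∧ B k c = u i := by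
    intro r c h
    obtain ⟨i, hi⟩ := ((hA.mul_eq_u_iff hB r c).1).resolve_left h
    exact ⟨i, ((hA.mul_eq_u_iff hB r c).2 i).1 hi⟩
  have ne : ∀ {v : Fin n → ZMod 2} {i}, v = u i → v ≠ 0 := fun h => h ▸ u_ne_zero _
  refine ⟨fun r c => (hA.mul_eq_u_iff hB r c).1, ?_, ?_, ?_⟩
  · intro r c c' h h'
    obtain ⟨i, k, h1, h2⟩ := nz h
    obtain ⟨i', k', h1', h2'⟩ := nz h'
    have := hA.row r k k' (ne h1) (ne h1')
    subst this
    exact hB.row k c c' (ne h2) (ne h2')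
  · intro r r' c h h'
    obtain ⟨i, k, h1, h2⟩ := nz h
    obtain ⟨i', k', h1', h2'⟩ := nz h'
    have := hB.col k k' c (ne h2) (ne h2')
    subst this
    exact hA.col r r' k (ne h1) (ne h1')
  · rintro i r s c d hrs hcd ⟨-, h2, h3, -⟩
    obtain ⟨k, hk1, hk2⟩ := ((hA.mul_eq_u_iff hB r d).2 i).1 h2
    obtain ⟨l, hl1, hl2⟩ := ((hA.mul_eq_u_iff hB s c).2 i).1 h3
    have z : ∀ {C : Matrix (Fin m) (Fin m) (Fin n → ZMod 2)} (_ : IsPlanar C) {a b b'},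
        C a b = u i → b' ≠ b → C a b' = 0 := by
      intro C hC a b b' h hb
      by_contra h'
      exact hb (hC.row a b' b h' (ne h))
    rcases lt_trichotomy k l with hkl | hkl | hkl
    · exact hB.planar i k l c d hkl hcd ⟨z hB hk2 hcd.ne, hk2, hl2, z hB hl2 hcd.ne'⟩
    · subst hkl
      exact hrs.ne (hA.col r s k (ne hk1) (ne hl1))
    · exact hA.planar i r s l k hrs hkl ⟨z hA hk1 hkl.ne, hk1, hl1, z hA hl1 hkl.ne'⟩

/-- The semigroup `P_m^n` of planar diagrams, seen as matrices. -/
@[ext]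
structure P (n m : ℕ) : Type where
  mat : Matrix (Fin m) (Fin m) (Fin n → ZMod 2)
  isPlanar : IsPlanar mat

instance (n m : ℕ) : Semigroup (P n m) where
  mul d d' := ⟨d.mat * d'.mat, d.isPlanar.mul d'.isPlanar⟩
  mul_assoc a b c := P.ext (Matrix.mul_assoc a.mat b.mat c.mat)

theorem P.mul_mat {n m : ℕ} (d d' : P n m) : (d * d').mat = d.mat * d'.mat := rfl

instance (n m : ℕ) : Finite (P n m) :=
  haveI : Finite (Matrix (Fin m) (Fin m) (Fin n → ZMod 2)) :=
    inferInstanceAs (Finite (Fin m → Fin m → Fin n → ZMod 2))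
  Finite.of_injective P.mat fun _ _ => P.ext

noncomputable instance (n m : ℕ) : Fintype (P n m) := Fintype.ofFinite _

/-- The colour that an element of `{0, 1, …, n}` stands for: `0` for `none`, `u_i` for `some i`. -/
def colour {n : ℕ} (o : Option (Fin n)) : Fin n → ZMod 2 := o.elim 0 u

theorem colour_cases {n : ℕ} (o : Option (Fin n)) : colour o = 0 ∨ ∃ i, colour o = u i := by
  cases o with
  | none => exact Or.inl rfl
  | some i => exact Or.inr ⟨i, rfl⟩

/-- The diagram `I_{c 1} ⊗ ⋯ ⊗ I_{c m}`, all of whose edges are vertical: the `t`-th top vertex and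
the `t`-th bottom vertex are isolated (`c t = none`) or joined by an edge of colour `c t`. -/
def vertical {n m : ℕ} (c : Fin m → Option (Fin n)) : P n m :=
  ⟨Matrix.diagonal fun t => colour (c t), by
    have key : ∀ {r s : Fin m}, Matrix.diagonal (fun t => colour (c t)) r s ≠ 0 → r = s := by
      intro r s h
      by_contra hrs
      exact h (Matrix.diagonal_apply_ne _ hrs)
    refine ⟨?_, ?_, ?_, ?_⟩
    · intro r s
      by_cases h : r = s
      · subst h; rw [Matrix.diagonal_apply_eq]; exact colour_cases _
      · exact Or.inl (Matrix.diagonal_apply_ne _ h)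
    · intro r s s' h h'; exact (key h).symm.trans (key h')
    · intro r s s' h h'; exact (key h).trans (key h').symm
    · rintro i r s c' d hrs hcd ⟨-, h, h', -⟩
      have h1 := key (h ▸ u_ne_zero i)
      have h2 := key (h' ▸ u_ne_zero i)
      subst h1 h2
      exact lt_asymm hrs hcd⟩

/-- The `n` coloured planar rook algebra `ℂP_m`: the semigroup algebra of `P_m`. -/
abbrev CP (n m : ℕ) : Type := MonoidAlgebra ℂ (P n m)

/-- The coefficients of `e_1 = ∑ I_i - (n - 1) I_0`. -/
def unitCoeff {n : ℕ} (o : Option (Fin n)) : ℂ := o.elim (-((n : ℂ) - 1)) fun _ => 1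

/-- The element `e_m = e_1 ⊗ ⋯ ⊗ e_1` of `ℂP_m`, expanded. -/
noncomputable def unit (n m : ℕ) : CP n m :=
  ∑ c : Fin m → Option (Fin n), MonoidAlgebra.single (vertical c) (∏ t, unitCoeff (c t))

open Classical in
theorem sum_unitCoeff {n m : ℕ} (v y : Fin m → Fin n → ZMod 2)
    (hv : v = 0 ∨ ∃ j, ∀ i s, u i * v s = if i = j then v s else 0) :
    ∑ o : Option (Fin n), (if (∀ s, colour o * v s = y s) then unitCoeff o else 0)
      = if v = y then 1 else 0 := by
  have e : ∀ o, (∀ s, colour o * v s = y s) ↔ (fun s => colour o * v s) = y :=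
    fun o => funext_iff.symm
  simp only [e]
  have h0 : (fun s => colour (none : Option (Fin n)) * v s) = 0 := by
    funext s; simp [colour]
  rw [Fintype.sum_option, h0]
  rcases hv with rfl | ⟨j, hj⟩
  · have h1 : ∀ i, (fun s => colour (some i) * (0 : Fin m → Fin n → ZMod 2) s) = 0 := by
      intro i; funext s; simp
    simp only [h1]
    by_cases h : (0 : Fin m → Fin n → ZMod 2) = y <;> simp [h, unitCoeff]
  · have h1 : ∀ i, (fun s => colour (some i) * v s) = if i = j then v else 0 := by
      intro i
      funext s
      have := hj i s
      simp only [colour, Option.elim, this]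
      split_ifs <;> rfl
    simp only [h1]
    rw [← Finset.add_sum_erase _ _ (Finset.mem_univ j)]
    have h2 : ∀ i ∈ Finset.univ.erase j,
        (if (if i = j then v else 0) = y then unitCoeff (some i) else (0 : ℂ))
          = if 0 = y then 1 else 0 := by
      intro i hi
      rw [if_neg (Finset.ne_of_mem_erase hi)]
      rfl
    rw [Finset.sum_congr rfl h2, Finset.sum_const, Finset.card_erase_of_mem (Finset.mem_univ j),
      Finset.card_univ, Fintype.card_fin]
    have hn : 1 ≤ n := j.pos
    by_cases h : (0 : Fin m → Fin n → ZMod 2) = y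
    · simp [h, unitCoeff, Nat.cast_sub hn]
      ring
    · simp [h, unitCoeff]

theorem u_mul_line {n : ℕ} {ι : Type} (v : ι → Fin n → ZMod 2)
    (h : ∀ s, v s = 0 ∨ ∃ i, v s = u i) (h' : ∀ s s', v s ≠ 0 → v s' ≠ 0 → s = s') :
    v = 0 ∨ ∃ j, ∀ i s, u i * v s = if i = j then v s else 0 := by
  by_cases hv : v = 0
  · exact Or.inl hv
  · obtain ⟨s, hs⟩ := Function.ne_iff.1 hv
    obtain ⟨j, hj⟩ := (h s).resolve_left hs
    refine Or.inr ⟨j, fun i s' => ?_⟩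
    by_cases hs' : v s' = 0
    · simp [hs']
    · rw [← h' s s' hs hs', hj, u_mul_u]
      split_ifs with hij
      · rw [hij]
      · rfl

open Classical in
theorem sum_prod_unitCoeff {n m : ℕ} (v y : Fin m → Fin m → Fin n → ZMod 2)
    (h : ∀ t s, v t s = 0 ∨ ∃ i, v t s = u i)
    (h' : ∀ t s s', v t s ≠ 0 → v t s' ≠ 0 → s = s') (z : ℂ) :
    (∑ c : Fin m → Option (Fin n),
      if (∀ t s, colour (c t) * v t s = y t s) then (∏ t, unitCoeff (c t)) * z else 0)
      = if v = y then z else 0 := by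
  have h1 := fun t => sum_unitCoeff (v t) (y t) (u_mul_line _ (h t) (h' t))
  have h2 := Finset.prod_univ_sum (fun _ : Fin m => (Finset.univ : Finset (Option (Fin n))))
    (fun t o => if (∀ s, colour o * v t s = y t s) then unitCoeff o else (0 : ℂ))
  simp only [h1, Fintype.piFinset_univ, Finset.prod_ite_zero, Finset.mem_univ, true_imp_iff,
    Finset.prod_const_one] at h2
  have h3 := congrArg (· * z) h2
  simp only [Finset.sum_mul, ite_mul, one_mul, zero_mul] at h3
  rw [← h3]
  simp only [funext_iff]

open Classical in
theorem unit_mul_single {n m : ℕ} (d : P n m) (z : ℂ) :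
    unit n m * MonoidAlgebra.single d z = MonoidAlgebra.single d z := by
  apply MonoidAlgebra.ext
  ext y
  have e : ∀ c : Fin m → Option (Fin n),
      (vertical c * d = y) ↔ ∀ t s, colour (c t) * d.mat t s = y.mat t s := by
    intro c
    rw [P.ext_iff, ← Matrix.ext_iff, P.mul_mat]
    simp only [vertical, Matrix.diagonal_mul]
  have e' : d = y ↔ (fun t s => d.mat t s) = fun t s => y.mat t s := by
    rw [P.ext_iff, ← Matrix.ext_iff]
    simp only [funext_iff]
  simp only [unit, Finset.sum_mul, MonoidAlgebra.single_mul_single, MonoidAlgebra.coeff_sum,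
    MonoidAlgebra.coeff_single, Finsupp.finsetSum_apply, Finsupp.single_apply, e, e']
  convert sum_prod_unitCoeff (fun t s => d.mat t s) (fun t s => y.mat t s)
    d.isPlanar.entry d.isPlanar.row z

open Classical in
theorem single_mul_unit {n m : ℕ} (d : P n m) (z : ℂ) :
    MonoidAlgebra.single d z * unit n m = MonoidAlgebra.single d z := by
  apply MonoidAlgebra.ext
  ext y
  have e : ∀ c : Fin m → Option (Fin n),
      (d * vertical c = y) ↔ ∀ t s, colour (c t) * d.mat s t = y.mat s t := by
    intro c
    rw [P.ext_iff, ← Matrix.ext_iff, P.mul_mat]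
    simp only [vertical, Matrix.mul_diagonal]
    rw [forall_comm]
    simp only [mul_comm]
  have e' : d = y ↔ (fun t s => d.mat s t) = fun t s => y.mat s t := by
    rw [P.ext_iff, ← Matrix.ext_iff, forall_comm]
    simp only [funext_iff]
  simp only [unit, Finset.mul_sum, MonoidAlgebra.single_mul_single, MonoidAlgebra.coeff_sum,
    MonoidAlgebra.coeff_single, Finsupp.finsetSum_apply, Finsupp.single_apply, e, e', mul_comm z]
  convert sum_prod_unitCoeff (fun t s => d.mat s t) (fun t s => y.mat s t)
    (fun t s => d.isPlanar.entry s t) (fun t s s' => d.isPlanar.col s s' t) z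

theorem unit_mul {n m : ℕ} (a : CP n m) : unit n m * a = a := by
  induction a using MonoidAlgebra.induction_linear with
  | zero => exact mul_zero _
  | add f g hf hg => rw [mul_add, hf, hg]
  | single d z => exact unit_mul_single d z

theorem mul_unit {n m : ℕ} (a : CP n m) : a * unit n m = a := by
  induction a using MonoidAlgebra.induction_linear with
  | zero => exact zero_mul _
  | add f g hf hg => rw [add_mul, hf, hg]
  | single d z => exact single_mul_unit d z

noncomputable instance (n m : ℕ) : Ring (CP n m) :=
  { (inferInstance : NonUnitalRing (CP n m)) with
    one := unit n m
    one_mul := unit_mul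
    mul_one := mul_unit }

noncomputable instance (n m : ℕ) : Algebra ℂ (CP n m) :=
  Algebra.ofModule (fun r x y => smul_mul_assoc r x y) (fun r x y => mul_smul_comm r x y)

instance (n m : ℕ) : FiniteDimensional ℂ (CP n m) := inferInstance


/-- Two diagrams put next to each other. -/
def juxt {n m m' : ℕ} (d : P n m) (d' : P n m') : P n (m + m') where
  mat := (Matrix.fromBlocks d.mat 0 0 d'.mat).submatrix finSumFinEquiv.symm finSumFinEquiv.symm
  isPlanar := by
    have key : ∀ {r c : Fin m ⊕ Fin m'} {P : (Fin n → ZMod 2) → Prop}, P 0 →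
        (∀ a b, r = Sum.inl a → c = Sum.inl b → P (d.mat a b)) →
        (∀ a b, r = Sum.inr a → c = Sum.inr b → P (d'.mat a b)) →
        P (Matrix.fromBlocks d.mat 0 0 d'.mat r c) := by
      rintro (a | a) (b | b) P h0 h1 h2
      · exact h1 a b rfl rfl
      · exact h0
      · exact h0
      · exact h2 a b rfl rfl
    refine ⟨?_, ?_, ?_, ?_⟩
    · intro r c
      exact key (P := fun v => v = 0 ∨ ∃ i, v = u i) (Or.inl rfl)
        (fun a b _ _ => d.isPlanar.entry a b) (fun a b _ _ => d'.isPlanar.entry a b)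
    · intro r c c' h h'
      apply finSumFinEquiv.symm.injective
      simp only [Matrix.submatrix_apply] at h h'
      generalize finSumFinEquiv.symm r = r at h h'
      generalize finSumFinEquiv.symm c = c at *
      generalize finSumFinEquiv.symm c' = c' at *
      rcases r with r | r <;> rcases c with c | c <;> rcases c' with c' | c' <;>
        simp at h h'
      · rw [d.isPlanar.row r c c' h h']
      · rw [d'.isPlanar.row r c c' h h']
    · intro r r' c h h'
      apply finSumFinEquiv.symm.injective
      simp only [Matrix.submatrix_apply] at h h'
      generalize finSumFinEquiv.symm r = r at *
      generalize finSumFinEquiv.symm c = c at *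
      generalize finSumFinEquiv.symm r' = r' at *
      rcases r with r | r <;> rcases c with c | c <;> rcases r' with r' | r' <;>
        simp at h h'
      · rw [d.isPlanar.col r r' c h h']
      · rw [d'.isPlanar.col r r' c h h']
    · intro i r s c e hrs hce
      obtain ⟨r, rfl⟩ := finSumFinEquiv.surjective r
      obtain ⟨s, rfl⟩ := finSumFinEquiv.surjective s
      obtain ⟨c, rfl⟩ := finSumFinEquiv.surjective c
      obtain ⟨e, rfl⟩ := finSumFinEquiv.surjective e
      simp only [Matrix.submatrix_apply, Equiv.symm_apply_apply]
      have hu : (0 : Fin n → ZMod 2) ≠ u i := (u_ne_zero i).symm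
      rcases r with r | r <;> rcases s with s | s <;> rcases c with c | c <;> rcases e with e | e <;>
        simp only [finSumFinEquiv_apply_left, finSumFinEquiv_apply_right, Fin.lt_def,
          Fin.val_castAdd, Fin.val_natAdd, Matrix.fromBlocks_apply₁₁, Matrix.fromBlocks_apply₁₂,
          Matrix.fromBlocks_apply₂₁, Matrix.fromBlocks_apply₂₂, Matrix.zero_apply, hu, false_and,
          and_false, not_false_eq_true] at hrs hce ⊢
      · exact d.isPlanar.planar i r s c e hrs hce
      · omega
      · omega
      · exact d'.isPlanar.planar i r s c e (by simpa using hrs) (by simpa using hce)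

theorem juxt_mul_juxt {n m m' : ℕ} (d e : P n m) (d' e' : P n m') :
    juxt d d' * juxt e e' = juxt (d * e) (d' * e') := by
  apply P.ext
  rw [P.mul_mat]
  simp only [juxt, P.mul_mat]
  rw [Matrix.submatrix_mul_equiv, Matrix.fromBlocks_multiply]
  simp

/-- The embedding `ℂP_m ⊗ ℂP_{m'} → ℂP_{m + m'}`, as a bilinear map. -/
noncomputable def tens {n m m' : ℕ} : CP n m →ₗ[ℂ] CP n m' →ₗ[ℂ] CP n (m + m') :=
  LinearMap.mk₂ ℂ
    (fun a b => ∑ d, ∑ d', MonoidAlgebra.single (juxt d d') (a.coeff d * b.coeff d'))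
    (fun a a' b => by
      simp only [MonoidAlgebra.coeff_add, Finsupp.add_apply, add_mul, MonoidAlgebra.single_add,
        Finset.sum_add_distrib])
    (fun z a b => by
      simp only [MonoidAlgebra.coeff_smul, Finsupp.smul_apply, smul_mul_assoc,
        ← MonoidAlgebra.smul_single, Finset.smul_sum])
    (fun a b b' => by
      simp only [MonoidAlgebra.coeff_add, Finsupp.add_apply, mul_add, MonoidAlgebra.single_add,
        Finset.sum_add_distrib])
    (fun z a b => by
      simp only [MonoidAlgebra.coeff_smul, Finsupp.smul_apply, mul_smul_comm,
        ← MonoidAlgebra.smul_single, Finset.smul_sum])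

theorem tens_single {n m m' : ℕ} (d : P n m) (d' : P n m') (z z' : ℂ) :
    tens (MonoidAlgebra.single d z) (MonoidAlgebra.single d' z')
      = MonoidAlgebra.single (juxt d d') (z * z') := by
  classical
  simp only [tens, LinearMap.mk₂_apply, MonoidAlgebra.coeff_single]
  rw [Finset.sum_eq_single d, Finset.sum_eq_single d']
  · simp
  · intro e' _ he
    simp [Finsupp.single_eq_of_ne he]
  · simp
  · intro e _ he
    simp [Finsupp.single_eq_of_ne he]
  · simp

theorem tens_mul_tens {n m m' : ℕ} (a a' : CP n m) (b b' : CP n m') :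
    tens a b * tens a' b' = tens (a * a') (b * b') := by
  induction a using MonoidAlgebra.induction_linear with
  | zero => simp
  | add f g hf hg => simp only [map_add, LinearMap.add_apply, add_mul, hf, hg]
  | single d z =>
  induction a' using MonoidAlgebra.induction_linear with
  | zero => simp
  | add f g hf hg => simp only [map_add, LinearMap.add_apply, mul_add, hf, hg]
  | single e w =>
  induction b using MonoidAlgebra.induction_linear with
  | zero => simp
  | add f g hf hg => simp only [map_add, add_mul, hf, hg]
  | single d' z' =>
  induction b' using MonoidAlgebra.induction_linear with
  | zero => simp
  | add f g hf hg => simp only [map_add, mul_add, hf, hg]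
  | single e' w' =>
  simp only [tens_single, MonoidAlgebra.single_mul_single, juxt_mul_juxt]
  congr 1
  ring

/-- The diagram `I_i ∈ P_1` (`o = some i`) and the diagram `I_0 ∈ P_1` (`o = none`). -/
def dot {n : ℕ} (o : Option (Fin n)) : P n 1 := vertical fun _ => o

/-- The idempotents `I_0` and `I_i - I_0` (`1 ≤ i ≤ n`) of `ℂP_1`. -/
noncomputable def idem {n : ℕ} : Fin (n + 1) → CP n 1 :=
  Fin.cases (MonoidAlgebra.single (dot none) 1)
    fun i => MonoidAlgebra.single (dot (some i)) 1 - MonoidAlgebra.single (dot none) 1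

theorem dot_mul_dot {n : ℕ} (o : Option (Fin n)) :
    dot o * dot o = dot o ∧ dot o * dot none = dot none ∧ dot none * dot o = dot none := by
  have h : colour o * colour o = colour o := by
    cases o with
    | none => exact mul_zero _
    | some i => exact (u_mul_u i i).trans (if_pos rfl)
  have h0 : colour (none : Option (Fin n)) = 0 := rfl
  refine ⟨?_, ?_, ?_⟩ <;>
  · apply P.ext
    rw [P.mul_mat]
    simp only [dot, vertical, Matrix.diagonal_mul_diagonal, h, h0, mul_zero, zero_mul]

theorem idem_mul_idem {n : ℕ} (i : Fin (n + 1)) : (idem i : CP n 1) * idem i = idem i := by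
  refine Fin.cases ?_ (fun i => ?_) i
  · simp [idem, MonoidAlgebra.single_mul_single, dot_mul_dot]
  · obtain ⟨h1, h2, h3⟩ := dot_mul_dot (some i)
    obtain ⟨h4, -, -⟩ := dot_mul_dot (none : Option (Fin n))
    simp [idem, mul_sub, sub_mul, MonoidAlgebra.single_mul_single, h1, h2, h3, h4]

/-- The embedding `ψ_{i,m+1} : ℂP_m → ℂP_{m+1}`, `x ↦ x ⊗ I_0` for `i = 0` and
`x ↦ x ⊗ (I_i - I_0)` for `1 ≤ i ≤ n`. It does not preserve the identity element. -/
noncomputable def psi {n : ℕ} (m : ℕ) (i : Fin (n + 1)) : CP n m →ₙₐ[ℂ] CP n (m + 1) where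
  toFun x := tens x (idem i)
  map_smul' z x := by simp
  map_zero' := by simp
  map_add' x y := by simp
  map_mul' x y := by rw [tens_mul_tens, idem_mul_idem]

/-! ### The modules `W_T` -/

/-- `d'` is obtained from `d` by deleting some edges. -/
def IsSub {n m : ℕ} (d' d : P n m) : Prop := ∀ r c, d'.mat r c = 0 ∨ d'.mat r c = d.mat r c

open Classical in
/-- The number of edges. -/
noncomputable def size {n m : ℕ} (d : P n m) : ℕ :=
  (Finset.univ.filter fun p : Fin m × Fin m => d.mat p.1 p.2 ≠ 0).card

open Classical in
/-- The basis element `x_d` of `ℂP_m`. -/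
noncomputable def x {n m : ℕ} (d : P n m) : CP n m :=
  ∑ d' ∈ Finset.univ.filter fun d' => IsSub d' d,
    MonoidAlgebra.single d' ((-1) ^ (size d - size d'))

open Classical in
/-- `β(d) = (β_0(d), …, β_n(d))`: the set of isolated bottom vertices, and the sets of the bottom
vertices that lie on an edge of a given colour. -/
noncomputable def bottom {n m : ℕ} (d : P n m) : Fin (n + 1) → Finset (Fin m) :=
  Fin.cases (Finset.univ.filter fun c => ∀ r, d.mat r c = 0)
    fun i => Finset.univ.filter fun c => ∃ r, d.mat r c = u i

open Classical in
/-- The diagram `d` with only those edges kept that end in a bottom vertex from `C`. -/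
noncomputable def keep {n m : ℕ} (d : P n m) (C : Finset (Fin m)) : P n m where
  mat := Matrix.of fun r c => if c ∈ C then d.mat r c else 0
  isPlanar := by
    have key : ∀ {r c}, (if c ∈ C then d.mat r c else 0) ≠ 0 → d.mat r c ≠ 0 := by
      intro r c h
      split_ifs at h
      · exact h
      · exact absurd rfl h
    refine ⟨?_, ?_, ?_, ?_⟩
    · intro r c
      simp only [Matrix.of_apply]
      split_ifs
      · exact d.isPlanar.entry r c
      · exact Or.inl rfl
    · intro r c c' h h'
      exact d.isPlanar.row r c c' (key h) (key h')
    · intro r r' c h h'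
      exact d.isPlanar.col r r' c (key h) (key h')
    · rintro i r s c e hrs hce ⟨-, h2, h3, -⟩
      simp only [Matrix.of_apply] at h2 h3
      have ne : ∀ {v : Fin n → ZMod 2}, v = u i → v ≠ 0 := fun h => h ▸ u_ne_zero _
      have n2 := key (ne h2)
      have n3 := key (ne h3)
      have h2' : d.mat r e = u i := by split_ifs at h2; exacts [h2, absurd h2.symm (u_ne_zero i)]
      have h3' : d.mat s c = u i := by split_ifs at h3; exacts [h3, absurd h3.symm (u_ne_zero i)]
      refine d.isPlanar.planar i r s c e hrs hce ⟨?_, h2', h3', ?_⟩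
      · by_contra h; exact hce.ne (d.isPlanar.row r c e h n2)
      · by_contra h; exact hce.ne (d.isPlanar.row s c e n3 h)

open Classical in
/-- The bottom vertices that are not isolated. -/
noncomputable def supp {n m : ℕ} (d : P n m) : Finset (Fin m) :=
  Finset.univ.filter fun c => ∃ r, d.mat r c ≠ 0

theorem mem_supp {n m : ℕ} {d : P n m} {c : Fin m} : c ∈ supp d ↔ ∃ r, d.mat r c ≠ 0 := by
  simp [supp]

theorem keep_mat {n m : ℕ} (d : P n m) (C : Finset (Fin m)) (r c : Fin m) [Decidable (c ∈ C)] :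
    (keep d C).mat r c = if c ∈ C then d.mat r c else 0 := by
  simp only [keep, Matrix.of_apply]
  congr

theorem supp_keep {n m : ℕ} (d : P n m) {C : Finset (Fin m)} (hC : C ⊆ supp d) :
    supp (keep d C) = C := by
  classical
  ext c
  simp only [mem_supp, keep_mat]
  constructor
  · rintro ⟨r, hr⟩
    by_contra h
    simp [h] at hr
  · intro h
    obtain ⟨r, hr⟩ := mem_supp.1 (hC h)
    exact ⟨r, by simpa [h] using hr⟩

theorem isSub_keep {n m : ℕ} (d : P n m) (C : Finset (Fin m)) : IsSub (keep d C) d := by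
  classical
  intro r c
  rw [keep_mat]
  split_ifs
  · exact Or.inr rfl
  · exact Or.inl rfl

theorem IsSub.supp_subset {n m : ℕ} {d' d : P n m} (h : IsSub d' d) : supp d' ⊆ supp d := by
  intro c hc
  obtain ⟨r, hr⟩ := mem_supp.1 hc
  exact mem_supp.2 ⟨r, (h r c).resolve_left hr ▸ hr⟩

theorem IsSub.keep_supp {n m : ℕ} {d' d : P n m} (h : IsSub d' d) : keep d (supp d') = d' := by
  classical
  apply P.ext
  ext1 r c
  rw [keep_mat]
  split_ifs with hc
  · obtain ⟨s, hs⟩ := mem_supp.1 hc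
    have h1 := (h s c).resolve_left hs
    rcases h r c with h2 | h2
    · by_cases h3 : d.mat r c = 0
      · rw [h2, h3]
      · have := d.isPlanar.col r s c h3 (h1 ▸ hs)
        subst this
        exact absurd h2 hs
    · exact h2.symm
  · by_contra h4
    exact hc (mem_supp.2 ⟨r, fun h5 => h4 h5.symm⟩)

theorem size_eq {n m : ℕ} (d : P n m) : size d = (supp d).card := by
  classical
  unfold size
  apply Finset.card_bij (fun p _ => p.2)
  · intro p hp
    exact mem_supp.2 ⟨p.1, (Finset.mem_filter.1 hp).2⟩
  · rintro ⟨r, c⟩ hp ⟨s, c'⟩ hq h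
    simp only at h
    subst h
    rw [d.isPlanar.col r s c (Finset.mem_filter.1 hp).2 (Finset.mem_filter.1 hq).2]
  · intro c hc
    obtain ⟨r, hr⟩ := mem_supp.1 hc
    exact ⟨(r, c), Finset.mem_filter.2 ⟨Finset.mem_univ _, hr⟩, rfl⟩

theorem x_eq {n m : ℕ} (d : P n m) :
    x d = ∑ C ∈ (supp d).powerset,
      MonoidAlgebra.single (keep d C) ((-1) ^ ((supp d).card - C.card)) := by
  classical
  unfold x
  symm
  apply Finset.sum_bij (fun C _ => keep d C)
  · intro C _
    exact Finset.mem_filter.2 ⟨Finset.mem_univ _, isSub_keep d C⟩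
  · intro C hC C' hC' h
    rw [← supp_keep d (Finset.mem_powerset.1 hC), h, supp_keep d (Finset.mem_powerset.1 hC')]
  · intro d' hd'
    have h := (Finset.mem_filter.1 hd').2
    exact ⟨supp d', Finset.mem_powerset.2 h.supp_subset, h.keep_supp⟩
  · intro C hC
    rw [size_eq, size_eq, supp_keep d (Finset.mem_powerset.1 hC)]

theorem mul_keep {n m : ℕ} (d' d : P n m) (C : Finset (Fin m)) :
    d' * keep d C = keep (d' * d) C := by
  classical
  apply P.ext
  ext1 r c
  rw [keep_mat, P.mul_mat, P.mul_mat, Matrix.mul_apply, Matrix.mul_apply]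
  simp only [keep_mat]
  split_ifs <;> simp

theorem supp_mul_subset {n m : ℕ} (d' d : P n m) : supp (d' * d) ⊆ supp d := by
  intro c hc
  obtain ⟨r, hr⟩ := mem_supp.1 hc
  rw [P.mul_mat] at hr
  obtain ⟨i, hi⟩ := ((d'.isPlanar.mul_eq_u_iff d.isPlanar r c).1).resolve_left hr
  obtain ⟨k, -, hk⟩ := ((d'.isPlanar.mul_eq_u_iff d.isPlanar r c).2 i).1 hi
  exact mem_supp.2 ⟨k, hk ▸ u_ne_zero i⟩

theorem bottom_mul {n m : ℕ} {d' d : P n m} (h : supp (d' * d) = supp d) :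
    bottom (d' * d) = bottom d := by
  classical
  funext i
  have hz : ∀ e : P n m, ∀ c, (∀ r, e.mat r c = 0) ↔ c ∉ supp e := by
    intro e c; rw [mem_supp]; push Not; rfl
  refine Fin.cases ?_ (fun i => ?_) i
  · ext c
    simp only [bottom, Fin.cases_zero, Finset.mem_filter, Finset.mem_univ, true_and, hz, h]
  · ext c
    simp only [bottom, Fin.cases_succ, Finset.mem_filter, Finset.mem_univ, true_and]
    have fwd : ∀ i, (∃ r, (d' * d).mat r c = u i) → ∃ r, d.mat r c = u i := by
      rintro i ⟨r, hr⟩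
      rw [P.mul_mat] at hr
      obtain ⟨k, -, hk⟩ := ((d'.isPlanar.mul_eq_u_iff d.isPlanar r c).2 i).1 hr
      exact ⟨k, hk⟩
    refine ⟨fwd i, ?_⟩
    rintro ⟨r, hr⟩
    have hc : c ∈ supp (d' * d) := h ▸ mem_supp.2 ⟨r, hr ▸ u_ne_zero i⟩
    obtain ⟨s, hs⟩ := mem_supp.1 hc
    obtain ⟨j, hj⟩ := ((d' * d).isPlanar.entry s c).resolve_left hs
    obtain ⟨t, ht⟩ := fwd j ⟨s, hj⟩
    have := d.isPlanar.col r t c (hr ▸ u_ne_zero i) (ht ▸ u_ne_zero j)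
    subst this
    have := u_inj (hr.symm.trans ht)
    subst this
    exact ⟨s, hj⟩

theorem single_mul_x {n m : ℕ} (d' d : P n m) (z : ℂ) :
    MonoidAlgebra.single d' z * x d = if supp (d' * d) = supp d then z • x (d' * d) else 0 := by
  classical
  split_ifs with h
  · rw [x_eq, x_eq, Finset.mul_sum, Finset.smul_sum, h]
    refine Finset.sum_congr rfl fun C _ => ?_
    rw [MonoidAlgebra.single_mul_single, mul_keep, MonoidAlgebra.smul_single, smul_eq_mul]
  · obtain ⟨c, hc, hc'⟩ : ∃ c ∈ supp d, c ∉ supp (d' * d) := by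
      by_contra h'
      push Not at h'
      exact h (Finset.Subset.antisymm (supp_mul_subset d' d) h')
    have hk : ∀ C : Finset (Fin m), keep (d' * d) (insert c C) = keep (d' * d) C := by
      intro C
      apply P.ext
      ext1 r b
      rw [keep_mat, keep_mat]
      by_cases hb : b = c
      · subst hb
        have : (d' * d).mat r b = 0 := by
          by_contra h'; exact hc' (mem_supp.2 ⟨r, h'⟩)
        simp [this]
      · simp [hb]
    rw [x_eq, ← Finset.insert_erase hc, Finset.sum_powerset_insert (Finset.notMem_erase c _),
      ← Finset.sum_add_distrib, Finset.mul_sum]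
    refine Finset.sum_eq_zero fun C hC => ?_
    have hCs := Finset.mem_powerset.1 hC
    have hcC : c ∉ C := fun h' => Finset.notMem_erase c _ (hCs h')
    have hle := Finset.card_le_card hCs
    rw [mul_add, MonoidAlgebra.single_mul_single, MonoidAlgebra.single_mul_single, mul_keep,
      mul_keep, hk, ← MonoidAlgebra.single_add, Finset.card_insert_of_notMem hcC,
      Finset.card_insert_of_notMem (Finset.notMem_erase c _), Nat.add_sub_add_right,
      Nat.succ_sub hle, pow_succ]
    simp

/-- The left ideal `W_T` of `ℂP_m`: the span of all `x_d` with `β(d) = T`. -/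
noncomputable def W {n m : ℕ} (T : Fin (n + 1) → Finset (Fin m)) : Submodule (CP n m) (CP n m) :=
  { Submodule.span ℂ {a : CP n m | ∃ d : P n m, bottom d = T ∧ x d = a} with
    smul_mem' := by
      intro a b hb
      simp only [AddSubsemigroup.mem_carrier, AddSubmonoid.mem_toSubsemigroup,
        Submodule.mem_toAddSubmonoid] at hb ⊢
      induction hb using Submodule.span_induction with
      | zero => rw [smul_zero]; exact Submodule.zero_mem _
      | add b b' _ _ h h' => rw [smul_add]; exact Submodule.add_mem _ h h'
      | smul z b _ h => rw [smul_comm]; exact Submodule.smul_mem _ z h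
      | mem b hb =>
        obtain ⟨d, hd, rfl⟩ := hb
        induction a using MonoidAlgebra.induction_linear with
        | zero => rw [zero_smul]; exact Submodule.zero_mem _
        | add f g hf hg => rw [add_smul]; exact Submodule.add_mem _ hf hg
        | single d' z =>
          rw [smul_eq_mul, single_mul_x]
          split_ifs with h
          · exact Submodule.smul_mem _ z (Submodule.subset_span ⟨_, (bottom_mul h).trans hd, rfl⟩)
          · exact Submodule.zero_mem _ }

/-- The tuple of consecutive blocks of sizes `c 0, …, c n`. -/
def blocks {n : ℕ} (m : ℕ) (c : Fin (n + 1) → ℕ) : Fin (n + 1) → Finset (Fin m) :=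
  fun i => Finset.univ.filter fun t => (∑ j ∈ Finset.Iio i, c j) ≤ t ∧ t < ∑ j ∈ Finset.Iic i, c j


/-- The module `W^m_{c_0, …, c_n}`, for `m = c_0 + ⋯ + c_n`. -/
noncomputable def stdW {n : ℕ} (m : ℕ) (c : Fin (n + 1) → ℕ) : Submodule (CP n m) (CP n m) :=
  W (blocks m c)

/-! ### Finite-dimensional modules -/

/-- A finite-dimensional (unital, left) module over a `ℂ`-algebra. -/
structure FDMod (A : Type) [Ring A] [Algebra ℂ A] : Type 1 where
  carrier : Type
  [addCommGroup : AddCommGroup carrier]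
  [moduleC : Module ℂ carrier]
  [module : Module A carrier]
  [tower : IsScalarTower ℂ A carrier]
  [finite : FiniteDimensional ℂ carrier]

attribute [instance] FDMod.addCommGroup FDMod.moduleC FDMod.module FDMod.tower FDMod.finite

/-- Isomorphism of irreducible finite-dimensional modules. -/
instance irrSetoid (A : Type) [Ring A] [Algebra ℂ A] :
    Setoid {M : FDMod A // IsSimpleModule A M.carrier} where
  r M N := Nonempty (M.1.carrier ≃ₗ[A] N.1.carrier)
  iseqv := ⟨fun _ => ⟨LinearEquiv.refl _ _⟩, fun ⟨f⟩ => ⟨f.symm⟩, fun ⟨f⟩ ⟨g⟩ => ⟨f.trans g⟩⟩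

/-- The set of all isomorphism classes of irreducible finite-dimensional modules. -/
def IrrClass (A : Type) [Ring A] [Algebra ℂ A] : Type 1 :=
  Quotient (irrSetoid A)

open Classical in
/-- The isomorphism class `[M]` of an irreducible module `M`; `none`, which plays the role of `0`,
for the other modules (the zero module among them). -/
noncomputable def FDMod.cls {A : Type} [Ring A] [Algebra ℂ A] (M : FDMod A) :
    Option (IrrClass A) :=
  if h : IsSimpleModule A M.carrier then some (Quotient.mk (irrSetoid A) ⟨M, h⟩) else none

section Functors

variable {A B : Type} [Ring A] [Algebra ℂ A] [Ring B] [Algebra ℂ B]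

/-- The subspace `e M`, where `e = ψ(1)`. -/
def resSpace (ψ : A →ₙₐ[ℂ] B) (M : FDMod B) : Submodule ℂ M.carrier :=
  LinearMap.range (Algebra.lsmul ℂ ℂ M.carrier (ψ 1))

theorem psi_smul_mem (ψ : A →ₙₐ[ℂ] B) (M : FDMod B) (a : A) (y : M.carrier) :
    ψ a • y ∈ resSpace ψ M := by
  refine ⟨ψ a • y, ?_⟩
  change ψ 1 • ψ a • y = ψ a • y
  rw [smul_smul, ← map_mul, one_mul]

theorem psi_one_smul (ψ : A →ₙₐ[ℂ] B) (M : FDMod B) {y : M.carrier} (hy : y ∈ resSpace ψ M) :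
    ψ 1 • y = y := by
  obtain ⟨z, rfl⟩ := hy
  exact (smul_smul (ψ 1) (ψ 1) z).trans (by rw [← map_mul, one_mul]; rfl)

/-- The action of `A` on `e M` through `ψ`. -/
abbrev resModule (ψ : A →ₙₐ[ℂ] B) (M : FDMod B) : Module A (resSpace ψ M) where
  smul a y := ⟨ψ a • (y : M.carrier), psi_smul_mem ψ M a y⟩
  one_smul y := Subtype.ext (psi_one_smul ψ M y.2)
  mul_smul a b y := Subtype.ext (by
    change ψ (a * b) • (y : M.carrier) = ψ a • ψ b • (y : M.carrier)
    rw [map_mul, mul_smul])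
  smul_zero a := Subtype.ext (smul_zero (ψ a))
  smul_add a y z := Subtype.ext (smul_add (ψ a) (y : M.carrier) z)
  add_smul a b y := Subtype.ext (by
    change ψ (a + b) • (y : M.carrier) = ψ a • (y : M.carrier) + ψ b • (y : M.carrier)
    rw [map_add, add_smul])
  zero_smul y := Subtype.ext (by
    change ψ 0 • (y : M.carrier) = 0
    rw [map_zero, zero_smul])

/-- Restriction along an algebra homomorphism `ψ : A → B` that need not preserve the identity
element: the `A`-module `e M`, where `e = ψ(1)` and `a ∈ A` acts by `ψ(a)`. -/
def Res (ψ : A →ₙₐ[ℂ] B) (M : FDMod B) : FDMod A :=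
  letI : Module A (resSpace ψ M) := resModule ψ M
  { carrier := resSpace ψ M
    tower := ⟨fun z a y => Subtype.ext (by
      change ψ (z • a) • (y : M.carrier) = z • ψ a • (y : M.carrier)
      rw [map_smul, smul_assoc])⟩
    finite := inferInstance }

/-- The relations `b ψ(a) ⊗ y = b ⊗ a y` that turn `B ⊗_ℂ M` into `B ⊗_A M`. -/
def indRel (ψ : A →ₙₐ[ℂ] B) (M : FDMod A) : Submodule B (TensorProduct ℂ B M.carrier) :=
  Submodule.span B {t | ∃ (b : B) (a : A) (y : M.carrier),
    t = TensorProduct.tmul ℂ (b * ψ a) y - TensorProduct.tmul ℂ b (a • y)}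

/-- Induction along an algebra homomorphism `ψ : A → B` that need not preserve the identity
element: the `B`-module `B ⊗_A M`, where `A` acts on the right of `B` through `ψ`. -/
noncomputable def Ind [FiniteDimensional ℂ B] (ψ : A →ₙₐ[ℂ] B) (M : FDMod A) : FDMod B where
  carrier := TensorProduct ℂ B M.carrier ⧸ indRel ψ M
  finite :=
    inferInstanceAs (Module.Finite ℂ (TensorProduct ℂ B M.carrier ⧸ indRel ψ M))

end Functors

/-- `W^m_{c_0, …, c_n}` as an object of the category of finite-dimensional `ℂP_m`-modules. -/
noncomputable def stdMod {n : ℕ} (m : ℕ) (c : Fin (n + 1) → ℕ) : FDMod (CP n m) where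
  carrier := stdW m c
  finite := inferInstanceAs (FiniteDimensional ℂ ((stdW m c).restrictScalars ℂ))

/-- The functor `Res_{i,m+1} ∘ Ind_{i-1,m+1}` (on objects). The index `i : Fin n` stands for the
element `i + 1` of `{1, …, n}`; so `i.succ` and `i.castSucc` stand for `i` and `i - 1` in
`{0, …, n}`. -/
noncomputable def funE {n m : ℕ} (i : Fin n) (M : FDMod (CP n m)) : FDMod (CP n m) :=
  Res (psi m i.succ) (Ind (psi m i.castSucc) M)

/-- The functor `Res_{i-1,m+1} ∘ Ind_{i,m+1}` (on objects). -/
noncomputable def funF {n m : ℕ} (i : Fin n) (M : FDMod (CP n m)) : FDMod (CP n m) :=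
  Res (psi m i.castSucc) (Ind (psi m i.succ) M)

section Tensor

open scoped TensorProduct

variable {k : ℕ} {A : Fin k → Type} [∀ j, Ring (A j)] [∀ j, Algebra ℂ (A j)]

/-- The action of `A_1 ⊗ ⋯ ⊗ A_k` on `M_1 ⊗ ⋯ ⊗ M_k`, factor by factor. -/
noncomputable def tensorAction (M : ∀ j, FDMod (A j)) :
    (⨂[ℂ] j, A j) →ₐ[ℂ] Module.End ℂ (⨂[ℂ] j, (M j).carrier) :=
  PiTensorProduct.liftAlgHom
    ((PiTensorProduct.mapMultilinear ℂ (fun j => (M j).carrier)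
      (fun j => (M j).carrier)).compLinearMap
        fun j => (Algebra.lsmul ℂ ℂ (M j).carrier).toLinearMap)
    (by
      ext y
      simp)
    (by
      intro a b
      ext y
      simp)

theorem tensorAction_tprod (M : ∀ j, FDMod (A j)) (a : ∀ j, A j) (y : ∀ j, (M j).carrier) :
    tensorAction M (PiTensorProduct.tprod ℂ a) (PiTensorProduct.tprod ℂ y)
      = PiTensorProduct.tprod ℂ fun j => a j • y j := by
  simp [tensorAction]

/-- The module `M_1 ⊗ ⋯ ⊗ M_k` over `A_1 ⊗ ⋯ ⊗ A_k`. -/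
noncomputable def tensorMod (M : ∀ j, FDMod (A j)) : FDMod (⨂[ℂ] j, A j) :=
  letI : Module (⨂[ℂ] j, A j) (⨂[ℂ] j, (M j).carrier) :=
    Module.compHom _ (tensorAction M).toRingHom
  { carrier := ⨂[ℂ] j, (M j).carrier
    tower := ⟨fun z a y => by
      change tensorAction M (z • a) y = z • tensorAction M a y
      rw [map_smul]
      rfl⟩
    finite := inferInstance }

end Tensor

/-! ### Crystals -/

/-- The data of a `gl_{n+1}`-crystal; `none` plays the role of `0`. A weight is the tuple of its
coordinates with respect to `ϵ_1, …, ϵ_{n+1}`. The index `i : Fin n` of an operator stands for the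
element `i + 1` of `{1, …, n}`, so that `i.castSucc` and `i.succ` are the positions of `ϵ_i` and
`ϵ_{i+1}`. -/
structure CrystalData.{v} (n : ℕ) where
  B : Type v
  wt : B → Fin (n + 1) → ℤ
  ε : Fin n → B → WithBot ℤ
  φ : Fin n → B → WithBot ℤ
  e : Fin n → B → Option B
  f : Fin n → B → Option B

/-- The value of a weight on `E_{ii} - E_{i+1,i+1}`. -/
def pairing {n : ℕ} (i : Fin n) (w : Fin (n + 1) → ℤ) : ℤ := w i.castSucc - w i.succ

/-- The simple root `ϵ_i - ϵ_{i+1}`. -/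
def root {n : ℕ} (i : Fin n) : Fin (n + 1) → ℤ := Pi.single i.castSucc 1 - Pi.single i.succ 1

/-- The axioms of a crystal. -/
structure CrystalData.IsCrystal.{v} {n : ℕ} (C : CrystalData.{v} n) : Prop where
  phi_eq : ∀ i b, C.φ i b = C.ε i b + ((pairing i (C.wt b) : ℤ) : WithBot ℤ)
  wt_e : ∀ i b b', C.e i b = some b' → C.wt b' = C.wt b + root i
  wt_f : ∀ i b b', C.f i b = some b' → C.wt b' = C.wt b - root i
  f_iff_e : ∀ i b₁ b₂, C.f i b₂ = some b₁ ↔ C.e i b₁ = some b₂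
  of_bot : ∀ i b, C.ε i b = ⊥ → C.e i b = none ∧ C.f i b = none

/-- `ψ` preserves `wt`, `ε_i`, `φ_i` and commutes with all `e_i` and `f_i` (with `ψ(0) = 0`). -/
structure CrystalData.IsStrictMorphism.{v, w} {n : ℕ} (C : CrystalData.{v} n)
    (D : CrystalData.{w} n) (ψ : C.B → D.B) : Prop where
  wt : ∀ b, D.wt (ψ b) = C.wt b
  ε : ∀ i b, D.ε i (ψ b) = C.ε i b
  φ : ∀ i b, D.φ i (ψ b) = C.φ i b
  e : ∀ i b, D.e i (ψ b) = (C.e i b).map ψ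
  f : ∀ i b, D.f i (ψ b) = (C.f i b).map ψ

/-- Two vertices of the crystal graph lie in the same connected component. -/
def CrystalData.Connected.{v} {n : ℕ} (C : CrystalData.{v} n) : C.B → C.B → Prop :=
  Relation.EqvGen fun b₁ b₂ => ∃ i, C.f i b₁ = some b₂

open Classical in
/-- The connected component of `b₀` in the crystal graph, with the restricted structure. -/
noncomputable def CrystalData.component.{v} {n : ℕ} (C : CrystalData.{v} n) (b₀ : C.B) :
    CrystalData.{v} n where
  B := {b : C.B // C.Connected b₀ b}
  wt b := C.wt b.1
  ε i b := C.ε i b.1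
  φ i b := C.φ i b.1
  e i b := (C.e i b.1).bind fun b' => if h : C.Connected b₀ b' then some ⟨b', h⟩ else none
  f i b := (C.f i b.1).bind fun b' => if h : C.Connected b₀ b' then some ⟨b', h⟩ else none

/-! ### The crystals `B(ϵ_1)^{⊗ N}` -/

/-- The crystal `B(ϵ_1)`: boxes with entries in `{0, …, n}`. -/
def boxes (n : ℕ) : CrystalData.{0} n where
  B := Fin (n + 1)
  wt j := Pi.single j 1
  ε i j := if j = i.succ then 1 else 0
  φ i j := if j = i.castSucc then 1 else 0
  e i j := if j = i.succ then some i.castSucc else none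
  f i j := if j = i.castSucc then some i.succ else none

/-- The weight of `b_1 ⊗ ⋯ ⊗ b_N`. -/
def wordWt {n : ℕ} : List (Fin (n + 1)) → Fin (n + 1) → ℤ
  | [] => 0
  | b :: w => (boxes n).wt b + wordWt w

/-- `ε_i(b ⊗ w) = max {ε_i(b), ε_i(w) - wt(b)(E_{ii} - E_{i+1,i+1})}`. -/
def wordEps {n : ℕ} (i : Fin n) : List (Fin (n + 1)) → WithBot ℤ
  | [] => 0
  | b :: w => max ((boxes n).ε i b)
      (wordEps i w + ((-pairing i ((boxes n).wt b) : ℤ) : WithBot ℤ))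

/-- `φ_i(b ⊗ w) = max {φ_i(w), φ_i(b) + wt(w)(E_{ii} - E_{i+1,i+1})}`. -/
def wordPhi {n : ℕ} (i : Fin n) : List (Fin (n + 1)) → WithBot ℤ
  | [] => 0
  | b :: w => max (wordPhi i w)
      ((boxes n).φ i b + ((pairing i (wordWt w) : ℤ) : WithBot ℤ))

open Classical in
/-- `e_i(b ⊗ w)` is `e_i(b) ⊗ w` if `φ_i(b) ≥ ε_i(w)`, and `b ⊗ e_i(w)` otherwise. -/
noncomputable def wordE {n : ℕ} (i : Fin n) : List (Fin (n + 1)) → Option (List (Fin (n + 1)))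
  | [] => none
  | b :: w =>
      if wordEps i w ≤ (boxes n).φ i b then ((boxes n).e i b).map fun b' : Fin (n + 1) => b' :: w
      else (wordE i w).map fun w' => b :: w'

open Classical in
/-- `f_i(b ⊗ w)` is `f_i(b) ⊗ w` if `φ_i(b) > ε_i(w)`, and `b ⊗ f_i(w)` otherwise. -/
noncomputable def wordF {n : ℕ} (i : Fin n) : List (Fin (n + 1)) → Option (List (Fin (n + 1)))
  | [] => none
  | b :: w =>
      if wordEps i w < (boxes n).φ i b then ((boxes n).f i b).map fun b' : Fin (n + 1) => b' :: w
      else (wordF i w).map fun w' => b :: w'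

/-- The disjoint union of the tensor powers `B(ϵ_1)^{⊗ N}`, `N ≥ 0`: the list `[b_1, …, b_N]` stands
for `b_1 ⊗ (b_2 ⊗ ⋯ (b_N ⊗ 1))`, where the empty word `1` is the only element of the crystal of the
trivial module. -/
noncomputable def words (n : ℕ) : CrystalData.{0} n where
  B := List (Fin (n + 1))
  wt := wordWt
  ε := wordEps
  φ := wordPhi
  e := wordE
  f := wordF

/-! ### The crystal `B(λ)` -/

/-- Semistandard tableaux of shape `μ` with entries in `{0, …, n}`. -/
def Tableau (n : ℕ) (μ : YoungDiagram) : Type :=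
  {T : SemistandardYoungTableau μ // ∀ r c, T r c ≤ n}

/-- The entry in row `r` and column `c`. -/
def Tableau.get {n : ℕ} {μ : YoungDiagram} (T : Tableau n μ) (r c : ℕ) : Fin (n + 1) :=
  ⟨T.1 r c, Nat.lt_succ_of_le (T.2 r c)⟩

/-- The Middle-Eastern reading: the rows from top to bottom, each row from right to left. -/
def Tableau.reading {n : ℕ} {μ : YoungDiagram} (T : Tableau n μ) : List (Fin (n + 1)) :=
  (List.range (μ.colLen 0)).flatMap fun r =>
    ((List.range (μ.rowLen r)).reverse).map fun c => T.get r c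

open Classical in
/-- The crystal `B(λ)`: the structure of `B(ϵ_1)^{⊗ |λ|}` is lifted to the semistandard tableaux of
shape `λ` along the Middle-Eastern reading. -/
noncomputable def tableaux (n : ℕ) (μ : YoungDiagram) : CrystalData.{0} n where
  B := Tableau n μ
  wt T := (words n).wt T.reading
  ε i T := (words n).ε i T.reading
  φ i T := (words n).φ i T.reading
  e i T := if h : ∃ T' : Tableau n μ, (words n).e i T.reading = some T'.reading
    then some h.choose else none
  f i T := if h : ∃ T' : Tableau n μ, (words n).f i T.reading = some T'.reading
    then some h.choose else none

/-- The number of entries `i` in row `r`. -/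
def Tableau.content {n : ℕ} {μ : YoungDiagram} (T : Tableau n μ) (r : ℕ) (i : Fin (n + 1)) : ℕ :=
  ((Finset.range (μ.rowLen r)).filter fun c => T.get r c = i).card

/-! ### The crystal `[C_λ]` -/

section Modules

open scoped TensorProduct

variable {k : ℕ}

/-- The algebra `ℂP_λ = ℂP_{λ_1} ⊗ ⋯ ⊗ ℂP_{λ_k}`. -/
abbrev CPl (n : ℕ) (l : Fin k → ℕ) : Type := ⨂[ℂ] j, CP n (l j)

/-- The set `[C_λ]` of the isomorphism classes of irreducible finite-dimensional
`ℂP_λ`-modules. -/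
abbrev Cls (n : ℕ) (l : Fin k → ℕ) : Type 1 := IrrClass (CPl n l)

/-- The class of `W^{λ_1}_{c_{10}, …, c_{1n}} ⊗ ⋯ ⊗ W^{λ_k}_{c_{k0}, …, c_{kn}}`. -/
noncomputable def clsW {n : ℕ} (l : Fin k → ℕ) (c : Fin k → Fin (n + 1) → ℕ) :
    Option (Cls n l) :=
  (tensorMod fun j => stdMod (l j) (c j)).cls

/-- `X` is the class of the tensor product of the modules `W^{λ_j}_{c_{j0}, …, c_{jn}}`, where
`λ_j = c_{j0} + ⋯ + c_{jn}`. -/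
def IsLabel {n : ℕ} {l : Fin k → ℕ} (X : Cls n l) (c : Fin k → Fin (n + 1) → ℕ) : Prop :=
  (∀ j, ∑ i, c j i = l j) ∧ clsW l c = some X

open Classical in
/-- The numbers `c_{ji}` that belong to a class: every irreducible `ℂP_λ`-module is isomorphic to
exactly one of the tensor products in `IsLabel`. -/
noncomputable def label {n : ℕ} {l : Fin k → ℕ} (X : Cls n l) : Fin k → Fin (n + 1) → ℕ :=
  if h : ∃ c, IsLabel X c then h.choose else 0

/-- The signature: for each component `j` in turn, `c_{ji}` signs `-` and then `c_{j,i-1}` signs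
`+`. A sign is kept together with its component; `false` stands for `-` and `true` for `+`. -/
def signature {n : ℕ} (c : Fin k → Fin (n + 1) → ℕ) (i : Fin n) : List (Bool × Fin k) :=
  (List.finRange k).flatMap fun j =>
    List.replicate (c j i.succ) (false, j) ++ List.replicate (c j i.castSucc) (true, j)

/-- Deletion of all `(+,-)`-pairs, as long as there are adjacent ones. -/
def cancel : List (Bool × Fin k) → List (Bool × Fin k)
  | [] => []
  | a :: w =>
    match a.1, cancel w with
    | true, (false, _) :: w' => w'
    | _, w' => a :: w'

/-- The component of the rightmost `-` of the reduced signature. -/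
def minusPos {n : ℕ} (c : Fin k → Fin (n + 1) → ℕ) (i : Fin n) : Option (Fin k) :=
  (((cancel (signature c i)).filter fun a => !a.1).getLast?).map Prod.snd

/-- The component of the leftmost `+` of the reduced signature. -/
def plusPos {n : ℕ} (c : Fin k → Fin (n + 1) → ℕ) (i : Fin n) : Option (Fin k) :=
  (((cancel (signature c i)).filter fun a => a.1).head?).map Prod.snd

/-- Apply the functor `E_i` to the component of the rightmost `-` (`0` if there is no `-`). -/
noncomputable def opE {n : ℕ} {l : Fin k → ℕ} (i : Fin n) (X : Cls n l) : Option (Cls n l) :=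
  (minusPos (label X) i).bind fun s =>
    (tensorMod (Function.update (fun j => stdMod (l j) (label X j)) s
      (funE i (stdMod (l s) (label X s))))).cls

/-- Apply the functor `F_i` to the component of the leftmost `+` (`0` if there is no `+`). -/
noncomputable def opF {n : ℕ} {l : Fin k → ℕ} (i : Fin n) (X : Cls n l) : Option (Cls n l) :=
  (plusPos (label X) i).bind fun t =>
    (tensorMod (Function.update (fun j => stdMod (l j) (label X j)) t
      (funF i (stdMod (l t) (label X t))))).cls

/-- `j`-fold application of an operator that may take the value `0`. -/
def iter {B : Type*} (g : B → Option B) : ℕ → B → Option B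
  | 0, b => some b
  | j + 1, b => (iter g j b).bind g

/-- The crystal `[C_λ]`. -/
noncomputable def classes (n : ℕ) (l : Fin k → ℕ) : CrystalData.{1} n where
  B := Cls n l
  wt X i := ∑ j, (label X j i : ℤ)
  ε i X := ((sSup {j : ℕ | iter (opE i) j X ≠ none} : ℕ) : ℤ)
  φ i X := ((sSup {j : ℕ | iter (opF i) j X ≠ none} : ℕ) : ℤ)
  e := opE
  f := opF

end Modules

end PlanarRook

namespace PlanarRook

/-! ### The crystal of words -/

section Words

variable {n : ℕ} {i : Fin n}

/-! The crystal of tableaux and the crystal of isomorphism classes both embed strictly into the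
crystal of words, and they are compared there. A tableau and an irreducible class are each
determined by an array `c`, where `c j b` counts the letters `b` in row `j`. Reading the rows in
turn, each in weakly decreasing order, turns an array into a word. For a tableau this is the
Middle-Eastern reading (`Tableau.reading_eq`); for a class it is `classReading`. The crystal axioms
are checked once, for words, and pulled back along the embeddings.

Combinatorics. The recursive tensor product rule is the signature rule: the operators change the
letter at the rightmost surviving `-` or the leftmost surviving `+` (`wordE_tagged`,
`wordF_tagged`), and the new word is again the word of an array (`wordE_arrayReading`,
`wordF_arrayReading`). Column strictness is a system of inequalities between partial sums of
adjacent rows. It survives because a sign that is not cancelled forces a strict inequality between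
two entries of the array (`lt_of_minusPos`, `lt_of_plusPos`). The only semistandard array killed by
all raising operators has `j` throughout row `j` (`IsStrictArray.eq_single`), so every tableau is
connected to that one.

Algebra. The tensor products of the idempotents `I_0` and `I_i - I_0` are indexed by words and
decompose the identity of `ℂP_m` into primitive idempotents; two of them belong to the same simple
module exactly when the words have equal letter counts (`cpSystem`). This classifies the irreducible
modules and passes to tensor products (`IdemSystem.tensor`). The embedding `ψ_b` appends the letter
`b` to the word of an idempotent (`psi_wordIdem`). Hence induction along `ψ_b` adds a letter `b`,
restriction along `ψ_a` removes a letter `a` (`isStd_Res_Ind_stdMod`), and the functors act on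
labels as the operators act on words.

Finally, the image of a strict morphism is a union of connected components. The tableaux form a
single connected piece, so their image is exactly one component. -/

theorem castSucc_ne_succ' (i : Fin n) : i.castSucc ≠ i.succ := i.castSucc_lt_succ.ne

/-- `ε_i` of a word, as a natural number. -/
def epsNat (i : Fin n) : List (Fin (n + 1)) → ℕ
  | [] => 0
  | b :: w =>
      if b = i.succ then epsNat i w + 1
      else if b = i.castSucc then epsNat i w - 1 else epsNat i w

/-- `φ_i` of a word, as a natural number. -/
def phiNat (i : Fin n) : List (Fin (n + 1)) → ℕ
  | [] => 0
  | b :: w => if b = i.castSucc ∧ epsNat i w = 0 then phiNat i w + 1 else phiNat i w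

theorem epsNat_succ (w : List (Fin (n + 1))) : epsNat i (i.succ :: w) = epsNat i w + 1 := by
  simp [epsNat]

theorem epsNat_castSucc (w : List (Fin (n + 1))) :
    epsNat i (i.castSucc :: w) = epsNat i w - 1 := by
  simp [epsNat, castSucc_ne_succ']

theorem epsNat_of_ne {b : Fin (n + 1)} (h : b ≠ i.succ) (h' : b ≠ i.castSucc)
    (w : List (Fin (n + 1))) : epsNat i (b :: w) = epsNat i w := by
  simp [epsNat, h, h']

theorem phiNat_castSucc (w : List (Fin (n + 1))) :
    phiNat i (i.castSucc :: w) = if epsNat i w = 0 then phiNat i w + 1 else phiNat i w := by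
  simp [phiNat]

theorem phiNat_of_ne {b : Fin (n + 1)} (h' : b ≠ i.castSucc)
    (w : List (Fin (n + 1))) : phiNat i (b :: w) = phiNat i w := by
  simp [phiNat, h']

theorem phiNat_succ (w : List (Fin (n + 1))) : phiNat i (i.succ :: w) = phiNat i w :=
  phiNat_of_ne (castSucc_ne_succ' i).symm w

theorem pairing_single_succ : pairing i (Pi.single i.succ 1) = -1 := by
  simp [pairing, castSucc_ne_succ']

theorem pairing_single_castSucc : pairing i (Pi.single i.castSucc 1) = 1 := by
  simp [pairing, (castSucc_ne_succ' i).symm]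

theorem pairing_single_of_ne {b : Fin (n + 1)} (h : b ≠ i.succ) (h' : b ≠ i.castSucc) :
    pairing i (Pi.single b 1) = 0 := by
  simp [pairing, h.symm, h'.symm]

theorem pairing_add (v w : Fin (n + 1) → ℤ) : pairing i (v + w) = pairing i v + pairing i w := by
  simp only [pairing, Pi.add_apply]; ring

/-- For a letter `i.castSucc` in front, the maximum in the tensor rule is `max 0 (ε - 1)`, which is
the truncated subtraction in `epsNat`. -/
theorem wordEps_eq (w : List (Fin (n + 1))) : wordEps i w = ((epsNat i w : ℤ) : WithBot ℤ) := by
  induction w with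
  | nil => rfl
  | cons b w ih =>
    rw [wordEps, ih]
    by_cases h : b = i.succ
    · subst h
      rw [epsNat_succ]
      simp only [boxes, pairing_single_succ, if_true]
      norm_cast
      simp
    · by_cases h' : b = i.castSucc
      · subst h'
        rw [epsNat_castSucc]
        simp only [boxes, pairing_single_castSucc, if_neg h]
        norm_cast
        omega
      · rw [epsNat_of_ne h h']
        simp only [boxes, pairing_single_of_ne h h', if_neg h]
        norm_cast

/-- A letter `i.castSucc` in front either survives and raises `φ`, or cancels a `-` and lowers `ε`;
the difference grows by one in both cases. -/
theorem pairing_wordWt (w : List (Fin (n + 1))) :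
    pairing i (wordWt w) = (phiNat i w : ℤ) - epsNat i w := by
  induction w with
  | nil => simp [wordWt, pairing, epsNat, phiNat]
  | cons b w ih =>
    rw [wordWt, pairing_add, ih]
    by_cases h : b = i.succ
    · subst h
      rw [epsNat_succ, phiNat_succ]
      simp only [boxes, pairing_single_succ]
      push_cast
      ring
    · by_cases h' : b = i.castSucc
      · subst h'
        rw [epsNat_castSucc, phiNat_castSucc]
        simp only [boxes, pairing_single_castSucc]
        split_ifs <;> omega
      · rw [epsNat_of_ne h h', phiNat_of_ne h']
        simp only [boxes, pairing_single_of_ne h h']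
        ring

theorem wordPhi_eq (w : List (Fin (n + 1))) : wordPhi i w = ((phiNat i w : ℤ) : WithBot ℤ) := by
  induction w with
  | nil => rfl
  | cons b w ih =>
    rw [wordPhi, ih, pairing_wordWt]
    by_cases h' : b = i.castSucc
    · subst h'
      rw [phiNat_castSucc]
      simp only [boxes, if_true]
      norm_cast
      rw [Int.subNatNat_eq_coe]
      split_ifs <;> push_cast <;> omega
    · rw [phiNat_of_ne h']
      simp only [boxes, if_neg h']
      norm_cast
      rw [Int.subNatNat_eq_coe]
      omega

theorem wordE_succ (w : List (Fin (n + 1))) :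
    wordE i (i.succ :: w) = if epsNat i w = 0 then some (i.castSucc :: w)
      else (wordE i w).map fun w' => i.succ :: w' := by
  rw [wordE, wordEps_eq]
  have : (((epsNat i w : ℤ) : WithBot ℤ) ≤ 0) ↔ epsNat i w = 0 := by
    norm_cast
    omega
  simp [boxes, (castSucc_ne_succ' i).symm, this]

theorem wordF_succ (w : List (Fin (n + 1))) :
    wordF i (i.succ :: w) = (wordF i w).map fun w' => i.succ :: w' := by
  rw [wordF, wordEps_eq]
  have : ¬ (((epsNat i w : ℤ) : WithBot ℤ) < 0) := by
    norm_cast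
    omega
  simp [boxes, (castSucc_ne_succ' i).symm, this]

theorem wordF_castSucc (w : List (Fin (n + 1))) :
    wordF i (i.castSucc :: w) = if epsNat i w = 0 then some (i.succ :: w)
      else (wordF i w).map fun w' => i.castSucc :: w' := by
  rw [wordF, wordEps_eq]
  have : (((epsNat i w : ℤ) : WithBot ℤ) < 1) ↔ epsNat i w = 0 := by
    norm_cast
    omega
  simp [boxes, this]

theorem wordF_of_ne {b : Fin (n + 1)} (h' : b ≠ i.castSucc) (w : List (Fin (n + 1))) :
    wordF i (b :: w) = (wordF i w).map fun w' => b :: w' := by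
  rw [wordF, wordEps_eq]
  have : ¬ (((epsNat i w : ℤ) : WithBot ℤ) < 0) := by
    norm_cast
    omega
  simp [boxes, h', this]

theorem wordE_castSucc (w : List (Fin (n + 1))) :
    wordE i (i.castSucc :: w) = if epsNat i w ≤ 1 then none
      else (wordE i w).map fun w' => i.castSucc :: w' := by
  rw [wordE, wordEps_eq]
  have : (((epsNat i w : ℤ) : WithBot ℤ) ≤ 1) ↔ epsNat i w ≤ 1 := by
    norm_cast
  simp [boxes, castSucc_ne_succ', this]

theorem wordE_eq_none {w : List (Fin (n + 1))} : wordE i w = none ↔ epsNat i w = 0 := by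
  induction w with
  | nil => simp [wordE, epsNat]
  | cons b w ih =>
    by_cases h : b = i.succ
    · subst h
      rw [wordE_succ, epsNat_succ]
      split_ifs with h0 <;> simp [ih, h0]
    · by_cases h' : b = i.castSucc
      · subst h'
        rw [wordE_castSucc, epsNat_castSucc]
        split_ifs with h0
        · simp; omega
        · simp only [Option.map_eq_none_iff, ih]; omega
      · rw [wordE, wordEps_eq, epsNat_of_ne h h']
        have : (((epsNat i w : ℤ) : WithBot ℤ) ≤ 0) ↔ epsNat i w = 0 := by
          norm_cast
          omega
        simp [boxes, h, h', this, ih]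

theorem wordE_of_ne {b : Fin (n + 1)} (h : b ≠ i.succ) (h' : b ≠ i.castSucc)
    (w : List (Fin (n + 1))) : wordE i (b :: w) = (wordE i w).map fun w' => b :: w' := by
  rw [wordE, wordEps_eq]
  have : (((epsNat i w : ℤ) : WithBot ℤ) ≤ 0) ↔ epsNat i w = 0 := by
    norm_cast
    omega
  simp only [boxes, h, h', this, if_false, Option.map_none]
  -- If the tail has `ε = 0`, the rule acts on the box and gives `none`, and so does acting on the
  -- tail; hence the case distinction disappears.
  split_ifs with h0
  · rw [wordE_eq_none.2 h0]; rfl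
  · rfl

theorem wordF_eq_none {w : List (Fin (n + 1))} : wordF i w = none ↔ phiNat i w = 0 := by
  induction w with
  | nil => simp [wordF, phiNat]
  | cons b w ih =>
    by_cases h' : b = i.castSucc
    · subst h'
      rw [wordF_castSucc, phiNat_castSucc]
      split_ifs with h0 <;> simp [ih]
    · rw [wordF_of_ne h', phiNat_of_ne h']
      simp [ih]

/-- The three facts are proved in one induction because the drop of `ε` on the tail decides which
branch of `wordF` applies to the new word. -/
theorem of_wordE {w w' : List (Fin (n + 1))} (hw : wordE i w = some w') :
    epsNat i w = epsNat i w' + 1 ∧ wordWt w' = wordWt w + root i ∧ wordF i w' = some w := by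
  induction w generalizing w' with
  | nil => simp [wordE] at hw
  | cons b w ih =>
    by_cases h : b = i.succ
    · subst h
      rw [wordE_succ] at hw
      split_ifs at hw with h0
      · obtain rfl := Option.some.inj hw
        refine ⟨by rw [epsNat_succ, epsNat_castSucc]; omega, ?_, ?_⟩
        · simp only [wordWt, boxes, root]; abel
        · rw [wordF_castSucc, if_pos h0]
      · obtain ⟨w₁, h1, rfl⟩ := Option.map_eq_some_iff.1 hw
        obtain ⟨a1, a2, a3⟩ := ih h1
        refine ⟨by rw [epsNat_succ, epsNat_succ, a1], ?_, ?_⟩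
        · simp only [wordWt, a2]; abel
        · rw [wordF_succ, a3]; rfl
    · by_cases h' : b = i.castSucc
      · subst h'
        rw [wordE_castSucc] at hw
        split_ifs at hw with h0
        obtain ⟨w₁, h1, rfl⟩ := Option.map_eq_some_iff.1 hw
        obtain ⟨a1, a2, a3⟩ := ih h1
        refine ⟨by rw [epsNat_castSucc, epsNat_castSucc, a1]; omega, ?_, ?_⟩
        · simp only [wordWt, a2]; abel
        · rw [wordF_castSucc, a3, if_neg (by omega)]; rfl
      · rw [wordE_of_ne h h'] at hw
        obtain ⟨w₁, h1, rfl⟩ := Option.map_eq_some_iff.1 hw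
        obtain ⟨a1, a2, a3⟩ := ih h1
        refine ⟨by rw [epsNat_of_ne h h', epsNat_of_ne h h', a1], ?_, ?_⟩
        · simp only [wordWt, a2]; abel
        · rw [wordF_of_ne h', a3]; rfl

theorem wordE_of_wordF {w w' : List (Fin (n + 1))} (hw : wordF i w = some w') :
    wordE i w' = some w := by
  induction w generalizing w' with
  | nil => simp [wordF] at hw
  | cons b w ih =>
    by_cases h' : b = i.castSucc
    · subst h'
      rw [wordF_castSucc] at hw
      split_ifs at hw with h0
      · obtain rfl := Option.some.inj hw
        rw [wordE_succ, if_pos h0]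
      · obtain ⟨w₁, h1, rfl⟩ := Option.map_eq_some_iff.1 hw
        have a := ih h1
        have := (of_wordE a).1
        -- The old tail has `ε ≥ 1` and `f_i` raised it by one, so the new tail has `ε ≥ 2`, more
        -- than the `φ = 1` of the box.
        rw [wordE_castSucc, a, if_neg (by omega)]; rfl
    · rw [wordF_of_ne h'] at hw
      obtain ⟨w₁, h1, rfl⟩ := Option.map_eq_some_iff.1 hw
      have a := ih h1
      by_cases h : b = i.succ
      · subst h
        have := (of_wordE a).1
        rw [wordE_succ, a, if_neg (by omega)]; rfl
      · rw [wordE_of_ne h h', a]; rfl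

/-- Deduced from the change of `ε`: since `φ - ε` is the pairing with the weight and a simple root
pairs to 2 with its coroot, `φ` must drop by one. -/
theorem phiNat_of_wordF {w w' : List (Fin (n + 1))} (hw : wordF i w = some w') :
    phiNat i w = phiNat i w' + 1 := by
  obtain ⟨h1, h2, -⟩ := of_wordE (wordE_of_wordF hw)
  have h3 := congrArg (pairing i) h2
  have h4 : pairing i (root i) = 2 := by
    simp [pairing, root, castSucc_ne_succ', (castSucc_ne_succ' i).symm]
  rw [pairing_add, h4, pairing_wordWt, pairing_wordWt] at h3
  omega

end Words

/-! ### The crystal axioms for words and their transport -/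

theorem wordPhi_eq_add {n : ℕ} (i : Fin n) (w : List (Fin (n + 1))) :
    wordPhi i w = wordEps i w + ((pairing i (wordWt w) : ℤ) : WithBot ℤ) := by
  rw [wordPhi_eq, wordEps_eq, pairing_wordWt, ← WithBot.coe_add]
  congr 1
  ring

theorem wordEps_ne_bot {n : ℕ} (i : Fin n) (w : List (Fin (n + 1))) : wordEps i w ≠ ⊥ := by
  rw [wordEps_eq]
  exact WithBot.coe_ne_bot

theorem words_isCrystal (n : ℕ) : (words n).IsCrystal where
  phi_eq i b := wordPhi_eq_add i b
  wt_e i b b' h := (of_wordE h).2.1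
  wt_f i b b' h := by
    have := (of_wordE (wordE_of_wordF h)).2.1
    change wordWt b' = wordWt b - root i
    rw [this]; abel
  f_iff_e i b₁ b₂ := ⟨wordE_of_wordF, fun h => (of_wordE h).2.2⟩
  of_bot i b h := absurd h (wordEps_ne_bot i b)

/-- A crystal that embeds strictly into a crystal satisfies the crystal axioms. -/
theorem CrystalData.IsStrictMorphism.isCrystal.{v, w} {n : ℕ} {C : CrystalData.{v} n}
    {D : CrystalData.{w} n} {ψ : C.B → D.B} (h : C.IsStrictMorphism D ψ)
    (hψ : Function.Injective ψ) (hD : D.IsCrystal) : C.IsCrystal where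
  phi_eq i b := by rw [← h.φ, ← h.ε, ← h.wt, hD.phi_eq]
  wt_e i b b' hb := by
    rw [← h.wt, ← h.wt]
    exact hD.wt_e i _ _ (by rw [h.e, hb]; rfl)
  wt_f i b b' hb := by
    rw [← h.wt, ← h.wt]
    exact hD.wt_f i _ _ (by rw [h.f, hb]; rfl)
  f_iff_e i b₁ b₂ := by
    have e : ∀ (o : Option C.B) (b : C.B), o = some b ↔ o.map ψ = some (ψ b) := fun o b => by
      rw [← Option.map_some, (Option.map_injective hψ).eq_iff]
    rw [e, e, ← h.e, ← h.f]
    exact hD.f_iff_e i _ _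
  of_bot i b hb := by
    have := hD.of_bot i (ψ b) (by rw [h.ε, hb])
    rw [h.e, h.f] at this
    simpa using this

/-! ### Signatures and the words of arrays -/

section Signature

variable {n k : ℕ} {i : Fin n}

/-- The components of the signs `-` and of the signs `+` of a reduced signature. -/
def red : List (Bool × Fin k) → List (Fin k) × List (Fin k)
  | [] => ([], [])
  | (false, s) :: l => (s :: (red l).1, (red l).2)
  | (true, s) :: l =>
    match red l with
    | ([], R) => ([], s :: R)
    | (_ :: L, R) => (L, R)

theorem red_false (s : Fin k) (l : List (Bool × Fin k)) :
    red ((false, s) :: l) = (s :: (red l).1, (red l).2) := rfl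

theorem red_true_of_nil {l : List (Bool × Fin k)} (h : (red l).1 = []) (s : Fin k) :
    red ((true, s) :: l) = ([], s :: (red l).2) := by
  rw [red]
  generalize red l = p at *
  obtain ⟨L, R⟩ := p
  obtain rfl : L = [] := h
  rfl

theorem red_true_of_ne_nil {l : List (Bool × Fin k)} (h : (red l).1 ≠ []) (s : Fin k) :
    red ((true, s) :: l) = ((red l).1.tail, (red l).2) := by
  rw [red]
  generalize red l = p at *
  obtain ⟨_ | ⟨a, L⟩, R⟩ := p
  · exact absurd rfl h
  · rfl

/-- A `+` put in front of a reduced sequence meets its leftmost `-` first, so either it removes that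
one or there is no `-` left; the order "minus signs, then plus signs" persists. -/
theorem cancel_eq (l : List (Bool × Fin k)) :
    cancel l = (red l).1.map (Prod.mk false) ++ (red l).2.map (Prod.mk true) := by
  induction l with
  | nil => rfl
  | cons a l ih =>
    obtain ⟨b, s⟩ := a
    cases b
    · simp [cancel, ih, red_false]
    · rw [cancel, ih]
      rcases h : (red l).1 with _ | ⟨a, L⟩
      · rw [red_true_of_nil h]
        rcases (red l).2 with _ | ⟨a, R⟩ <;> simp
      · rw [red_true_of_ne_nil (by simp [h]), h]
        simp

theorem minusPos_eq (c : Fin k → Fin (n + 1) → ℕ) (i : Fin n) :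
    minusPos c i = (red (signature c i)).1.getLast? := by
  rw [minusPos, cancel_eq]
  simp [List.filter_map, Function.comp_def]

theorem plusPos_eq (c : Fin k → Fin (n + 1) → ℕ) (i : Fin n) :
    plusPos c i = (red (signature c i)).2.head? := by
  rw [plusPos, cancel_eq]
  simp [List.filter_map, Function.comp_def]

/-- The sign of a letter. -/
def sgn (i : Fin n) (a : Fin k × Fin (n + 1)) : Option (Bool × Fin k) :=
  if a.2 = i.succ then some (false, a.1)
  else if a.2 = i.castSucc then some (true, a.1) else none

theorem sgn_succ (s : Fin k) : sgn i (s, i.succ) = some (false, s) := by simp [sgn]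

theorem sgn_castSucc (s : Fin k) : sgn i (s, i.castSucc) = some (true, s) := by
  simp [sgn, castSucc_ne_succ']

theorem sgn_of_ne {a : Fin k × Fin (n + 1)} (h : a.2 ≠ i.succ) (h' : a.2 ≠ i.castSucc) :
    sgn i a = none := by
  simp [sgn, h, h']

/-- Case distinction on the sign of a letter. -/
theorem letter_cases (i : Fin n) (a : Fin k × Fin (n + 1)) :
    (∃ s, a = (s, i.succ)) ∨ (∃ s, a = (s, i.castSucc)) ∨ (a.2 ≠ i.succ ∧ a.2 ≠ i.castSucc) := by
  obtain ⟨s, b⟩ := a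
  by_cases h : b = i.succ
  · exact Or.inl ⟨s, by rw [h]⟩
  · by_cases h' : b = i.castSucc
    · exact Or.inr (Or.inl ⟨s, by rw [h']⟩)
    · exact Or.inr (Or.inr ⟨h, h'⟩)

theorem length_red (w : List (Fin k × Fin (n + 1))) :
    (red (w.filterMap (sgn i))).1.length = epsNat i (w.map Prod.snd) := by
  induction w with
  | nil => rfl
  | cons a w ih =>
    rcases letter_cases i a with ⟨s, rfl⟩ | ⟨s, rfl⟩ | ⟨h, h'⟩
    · rw [List.filterMap_cons_some (sgn_succ s), red_false, List.map_cons, epsNat_succ]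
      simp [ih]
    · rw [List.filterMap_cons_some (sgn_castSucc s), List.map_cons, epsNat_castSucc, ← ih]
      by_cases h : (red (w.filterMap (sgn i))).1 = []
      · rw [red_true_of_nil h, h]; rfl
      · rw [red_true_of_ne_nil h]; simp
    · rw [List.filterMap_cons_none (sgn_of_ne h h'), List.map_cons, epsNat_of_ne h h', ih]

theorem red_eq_nil {w : List (Fin k × Fin (n + 1))} :
    (red (w.filterMap (sgn i))).1 = [] ↔ epsNat i (w.map Prod.snd) = 0 := by
  rw [← length_red, List.length_eq_zero_iff]

/-- The signature rule for `e_i`, on letters tagged with their rows so that the component of a sign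
can be traced. The absence of surviving `-` in `B` is kept for the proof that the new word is still
in reading order. -/
theorem wordE_tagged {w : List (Fin k × Fin (n + 1))} {s : Fin k}
    (h : (red (w.filterMap (sgn i))).1.getLast? = some s) :
    ∃ A B, w = A ++ (s, i.succ) :: B ∧ epsNat i (B.map Prod.snd) = 0 ∧
      wordE i (w.map Prod.snd) = some ((A ++ (s, i.castSucc) :: B).map Prod.snd) := by
  induction w with
  | nil => simp [red] at h
  | cons a w ih =>
    rcases letter_cases i a with ⟨t, rfl⟩ | ⟨t, rfl⟩ | ⟨h1, h2⟩
    · rw [List.filterMap_cons_some (sgn_succ t), red_false] at h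
      by_cases h0 : (red (w.filterMap (sgn i))).1 = []
      · rw [h0] at h
        obtain rfl : t = s := by simpa using h
        refine ⟨[], w, rfl, red_eq_nil.1 h0, ?_⟩
        rw [List.map_cons, wordE_succ, if_pos (red_eq_nil.1 h0)]
        rfl
      · obtain ⟨x, L, hL⟩ := List.exists_cons_of_ne_nil h0
        rw [hL, List.getLast?_cons_cons, ← hL] at h
        obtain ⟨A, B, h3, h4, h5⟩ := ih h
        refine ⟨(t, i.succ) :: A, B, by rw [h3]; rfl, h4, ?_⟩
        rw [List.map_cons, wordE_succ, if_neg (fun h => h0 (red_eq_nil.2 h)), h5]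
        rfl
    · rw [List.filterMap_cons_some (sgn_castSucc t)] at h
      by_cases h0 : (red (w.filterMap (sgn i))).1 = []
      · rw [red_true_of_nil h0] at h
        simp at h
      · rw [red_true_of_ne_nil h0] at h
        have hl := length_red (i := i) w
        obtain ⟨x, L, hL⟩ := List.exists_cons_of_ne_nil h0
        rw [hL] at h hl
        rcases L with _ | ⟨y, L⟩
        · simp at h
        · rw [List.tail_cons, ← List.getLast?_cons_cons (a := x), ← hL] at h
          obtain ⟨A, B, h3, h4, h5⟩ := ih h
          refine ⟨(t, i.castSucc) :: A, B, by rw [h3]; rfl, h4, ?_⟩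
          simp only [List.length_cons] at hl
          rw [List.map_cons, wordE_castSucc, if_neg (by omega), h5]
          rfl
    · rw [List.filterMap_cons_none (sgn_of_ne h1 h2)] at h
      obtain ⟨A, B, h3, h4, h5⟩ := ih h
      refine ⟨a :: A, B, by rw [h3]; rfl, h4, ?_⟩
      rw [List.map_cons, wordE_of_ne h1 h2, h5]
      rfl

/-- The signature rule for `f_i`. The letter just before the changed one cannot be `i.castSucc`: it
would carry a surviving `+` further to the left. This too is kept for the reading order. -/
theorem wordF_tagged {w : List (Fin k × Fin (n + 1))} {s : Fin k}
    (h : (red (w.filterMap (sgn i))).2.head? = some s) :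
    ∃ A B, w = A ++ (s, i.castSucc) :: B ∧ epsNat i (B.map Prod.snd) = 0 ∧
      (∀ t, A.getLast? ≠ some (t, i.castSucc)) ∧
      wordF i (w.map Prod.snd) = some ((A ++ (s, i.succ) :: B).map Prod.snd) := by
  induction w with
  | nil => simp [red] at h
  | cons a w ih =>
    have key : ∀ A B, w = A ++ (s, i.castSucc) :: B → epsNat i (B.map Prod.snd) = 0 →
        (∀ t, A.getLast? ≠ some (t, i.castSucc)) →
        (a.2 = i.castSucc → epsNat i (w.map Prod.snd) ≠ 0) →
        ∀ t, (a :: A).getLast? ≠ some (t, i.castSucc) := by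
      intro A B h3 h4 h5 h6 t
      rcases A with _ | ⟨x, A⟩
      -- Here the changed letter heads `w`, and its `ε` is the truncated difference `0 - 1 = 0`.
      · intro ht
        refine h6 (by simpa using congrArg (Option.map Prod.snd) ht) ?_
        rw [h3, List.nil_append, List.map_cons, epsNat_castSucc, h4]
      · rw [List.getLast?_cons_cons]; exact h5 t
    rcases letter_cases i a with ⟨t, rfl⟩ | ⟨t, rfl⟩ | ⟨h1, h2⟩
    · rw [List.filterMap_cons_some (sgn_succ t), red_false] at h
      obtain ⟨A, B, h3, h4, h5, h6⟩ := ih h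
      refine ⟨(t, i.succ) :: A, B, by rw [h3]; rfl, h4,
        key A B h3 h4 h5 fun h => absurd h (castSucc_ne_succ' i).symm, ?_⟩
      rw [List.map_cons, wordF_succ, h6]
      rfl
    · rw [List.filterMap_cons_some (sgn_castSucc t)] at h
      by_cases h0 : (red (w.filterMap (sgn i))).1 = []
      · rw [red_true_of_nil h0] at h
        obtain rfl : t = s := by simpa using h
        refine ⟨[], w, rfl, red_eq_nil.1 h0, by simp, ?_⟩
        rw [List.map_cons, wordF_castSucc, if_pos (red_eq_nil.1 h0)]
        rfl
      · rw [red_true_of_ne_nil h0] at h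
        obtain ⟨A, B, h3, h4, h5, h6⟩ := ih h
        refine ⟨(t, i.castSucc) :: A, B, by rw [h3]; rfl, h4,
          key A B h3 h4 h5 fun _ h => h0 (red_eq_nil.2 h), ?_⟩
        rw [List.map_cons, wordF_castSucc, if_neg (fun h => h0 (red_eq_nil.2 h)), h6]
        rfl
    · rw [List.filterMap_cons_none (sgn_of_ne h1 h2)] at h
      obtain ⟨A, B, h3, h4, h5, h6⟩ := ih h
      refine ⟨a :: A, B, by rw [h3]; rfl, h4, key A B h3 h4 h5 fun h => absurd h h2, ?_⟩
      rw [List.map_cons, wordF_of_ne h2, h6]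
      rfl

theorem wordF_tagged_eq_none {w : List (Fin k × Fin (n + 1))}
    (h : (red (w.filterMap (sgn i))).2.head? = none) : wordF i (w.map Prod.snd) = none := by
  rw [wordF_eq_none]
  induction w with
  | nil => rfl
  | cons a w ih =>
    rcases letter_cases i a with ⟨t, rfl⟩ | ⟨t, rfl⟩ | ⟨h1, h2⟩
    · rw [List.filterMap_cons_some (sgn_succ t), red_false] at h
      rw [List.map_cons, phiNat_succ, ih h]
    · rw [List.filterMap_cons_some (sgn_castSucc t)] at h
      by_cases h0 : (red (w.filterMap (sgn i))).1 = []
      · rw [red_true_of_nil h0] at h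
        simp at h
      · rw [red_true_of_ne_nil h0] at h
        rw [List.map_cons, phiNat_castSucc, if_neg (fun h => h0 (red_eq_nil.2 h)), ih h]
    · rw [List.filterMap_cons_none (sgn_of_ne h1 h2)] at h
      rw [List.map_cons, phiNat_of_ne h2, ih h]

theorem wordE_tagged_eq_none {w : List (Fin k × Fin (n + 1))}
    (h : (red (w.filterMap (sgn i))).1.getLast? = none) : wordE i (w.map Prod.snd) = none := by
  rw [wordE_eq_none, ← red_eq_nil]
  exact List.getLast?_eq_none_iff.1 h

/-- The order in which the letters of an array are read. -/
def ReadBefore (a b : Fin k × Fin (n + 1)) : Prop := a.1 < b.1 ∨ a.1 = b.1 ∧ b.2 ≤ a.2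

theorem ReadBefore.antisymm {a b : Fin k × Fin (n + 1)} (h : ReadBefore a b)
    (h' : ReadBefore b a) : a = b := by
  rcases h with h | ⟨h1, h2⟩ <;> rcases h' with h' | ⟨h3, h4⟩
  · exact absurd h h'.asymm
  · exact absurd h (h3 ▸ lt_irrefl _)
  · exact absurd h' (h1 ▸ lt_irrefl _)
  · exact Prod.ext h1 (le_antisymm h4 h2)

/-- Lowering a letter keeps a row weakly decreasing as long as no equal letter of that row follows
it. -/
theorem pairwise_of_wordE {A B : List (Fin k × Fin (n + 1))} {s : Fin k}
    (h : (A ++ (s, i.succ) :: B).Pairwise ReadBefore) (hB : epsNat i (B.map Prod.snd) = 0) :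
    (A ++ (s, i.castSucc) :: B).Pairwise ReadBefore := by
  rw [List.pairwise_append, List.pairwise_cons] at h ⊢
  obtain ⟨hA, ⟨h1, h2⟩, h3⟩ := h
  have hlt := i.castSucc_lt_succ
  -- By antisymmetry of the reading order an equal letter in `B` would force the first letter of `B`
  -- to be equal as well, and that would be a surviving `-` in `B`.
  have hs : (s, i.succ) ∉ B := by
    intro hm
    rcases B with _ | ⟨b, B⟩
    · simp at hm
    · have hb : b = (s, i.succ) := by
        rcases List.mem_cons.1 hm with h | h
        · exact h.symm
        · exact ((List.pairwise_cons.1 h2).1 _ h).antisymm (h1 b (by simp))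
      rw [hb, List.map_cons, epsNat_succ] at hB
      omega
  refine ⟨hA, ⟨fun b hb => ?_, h2⟩, fun a ha b hb => ?_⟩
  · rcases h1 b hb with h | ⟨h, h'⟩
    · exact Or.inl h
    · refine Or.inr ⟨h, ?_⟩
      have hne : b.2 ≠ i.succ := fun h'' => hs (by
        have : b = (s, i.succ) := Prod.ext h.symm h''
        rwa [← this])
      exact Fin.le_castSucc_iff.2 (lt_of_le_of_ne h' hne)
  · rcases List.mem_cons.1 hb with rfl | hb
    · rcases h3 a ha _ (List.mem_cons_self) with h | ⟨h, h'⟩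
      · exact Or.inl h
      · exact Or.inr ⟨h, hlt.le.trans h'⟩
    · exact h3 a ha b (List.mem_cons_of_mem _ hb)

/-- Dually, raising a letter is harmless when no equal letter of its row precedes it; if one did,
the last letter of `A` would be such a letter. -/
theorem pairwise_of_wordF {A B : List (Fin k × Fin (n + 1))} {s : Fin k}
    (h : (A ++ (s, i.castSucc) :: B).Pairwise ReadBefore)
    (hA' : ∀ t, A.getLast? ≠ some (t, i.castSucc)) :
    (A ++ (s, i.succ) :: B).Pairwise ReadBefore := by
  rw [List.pairwise_append, List.pairwise_cons] at h ⊢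
  obtain ⟨hA, ⟨h1, h2⟩, h3⟩ := h
  have hlt := i.castSucc_lt_succ
  have hs : (s, i.castSucc) ∉ A := by
    intro hm
    rcases List.eq_nil_or_concat A with rfl | ⟨A', b, rfl⟩
    · simp at hm
    · have hb : b = (s, i.castSucc) := by
        rw [List.concat_eq_append] at *
        rcases List.mem_append.1 hm with h | h
        · exact (h3 b (by simp) _ List.mem_cons_self).antisymm
            ((List.pairwise_append.1 hA).2.2 _ h b (by simp))
        · exact (List.mem_singleton.1 h).symm
      exact hA' s (by simp [hb])
  refine ⟨hA, ⟨fun b hb => ?_, h2⟩, fun a ha b hb => ?_⟩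
  · rcases h1 b hb with h | ⟨h, h'⟩
    · exact Or.inl h
    · exact Or.inr ⟨h, h'.trans hlt.le⟩
  · rcases List.mem_cons.1 hb with rfl | hb
    · rcases h3 a ha _ (List.mem_cons_self) with h | ⟨h, h'⟩
      · exact Or.inl h
      · refine Or.inr ⟨h, Fin.castSucc_lt_iff_succ_le.1 (lt_of_le_of_ne h' fun h'' => hs ?_)⟩
        have : a = (s, i.castSucc) := Prod.ext h h''.symm
        rwa [← this]
    · exact h3 a ha b (List.mem_cons_of_mem _ hb)

end Signature

/-! ### Words of arrays and the action of the operators on them -/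

section Arrays

variable {n k : ℕ}

/-- The weakly decreasing word with prescribed numbers of letters. -/
def rowWord (v : Fin (n + 1) → ℕ) : List (Fin (n + 1)) :=
  (List.finRange (n + 1)).reverse.flatMap fun b => List.replicate (v b) b

/-- The rows of an array, read from top to bottom. -/
def arrayWord (c : Fin k → Fin (n + 1) → ℕ) : List (Fin k × Fin (n + 1)) :=
  (List.finRange k).flatMap fun j => (rowWord (c j)).map (Prod.mk j)

/-- The letters of the rows of an array, read from top to bottom. -/
def arrayReading (c : Fin k → Fin (n + 1) → ℕ) : List (Fin (n + 1)) :=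
  (arrayWord c).map Prod.snd

theorem pairwise_rowWord (v : Fin (n + 1) → ℕ) : (rowWord v).Pairwise (· ≥ ·) := by
  rw [rowWord, List.pairwise_flatMap]
  refine ⟨fun b _ => List.pairwise_replicate.2 (Or.inr le_rfl), ?_⟩
  rw [List.pairwise_reverse]
  refine (List.pairwise_lt_finRange (n + 1)).imp fun h x hx y hy => ?_
  rw [List.eq_of_mem_replicate hx, List.eq_of_mem_replicate hy]
  exact h.le

theorem count_rowWord (v : Fin (n + 1) → ℕ) (b : Fin (n + 1)) : (rowWord v).count b = v b := by
  rw [rowWord, List.count_flatMap]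
  simp only [Function.comp_def, List.count_replicate, List.map_reverse, List.sum_reverse]
  rw [← List.ofFn_eq_map, List.sum_ofFn]
  simp

theorem eq_rowWord {l : List (Fin (n + 1))} {v : Fin (n + 1) → ℕ} (h : l.Pairwise (· ≥ ·))
    (hv : ∀ b, l.count b = v b) : l = rowWord v :=
  List.Perm.eq_of_pairwise (fun _ _ _ _ h h' => le_antisymm h' h) h (pairwise_rowWord v)
    (List.perm_iff_count.2 fun b => by rw [hv, count_rowWord])

theorem pairwise_arrayWord (c : Fin k → Fin (n + 1) → ℕ) : (arrayWord c).Pairwise ReadBefore := by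
  rw [arrayWord, List.pairwise_flatMap]
  refine ⟨fun j _ => ?_, ?_⟩
  · rw [List.pairwise_map]
    exact (pairwise_rowWord (c j)).imp fun h => Or.inr ⟨rfl, h⟩
  · refine (List.pairwise_lt_finRange k).imp fun h x hx y hy => Or.inl ?_
    obtain ⟨_, _, rfl⟩ := List.mem_map.1 hx
    obtain ⟨_, _, rfl⟩ := List.mem_map.1 hy
    exact h

theorem count_arrayWord (c : Fin k → Fin (n + 1) → ℕ) (j : Fin k) (b : Fin (n + 1)) :
    (arrayWord c).count (j, b) = c j b := by
  have h : ∀ j', ((rowWord (c j')).map (Prod.mk j')).count (j, b) = if j' = j then c j b else 0 := by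
    intro j'
    split_ifs with h
    · subst h
      rw [List.count_map_of_injective _ _ (Prod.mk_right_injective j'), count_rowWord]
    · rw [List.count_eq_zero]
      simp [h]
  rw [arrayWord, List.count_flatMap]
  simp only [Function.comp_def, h]
  rw [← List.ofFn_eq_map, List.sum_ofFn]
  simp

/-- The reading order is antisymmetric, so a word in reading order is determined by its letter
counts. -/
theorem eq_arrayWord {l : List (Fin k × Fin (n + 1))} {c : Fin k → Fin (n + 1) → ℕ}
    (h : l.Pairwise ReadBefore) (hc : ∀ j b, l.count (j, b) = c j b) : l = arrayWord c :=
  List.Perm.eq_of_pairwise (fun _ _ _ _ h h' => h.antisymm h') h (pairwise_arrayWord c)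
    (List.perm_iff_count.2 fun ⟨j, b⟩ => by rw [hc, count_arrayWord])

/-- In a weakly decreasing row the letters `i.succ` come before the letters `i.castSucc`, which is
why each row contributes its `-` signs first. -/
theorem filterMap_sgn {i : Fin n} (j : Fin k) {l : List (Fin (n + 1))} (h : l.Pairwise (· ≥ ·)) :
    (l.map (Prod.mk j)).filterMap (sgn i) = List.replicate (l.count i.succ) (false, j) ++
      List.replicate (l.count i.castSucc) (true, j) := by
  have hlt := i.castSucc_lt_succ
  induction l with
  | nil => rfl
  | cons b l ih =>
    obtain ⟨h1, h2⟩ := List.pairwise_cons.1 h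
    rw [List.map_cons]
    rcases letter_cases i (j, b) with ⟨s, hs⟩ | ⟨s, hs⟩ | ⟨h3, h4⟩
    · obtain ⟨rfl, rfl⟩ := Prod.mk.inj hs
      rw [List.filterMap_cons_some (sgn_succ j), ih h2, List.count_cons_self,
        List.count_cons_of_ne hlt.ne', List.replicate_succ, List.cons_append]
    · obtain ⟨rfl, rfl⟩ := Prod.mk.inj hs
      have h0 : l.count i.succ = 0 := List.count_eq_zero.2 fun h => (h1 _ h).not_gt hlt
      rw [List.filterMap_cons_some (sgn_castSucc j), ih h2, List.count_cons_self,
        List.count_cons_of_ne hlt.ne, h0, List.replicate_succ]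
      rfl
    · rw [List.filterMap_cons_none (sgn_of_ne h3 h4), ih h2, List.count_cons_of_ne h3,
        List.count_cons_of_ne h4]

theorem signature_eq (c : Fin k → Fin (n + 1) → ℕ) (i : Fin n) :
    signature c i = (arrayWord c).filterMap (sgn i) := by
  rw [arrayWord, List.filterMap_flatMap, signature]
  congr 1
  funext j
  rw [filterMap_sgn j (pairwise_rowWord (c j)), count_rowWord, count_rowWord]

/-- The array in which one entry `a` of the row `s` has been replaced by `b`. -/
def replaceEntry (c : Fin k → Fin (n + 1) → ℕ) (s : Fin k) (a b : Fin (n + 1)) :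
    Fin k → Fin (n + 1) → ℕ :=
  Function.update c s (c s - Pi.single a 1 + Pi.single b 1)

theorem replaceEntry_arrayWord {c : Fin k → Fin (n + 1) → ℕ} {s : Fin k} {a b : Fin (n + 1)}
    {A B : List (Fin k × Fin (n + 1))} (h : arrayWord c = A ++ (s, a) :: B)
    (h' : (A ++ (s, b) :: B).Pairwise ReadBefore) :
    0 < c s a ∧ A ++ (s, b) :: B = arrayWord (replaceEntry c s a b) := by
  have hc : ∀ j d, c j d = (A ++ B).count (j, d) + if (s, a) = (j, d) then 1 else 0 := by
    intro j d
    rw [← count_arrayWord c, h]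
    simp [List.count_append, List.count_cons, add_assoc]
  refine ⟨by rw [hc]; simp, eq_arrayWord h' fun j d => ?_⟩
  have h2 := hc j d
  simp only [List.count_append, List.count_cons, Prod.mk.injEq, beq_iff_eq] at h2 ⊢
  by_cases hj : j = s
  · subst hj
    simp only [replaceEntry, Function.update_self, Pi.add_apply, Pi.sub_apply, h2, Pi.single_apply,
      true_and, eq_comm (a := d)]
    split_ifs <;> omega
  · rw [replaceEntry, Function.update_of_ne hj]
    simp [h2, Ne.symm hj]

/-- Combines the signature rule with the preservation of the reading order. Positivity of the entry
is recorded because `replaceEntry` uses truncated subtraction. -/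
theorem wordE_arrayReading {c : Fin k → Fin (n + 1) → ℕ} {i : Fin n} {s : Fin k}
    (h : minusPos c i = some s) : 0 < c s i.succ ∧
      wordE i (arrayReading c) = some (arrayReading (replaceEntry c s i.succ i.castSucc)) := by
  rw [minusPos_eq, signature_eq] at h
  obtain ⟨A, B, h1, h2, h3⟩ := wordE_tagged h
  have hp := pairwise_arrayWord c
  rw [h1] at hp
  obtain ⟨h4, h5⟩ := replaceEntry_arrayWord h1 (pairwise_of_wordE hp h2)
  exact ⟨h4, by rw [arrayReading, h3, h5]; rfl⟩

theorem wordE_arrayReading_eq_none {c : Fin k → Fin (n + 1) → ℕ} {i : Fin n}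
    (h : minusPos c i = none) : wordE i (arrayReading c) = none := by
  rw [minusPos_eq, signature_eq] at h
  exact wordE_tagged_eq_none h

theorem wordF_arrayReading {c : Fin k → Fin (n + 1) → ℕ} {i : Fin n} {s : Fin k}
    (h : plusPos c i = some s) : 0 < c s i.castSucc ∧
      wordF i (arrayReading c) = some (arrayReading (replaceEntry c s i.castSucc i.succ)) := by
  rw [plusPos_eq, signature_eq] at h
  obtain ⟨A, B, h1, h2, h0, h3⟩ := wordF_tagged h
  have hp := pairwise_arrayWord c
  rw [h1] at hp
  obtain ⟨h4, h5⟩ := replaceEntry_arrayWord h1 (pairwise_of_wordF hp h0)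
  exact ⟨h4, by rw [arrayReading, h3, h5]; rfl⟩

theorem wordF_arrayReading_eq_none {c : Fin k → Fin (n + 1) → ℕ} {i : Fin n}
    (h : plusPos c i = none) : wordF i (arrayReading c) = none := by
  rw [plusPos_eq, signature_eq] at h
  exact wordF_tagged_eq_none h

theorem length_rowWord (v : Fin (n + 1) → ℕ) : (rowWord v).length = ∑ b, v b := by
  rw [rowWord, List.length_flatMap]
  simp only [List.length_replicate, List.map_reverse, List.sum_reverse]
  rw [← List.ofFn_eq_map, List.sum_ofFn]

theorem map_fst_arrayWord {l : Fin k → ℕ} {c : Fin k → Fin (n + 1) → ℕ}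
    (h : ∀ j, ∑ b, c j b = l j) :
    (arrayWord c).map Prod.fst = (List.finRange k).flatMap fun j => List.replicate (l j) j := by
  rw [arrayWord, List.map_flatMap]
  congr 1
  funext j
  rw [List.map_map, ← h, ← length_rowWord]
  exact List.map_const'

/-- Once the row lengths are fixed, the row tags of the letters are known, so forgetting them loses
nothing. -/
theorem arrayReading_injective {l : Fin k → ℕ} {c c' : Fin k → Fin (n + 1) → ℕ}
    (h : ∀ j, ∑ b, c j b = l j) (h' : ∀ j, ∑ b, c' j b = l j)
    (hr : arrayReading c = arrayReading c') : c = c' := by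
  have h1 := (map_fst_arrayWord h).trans (map_fst_arrayWord h').symm
  have h2 : arrayWord c = arrayWord c' := by
    rw [← List.zip_unzip (arrayWord c), ← List.zip_unzip (arrayWord c'), List.unzip_eq_map,
      List.unzip_eq_map, h1]
    exact congrArg _ hr
  funext j b
  rw [← count_arrayWord c, h2, count_arrayWord]

theorem sum_replaceEntry {c : Fin k → Fin (n + 1) → ℕ} {s : Fin k} {a b : Fin (n + 1)}
    (h : 0 < c s a) (j : Fin k) : ∑ d, replaceEntry c s a b j d = ∑ d, c j d := by
  by_cases hj : j = s
  · subst hj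
    have h1 : Pi.single a 1 ≤ c j := by
      intro d
      by_cases hd : d = a
      · subst hd; simpa using Nat.succ_le_of_lt h
      · simp [hd]
    rw [replaceEntry, Function.update_self]
    conv_rhs => rw [← tsub_add_cancel_of_le h1]
    simp [Finset.sum_add_distrib]
  · rw [replaceEntry, Function.update_of_ne hj]

theorem wordWt_arrayReading (c : Fin k → Fin (n + 1) → ℕ) (b : Fin (n + 1)) :
    wordWt (arrayReading c) b = ∑ j, (c j b : ℤ) := by
  have h : ∀ w : List (Fin (n + 1)), wordWt w b = w.count b := by
    intro w
    induction w with
    | nil => rfl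
    | cons a w ih =>
      simp only [wordWt, Pi.add_apply, ih, boxes, List.count_cons, Pi.single_apply, beq_iff_eq]
      by_cases hb : b = a
      · subst hb; simp; ring
      · simp [hb, Ne.symm hb]
  rw [h, arrayReading, arrayWord, List.map_flatMap, List.count_flatMap]
  simp only [List.map_map, Function.comp_def, List.map_id']
  simp only [count_rowWord]
  rw [← List.ofFn_eq_map, List.sum_ofFn]
  push_cast
  rfl

end Arrays

/-! ### The arrays of semistandard tableaux -/

section Strict

variable {n k : ℕ}

/-- The number of letters smaller than `t` in a row. -/
def partialSum (v : Fin (n + 1) → ℕ) (t : ℕ) : ℕ :=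
  ∑ b : Fin (n + 1), if (b : ℕ) < t then v b else 0

theorem partialSum_zero (v : Fin (n + 1) → ℕ) : partialSum v 0 = 0 := by simp [partialSum]

theorem partialSum_add (v w : Fin (n + 1) → ℕ) (t : ℕ) :
    partialSum (v + w) t = partialSum v t + partialSum w t := by
  simp only [partialSum, ← Finset.sum_add_distrib]
  refine Finset.sum_congr rfl fun b _ => ?_
  split_ifs <;> simp

theorem partialSum_single (a : Fin (n + 1)) (z t : ℕ) :
    partialSum (Pi.single a z) t = if (a : ℕ) < t then z else 0 := by
  rw [partialSum, Finset.sum_eq_single a]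
  · simp
  · intro b _ hb; simp [hb]
  · simp

theorem partialSum_succ (v : Fin (n + 1) → ℕ) (b : Fin (n + 1)) :
    partialSum v (b + 1) = partialSum v b + v b := by
  have : v b = ∑ a, if a = b then v a else 0 := by simp
  rw [this, partialSum, partialSum, ← Finset.sum_add_distrib]
  refine Finset.sum_congr rfl fun a _ => ?_
  have := @Fin.ext_iff _ a b
  split_ifs <;> omega

theorem partialSum_last (v : Fin (n + 1) → ℕ) : partialSum v (n + 1) = ∑ b, v b :=
  Finset.sum_congr rfl fun b _ => if_pos b.2

theorem partialSum_mono (v : Fin (n + 1) → ℕ) : Monotone (partialSum v) := by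
  intro s t h
  refine Finset.sum_le_sum fun b _ => ?_
  split_ifs <;> omega

theorem ext_of_partialSum {v w : Fin (n + 1) → ℕ}
    (h : ∀ t ≤ n + 1, partialSum v t = partialSum w t) : v = w := by
  funext b
  have h1 := partialSum_succ v b
  have h2 := partialSum_succ w b
  have h3 := h b b.2.le
  have h4 := h (b + 1) b.2
  omega

/-- The columns of the tableau with the given rows are strictly increasing. -/
def IsStrictArray (c : Fin k → Fin (n + 1) → ℕ) : Prop :=
  ∀ j j' : Fin k, (j : ℕ) + 1 = j' → ∀ t ≤ n, partialSum (c j') (t + 1) ≤ partialSum (c j) t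

/-- Written additively on both sides to avoid subtraction of natural numbers. -/
theorem partialSum_replaceEntry {c : Fin k → Fin (n + 1) → ℕ} {s : Fin k} {a b : Fin (n + 1)}
    (h : 0 < c s a) (t : ℕ) :
    partialSum (replaceEntry c s a b s) t + (if (a : ℕ) < t then 1 else 0)
      = partialSum (c s) t + if (b : ℕ) < t then 1 else 0 := by
  have h1 : Pi.single a 1 ≤ c s := by
    intro d
    by_cases hd : d = a
    · subst hd; simpa using Nat.succ_le_of_lt h
    · simp [hd]
  rw [replaceEntry, Function.update_self]
  conv_rhs => rw [← tsub_add_cancel_of_le h1]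
  simp only [partialSum_add, partialSum_single]
  ring

theorem red_append {A B B' : List (Bool × Fin k)} (h : red B = red B') :
    red (A ++ B) = red (A ++ B') := by
  induction A with
  | nil => exact h
  | cons a A ih =>
    obtain ⟨b, s⟩ := a
    cases b
    · rw [List.cons_append, List.cons_append, red_false, red_false, ih]
    · rw [List.cons_append, List.cons_append, red, red, ih]

/-- Equal numbers of `+` followed directly by `-` cancel, whatever comes after them. -/
theorem red_replicate (a b : ℕ) (j s : Fin k) (B : List (Bool × Fin k)) :
    red (List.replicate (a + b) (true, j) ++ (List.replicate b (false, s) ++ B))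
      = red (List.replicate a (true, j) ++ B) := by
  induction b with
  | zero => rfl
  | succ b ih =>
    rw [← ih, ← add_assoc, List.replicate_succ', List.append_assoc, List.replicate_succ]
    refine red_append ?_
    rw [List.singleton_append, List.cons_append, red_true_of_ne_nil (by rw [red_false]; simp),
      red_false]
    rfl

theorem red_mem (l : List (Bool × Fin k)) :
    (∀ s ∈ (red l).1, (false, s) ∈ l) ∧ ∀ s ∈ (red l).2, (true, s) ∈ l := by
  have h := cancel_eq l
  have sub : ∀ l : List (Bool × Fin k), cancel l ⊆ l := by
    intro l
    induction l with
    | nil => exact List.Subset.refl _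
    | cons a l ih =>
      rw [cancel]
      split
      · rename_i h
        exact fun x hx => List.mem_cons_of_mem _ (ih (h ▸ List.mem_cons_of_mem _ hx))
      · exact List.cons_subset_cons _ ih
  refine ⟨fun s hs => sub l ?_, fun s hs => sub l ?_⟩ <;> rw [h] <;> simp [hs]

theorem finRange_split {j s : Fin k} (h : (j : ℕ) + 1 = s) :
    ∃ A B, List.finRange k = A ++ j :: s :: B ∧ j ∉ A ∧ j ∉ B ∧ s ∉ A ∧ s ∉ B := by
  have h1 : (List.finRange k).drop j = j :: s :: (List.finRange k).drop (s + 1) := by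
    rw [List.drop_eq_getElem_cons (by simp), h, List.drop_eq_getElem_cons (by simp)]
    simp
  have h2 : List.finRange k = (List.finRange k).take j ++ j :: s :: (List.finRange k).drop (s + 1) := by
    rw [← h1, List.take_append_drop]
  refine ⟨_, _, h2, ?_⟩
  have h3 := List.nodup_finRange k
  rw [h2] at h3
  simp only [List.nodup_append, List.nodup_cons, List.mem_cons, not_or] at h3
  obtain ⟨-, ⟨⟨-, h4⟩, h5, -⟩, h6⟩ := h3
  exact ⟨fun h => h6 j h j (Or.inl rfl) rfl, h4, fun h => h6 s h s (Or.inr (Or.inl rfl)) rfl, h5⟩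

theorem mem_flatMap_signature {c : Fin k → Fin (n + 1) → ℕ} {i : Fin n} {A : List (Fin k)}
    {b : Bool} {s : Fin k} (h : (b, s) ∈ A.flatMap fun j =>
      List.replicate (c j i.succ) (false, j) ++ List.replicate (c j i.castSucc) (true, j)) :
    s ∈ A ∧ 0 < c s (if b then i.castSucc else i.succ) := by
  obtain ⟨j, hj, h⟩ := List.mem_flatMap.1 h
  rcases List.mem_append.1 h with h | h
  · obtain ⟨h1, h2⟩ := List.mem_replicate.1 h
    obtain ⟨rfl, rfl⟩ := Prod.mk.inj h2
    exact ⟨hj, Nat.pos_of_ne_zero h1⟩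
  · obtain ⟨h1, h2⟩ := List.mem_replicate.1 h
    obtain ⟨rfl, rfl⟩ := Prod.mk.inj h2
    exact ⟨hj, Nat.pos_of_ne_zero h1⟩

/-- For adjacent rows the `+` signs of the upper row stand immediately before the `-` signs of the
lower one, and neither kind occurs elsewhere. -/
theorem signature_split (c : Fin k → Fin (n + 1) → ℕ) (i : Fin n) {j s : Fin k}
    (h : (j : ℕ) + 1 = s) : ∃ A B : List (Bool × Fin k),
      signature c i = A ++ (List.replicate (c j i.castSucc) (true, j) ++
        (List.replicate (c s i.succ) (false, s) ++ B)) ∧ (false, s) ∉ A ++ B ∧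
        (true, j) ∉ A ++ B := by
  have hjs : j ≠ s := fun h' => by subst h'; omega
  obtain ⟨A, B, h1, h2, h3, h4, h5⟩ := finRange_split h
  refine ⟨A.flatMap (fun j => List.replicate (c j i.succ) (false, j) ++
      List.replicate (c j i.castSucc) (true, j)) ++ List.replicate (c j i.succ) (false, j),
    List.replicate (c s i.castSucc) (true, s) ++
      B.flatMap fun j => List.replicate (c j i.succ) (false, j) ++
      List.replicate (c j i.castSucc) (true, j), ?_, ?_, ?_⟩
  · rw [signature, h1, List.flatMap_append, List.flatMap_cons, List.flatMap_cons]
    simp only [List.append_assoc]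
  · simp only [List.mem_append, not_or, List.mem_replicate]
    exact ⟨⟨fun h => h4 (mem_flatMap_signature h).1, by simp [hjs.symm]⟩, by simp,
      fun h => h5 (mem_flatMap_signature h).1⟩
  · simp only [List.mem_append, not_or, List.mem_replicate]
    exact ⟨⟨fun h => h2 (mem_flatMap_signature h).1, by simp⟩, by simp [hjs],
      fun h => h3 (mem_flatMap_signature h).1⟩

/-- Otherwise the `+` signs of the row above would cancel every `-` of row `s`, and none could
survive. -/
theorem lt_of_minusPos {c : Fin k → Fin (n + 1) → ℕ} {i : Fin n} {j s : Fin k}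
    (h : (j : ℕ) + 1 = s) (hs : minusPos c i = some s) : c j i.castSucc < c s i.succ := by
  by_contra hle
  obtain ⟨A, B, h1, h2, -⟩ := signature_split c i h
  rw [← Nat.sub_add_cancel (not_lt.1 hle)] at h1
  have h3 : red (signature c i) =
      red (A ++ (List.replicate (c j i.castSucc - c s i.succ) (true, j) ++ B)) := by
    rw [h1]
    exact red_append (red_replicate _ _ _ _ _)
  rw [minusPos_eq, h3] at hs
  have := (red_mem _).1 s (List.mem_of_getLast? hs)
  simp only [List.mem_append, List.mem_replicate, Prod.mk.injEq] at this h2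
  simp at this
  tauto

/-- Otherwise the `-` signs of the row below would cancel every `+` of row `j`. -/
theorem lt_of_plusPos {c : Fin k → Fin (n + 1) → ℕ} {i : Fin n} {j s : Fin k}
    (h : (j : ℕ) + 1 = s) (hj : plusPos c i = some j) : c s i.succ < c j i.castSucc := by
  by_contra hle
  obtain ⟨A, B, h1, -, h2⟩ := signature_split c i h
  rw [← Nat.add_sub_cancel' (not_lt.1 hle), List.replicate_add, List.append_assoc] at h1
  have h3 : red (signature c i) =
      red (A ++ (List.replicate (c s i.succ - c j i.castSucc) (false, s) ++ B)) := by
    rw [h1]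
    refine red_append ?_
    have := red_replicate 0 (c j i.castSucc) j s
      (List.replicate (c s i.succ - c j i.castSucc) (false, s) ++ B)
    rw [zero_add] at this
    exact this
  rw [plusPos_eq, h3] at hj
  have := (red_mem _).2 j (List.mem_of_head? hj)
  simp only [List.mem_append, List.mem_replicate, Prod.mk.injEq] at this h2
  simp at this
  tauto

/-- Only one partial sum of row `s` changes: the number of entries below `i + 1` grows by one. This
matters only against the row above, where `lt_of_minusPos` provides the missing unit. -/
theorem IsStrictArray.replaceEntry_minus {c : Fin k → Fin (n + 1) → ℕ} (hc : IsStrictArray c)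
    {i : Fin n} {s : Fin k} (hs : minusPos c i = some s) :
    IsStrictArray (replaceEntry c s i.succ i.castSucc) := by
  intro j j' hj t ht
  have hP := partialSum_replaceEntry (b := i.castSucc) (wordE_arrayReading hs).1
  have hle := hc j j' hj t ht
  by_cases h1 : j' = s
  · subst h1
    have h2 : j ≠ j' := fun h => by subst h; omega
    have h3 := hP (t + 1)
    have h4 := lt_of_minusPos hj hs
    -- The inequality is taken one step beyond the critical place `t = i`; removing the entries
    -- counted by `c j' i.succ` and `c j i.castSucc` leaves a strict inequality at `t = i`.
    have h5 := hc j j' hj (i + 1) (by omega)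
    have h6 := partialSum_succ (c j') i.succ
    have h7 := partialSum_succ (c j) i.castSucc
    simp only [Fin.val_succ, Fin.val_castSucc] at h3 h6 h7
    rw [show replaceEntry c j' i.succ i.castSucc j = c j from Function.update_of_ne h2 _ _]
    by_cases h8 : t = i
    · subst h8
      rw [if_neg (by omega), if_pos (by omega)] at h3
      omega
    · split_ifs at h3 <;> omega
  · rw [show replaceEntry c s i.succ i.castSucc j' = c j' from Function.update_of_ne h1 _ _]
    by_cases h2 : j = s
    · subst h2
      have h3 := hP t
      simp only [Fin.val_succ, Fin.val_castSucc] at h3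
      split_ifs at h3 <;> omega
    · rwa [show replaceEntry c s i.succ i.castSucc j = c j from Function.update_of_ne h2 _ _]

/-- Now the number of entries below `i + 1` in row `s` drops by one, which matters only against the
row below; `lt_of_plusPos` supplies the unit. -/
theorem IsStrictArray.replaceEntry_plus {c : Fin k → Fin (n + 1) → ℕ} (hc : IsStrictArray c)
    {i : Fin n} {s : Fin k} (hs : plusPos c i = some s) :
    IsStrictArray (replaceEntry c s i.castSucc i.succ) := by
  intro j j' hj t ht
  have hP := partialSum_replaceEntry (b := i.succ) (wordF_arrayReading hs).1
  have hle := hc j j' hj t ht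
  by_cases h1 : j = s
  · subst h1
    have h2 : j' ≠ j := fun h => by subst h; omega
    have h3 := hP t
    have h4 := lt_of_plusPos hj hs
    -- The critical place is `t = i + 1`; here the inequality one step earlier is used, and the
    -- entries counted by `c j' i.succ` and `c j i.castSucc` are added.
    have h5 := hc j j' hj i (by omega)
    have h6 := partialSum_succ (c j') i.succ
    have h7 := partialSum_succ (c j) i.castSucc
    simp only [Fin.val_succ, Fin.val_castSucc] at h3 h6 h7
    rw [show replaceEntry c j i.castSucc i.succ j' = c j' from Function.update_of_ne h2 _ _]
    by_cases h8 : t = i + 1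
    · subst h8
      rw [if_pos (by omega), if_neg (by omega)] at h3
      omega
    · split_ifs at h3 <;> omega
  · rw [show replaceEntry c s i.castSucc i.succ j = c j from Function.update_of_ne h1 _ _]
    by_cases h2 : j' = s
    · subst h2
      have h3 := hP (t + 1)
      simp only [Fin.val_succ, Fin.val_castSucc] at h3
      split_ifs at h3 <;> omega
    · rwa [show replaceEntry c s i.castSucc i.succ j' = c j' from Function.update_of_ne h2 _ _]

theorem pairwise_signature (c : Fin k → Fin (n + 1) → ℕ) (i : Fin n) :
    (signature c i).Pairwise fun a b => a.2 < b.2 ∨ (a.2 = b.2 ∧ (a.1 = true → b.1 = true)) := by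
  rw [signature, List.pairwise_flatMap]
  refine ⟨fun j _ => ?_, (List.pairwise_lt_finRange k).imp fun h x hx y hy => Or.inl ?_⟩
  · simp only [List.pairwise_append, List.pairwise_replicate]
    refine ⟨Or.inr (by simp), Or.inr (by simp), fun a ha b hb => ?_⟩
    rw [List.eq_of_mem_replicate ha, List.eq_of_mem_replicate hb]
    simp
  · have e : ∀ {b : Bool} {s j : Fin k}, (b, s) ∈ List.replicate (c j i.succ) (false, j) ++
        List.replicate (c j i.castSucc) (true, j) → s = j := by
      intro b s j h
      simp only [List.mem_append, List.mem_replicate, Prod.mk.injEq] at h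
      tauto
    rwa [e hx, e hy]

/-- If no `-` survives, the very first sign is a `+`, since a leading `-` is never cancelled. A `-`
of row `j` comes after it, and in its own row a `+` comes last, so the leading `+` lies in an
earlier row. -/
theorem exists_of_minusPos_eq_none {c : Fin k → Fin (n + 1) → ℕ} {i : Fin n}
    (h : minusPos c i = none) {j : Fin k} (hj : 0 < c j i.succ) :
    ∃ j' < j, 0 < c j' i.castSucc := by
  have h1 : (false, j) ∈ signature c i := by
    rw [signature, List.mem_flatMap]
    exact ⟨j, List.mem_finRange j, List.mem_append_left _ (List.mem_replicate.2 ⟨hj.ne', rfl⟩)⟩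
  have h2 := pairwise_signature c i
  rw [minusPos_eq, List.getLast?_eq_none_iff] at h
  have h3 : ∀ a ∈ signature c i, 0 < c a.2 (if a.1 then i.castSucc else i.succ) :=
    fun a ha => (mem_flatMap_signature ha).2
  rcases hl : signature c i with _ | ⟨⟨b, j'⟩, l⟩
  · rw [hl] at h1; simp at h1
  · rw [hl] at h h1 h2 h3
    cases b
    · rw [red_false] at h; simp at h
    · have h4 : (false, j) ∈ l := by simpa using h1
      have h5 := (List.pairwise_cons.1 h2).1 _ h4
      exact ⟨j', by simpa using h5, by simpa using h3 _ List.mem_cons_self⟩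

/-- Strict columns starting at entries `≥ 0` leave no entry smaller than `j` in row `j`. -/
theorem IsStrictArray.partialSum_eq_zero {c : Fin k → Fin (n + 1) → ℕ} (hc : IsStrictArray c)
    (hk : k ≤ n + 1) (j : Fin k) : partialSum (c j) j = 0 := by
  obtain ⟨j, hj⟩ := j
  induction j with
  | zero => exact partialSum_zero _
  | succ j ih =>
    have := hc ⟨j, by omega⟩ ⟨j + 1, hj⟩ rfl j (by omega)
    have h := ih (by omega)
    simp only at h ⊢
    omega

/-- The highest weight array, by induction on the row. Entries below `j` are excluded by strictness.
An entry `i + 1 > j` would need an entry `i` in some earlier row `j'`, which contains only `j'`;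
then `i + 1 = j' + 1 ≤ j`, a contradiction. -/
theorem IsStrictArray.eq_single {c : Fin k → Fin (n + 1) → ℕ} (hc : IsStrictArray c)
    (hk : k ≤ n + 1) (h : ∀ i, minusPos c i = none) (j : Fin k) :
    c j = Pi.single (Fin.castLE hk j) (∑ b, c j b) := by
  have key : ∀ j : Fin k, ∀ b : Fin (n + 1), b ≠ Fin.castLE hk j → c j b = 0 := by
    intro j
    induction j using WellFoundedLT.induction with
    | ind j ih =>
    intro b hb
    have hb' : (b : ℕ) ≠ j := fun h => hb (Fin.ext h)
    by_contra h0
    rcases lt_or_gt_of_ne hb' with hlt | hlt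
    · have h1 := partialSum_succ (c j) b
      have h2 := hc.partialSum_eq_zero hk j
      have h3 := partialSum_mono (c j) (show (b : ℕ) + 1 ≤ j from hlt)
      omega
    · obtain ⟨i, rfl⟩ := Fin.exists_succ_eq.2 (show b ≠ 0 by rintro rfl; simp at hlt)
      obtain ⟨j', hj', h1⟩ := exists_of_minusPos_eq_none (h i) (Nat.pos_of_ne_zero h0)
      refine h1.ne' (ih j' hj' _ fun h2 => ?_)
      have h3 := congrArg Fin.val h2
      simp only [Fin.val_succ, Fin.val_castSucc, Fin.val_castLE] at hlt h3
      have : (j' : ℕ) < j := hj'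
      omega
  funext b
  by_cases hb : b = Fin.castLE hk j
  · subst hb
    rw [Pi.single_eq_same, Finset.sum_eq_single (Fin.castLE hk j) (fun b _ hb => key j b hb)]
    simp
  · rw [Pi.single_eq_of_ne hb, key j b hb]

theorem isStrictArray_single (hk : k ≤ n + 1) {l : Fin k → ℕ} (hl : Antitone l) :
    IsStrictArray fun j => Pi.single (M := fun _ : Fin (n + 1) => ℕ) (Fin.castLE hk j) (l j) := by
  intro j j' h t _
  have h2 : l j' ≤ l j := hl (Fin.le_def.2 (by omega))
  simp only [partialSum_single, Fin.val_castLE]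
  split_ifs <;> omega

end Strict

/-! ### Semistandard tableaux as strict arrays -/

section Tableaux

variable {n : ℕ} {μ : YoungDiagram}

theorem Tableau.partialSum_content (T : Tableau n μ) (r t : ℕ) :
    partialSum (T.content r) t = ((Finset.range (μ.rowLen r)).filter fun c => T.1 r c < t).card := by
  rw [Finset.card_eq_sum_card_fiberwise (f := fun c => T.get r c)
    (t := Finset.univ.filter fun b : Fin (n + 1) => (b : ℕ) < t), Finset.sum_filter]
  · refine Finset.sum_congr rfl fun b _ => ?_
    split_ifs with hb
    · rw [Tableau.content, Finset.filter_filter]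
      congr 1
      refine Finset.filter_congr fun c _ => ⟨fun h => ⟨?_, h⟩, fun h => h.2⟩
      rw [← h] at hb
      exact hb
    · rfl
  · intro c hc
    simp only [Finset.coe_filter, Set.mem_ofPred_eq, Finset.mem_univ, true_and] at hc ⊢
    exact hc.2

theorem Tableau.sum_content (T : Tableau n μ) (r : ℕ) : ∑ b, T.content r b = μ.rowLen r := by
  rw [← partialSum_last, T.partialSum_content, Finset.filter_true_of_mem, Finset.card_range]
  exact fun c _ => Nat.lt_succ_of_le (T.2 r c)

/-- Below an entry of row `j` stands a larger one, so a column with an entry `< t + 1` in row `j +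
1` has an entry `< t` in row `j`. -/
theorem Tableau.isStrictArray (T : Tableau n μ) :
    IsStrictArray fun j : Fin (μ.colLen 0) => T.content j := by
  intro j j' h t _
  simp only [T.partialSum_content, ← h]
  refine Finset.card_le_card fun c hc => ?_
  simp only [Finset.mem_filter, Finset.mem_range] at hc ⊢
  have h1 := T.1.col_strict (Nat.lt_succ_self j) (YoungDiagram.mem_iff_lt_rowLen.2 hc.1)
  have h2 := μ.rowLen_anti j (j + 1) (Nat.le_succ _)
  simp only [Nat.succ_eq_add_one] at h1
  omega

/-- The entry in column `p` of the weakly increasing row with given numbers of letters. -/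
def rowEntry (v : Fin (n + 1) → ℕ) (p : ℕ) : ℕ :=
  (Finset.univ.filter fun b : Fin (n + 1) => partialSum v (b + 1) ≤ p).card

theorem rowEntry_mono (v : Fin (n + 1) → ℕ) : Monotone (rowEntry v) := by
  intro p p' h
  refine Finset.card_le_card fun b hb => ?_
  simp only [Finset.mem_filter, Finset.mem_univ, true_and] at hb ⊢
  omega

/-- The adjunction between positions and partial sums; through it every statement on entries becomes
one on partial sums. -/
theorem rowEntry_lt_iff {v : Fin (n + 1) → ℕ} {p t : ℕ} (ht : t ≤ n + 1) :
    rowEntry v p < t ↔ p < partialSum v t := by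
  have hcard : (Finset.univ.filter fun b : Fin (n + 1) => (b : ℕ) < t).card = t := by
    rw [Fin.card_filter_val_lt]; omega
  constructor
  · intro h
    by_contra hp
    refine absurd (Finset.card_le_card fun b hb => ?_) (not_le.2 (hcard.symm ▸ h))
    simp only [Finset.mem_filter, Finset.mem_univ, true_and] at hb ⊢
    exact (partialSum_mono v hb).trans (not_lt.1 hp)
  · intro h
    rcases t with _ | t
    · rw [partialSum_zero] at h; omega
    refine Nat.lt_succ_of_le ?_
    have hcard' : (Finset.univ.filter fun b : Fin (n + 1) => (b : ℕ) < t).card = t := by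
      rw [Fin.card_filter_val_lt]; omega
    refine (Finset.card_le_card fun b hb => ?_).trans_eq hcard'
    simp only [Finset.mem_filter, Finset.mem_univ, true_and] at hb ⊢
    by_contra hb'
    have := partialSum_mono v (show t + 1 ≤ (b : ℕ) + 1 by omega)
    omega

/-- The converse of `Tableau.isStrictArray`: each row is filled in weakly increasing order, and the
inequalities for adjacent rows are exactly column strictness. -/
theorem exists_tableau {c : Fin (μ.colLen 0) → Fin (n + 1) → ℕ}
    (hc : ∀ j, ∑ b, c j b = μ.rowLen j) (hs : IsStrictArray c) :
    ∃ T : Tableau n μ, (fun j : Fin (μ.colLen 0) => T.content j) = c := by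
  -- The array is extended by zero rows, so that rows can be indexed by all natural numbers.
  obtain ⟨C, hC⟩ : ∃ C : ℕ → Fin (n + 1) → ℕ, ∀ j : Fin (μ.colLen 0), C j = c j :=
    ⟨fun r => if h : r < μ.colLen 0 then c ⟨r, h⟩ else 0, fun j => dif_pos j.2⟩
  have hrow : ∀ {r p : ℕ}, (r, p) ∈ μ → r < μ.colLen 0 := fun h =>
    (YoungDiagram.mem_iff_lt_colLen.1 h).trans_le (μ.colLen_anti 0 _ (Nat.zero_le _))
  have hlast : ∀ {r p : ℕ}, (r, p) ∈ μ → rowEntry (C r) p < n + 1 := by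
    intro r p h
    rw [rowEntry_lt_iff le_rfl, partialSum_last, hC ⟨r, hrow h⟩, hc]
    exact YoungDiagram.mem_iff_lt_rowLen.1 h
  have hstep : ∀ {r p : ℕ}, (r + 1, p) ∈ μ → rowEntry (C r) p < rowEntry (C (r + 1)) p := by
    intro r p h
    have h1 := hlast h
    have h2 : p < partialSum (C (r + 1)) (rowEntry (C (r + 1)) p + 1) :=
      (rowEntry_lt_iff h1).1 (Nat.lt_succ_self _)
    rw [rowEntry_lt_iff h1.le]
    refine h2.trans_le ?_
    have h3 := hs ⟨r, (Nat.lt_succ_self r).trans (hrow h)⟩ ⟨r + 1, hrow h⟩ rfl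
      (rowEntry (C (r + 1)) p) (Nat.lt_succ_iff.1 h1)
    rwa [← hC, ← hC] at h3
  have hcol : ∀ {r r' p : ℕ}, r < r' → (r', p) ∈ μ → rowEntry (C r) p < rowEntry (C r') p := by
    intro r r' p h
    induction r', h using Nat.le_induction with
    | base => exact hstep
    | succ r' h ih =>
      intro hm
      exact (ih (μ.up_left_mem (Nat.le_succ _) le_rfl hm)).trans (hstep hm)
  refine ⟨⟨⟨fun r p => if (r, p) ∈ μ then rowEntry (C r) p else 0, ?_, ?_, ?_⟩, ?_⟩, ?_⟩
  · intro r p p' h hm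
    rw [if_pos hm, if_pos (μ.up_left_mem le_rfl h.le hm)]
    exact rowEntry_mono _ h.le
  · intro r r' p h hm
    rw [if_pos hm, if_pos (μ.up_left_mem h.le le_rfl hm)]
    exact hcol h hm
  · intro r p h
    exact if_neg h
  · intro r p
    change (if (r, p) ∈ μ then rowEntry (C r) p else 0) ≤ n
    split_ifs with h
    · exact Nat.lt_succ_iff.1 (hlast h)
    · exact Nat.zero_le n
  · funext j
    refine ext_of_partialSum fun t ht => ?_
    refine (Tableau.partialSum_content _ _ _).trans ?_
    have hle : partialSum (c j) t ≤ μ.rowLen j := by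
      rw [← hc, ← partialSum_last]
      exact partialSum_mono _ ht
    conv_rhs => rw [← Finset.card_range (partialSum (c j) t)]
    congr 1
    ext p
    simp only [Finset.mem_filter, Finset.mem_range]
    change p < μ.rowLen j ∧ (if ((j : ℕ), p) ∈ μ then rowEntry (C j) p else 0) < t ↔ _
    rw [← YoungDiagram.mem_iff_lt_rowLen]
    constructor
    · rintro ⟨h1, h2⟩
      rwa [if_pos h1, rowEntry_lt_iff ht, hC] at h2
    · intro h
      have h1 : ((j : ℕ), p) ∈ μ := YoungDiagram.mem_iff_lt_rowLen.2 (h.trans_le hle)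
      rw [if_pos h1, rowEntry_lt_iff ht, hC]
      exact ⟨h1, h⟩

theorem Tableau.row_eq (T : Tableau n μ) (r : ℕ) :
    ((List.range (μ.rowLen r)).reverse).map (fun c => T.get r c) = rowWord (T.content r) := by
  refine eq_rowWord ?_ fun b => ?_
  · rw [List.pairwise_map, List.pairwise_reverse]
    refine List.Pairwise.imp_of_mem (fun {a b} _ hb h => ?_) (List.pairwise_lt_range)
    exact T.1.row_weak h (YoungDiagram.mem_iff_lt_rowLen.2 (List.mem_range.1 hb))
  · rw [Tableau.content, List.map_reverse, List.count_reverse]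
    induction μ.rowLen r with
    | zero => rfl
    | succ N ih =>
      rw [List.range_succ, List.map_append, List.count_append, ih, Finset.range_add_one,
        Finset.filter_insert]
      by_cases h : T.get r N = b <;> simp [h]

theorem Tableau.reading_eq (T : Tableau n μ) :
    T.reading = arrayReading fun j : Fin (μ.colLen 0) => T.content j := by
  rw [arrayReading, arrayWord, List.map_flatMap, Tableau.reading,
    ← List.map_coe_finRange_eq_range, List.flatMap_map]
  congr 1
  funext j
  rw [T.row_eq, List.map_map]
  exact (List.map_id _).symm

/-- Equal contents give equal words row by row, and such a word lists the entries of the row at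
fixed positions. -/
theorem Tableau.content_injective {T T' : Tableau n μ}
    (h : (fun j : Fin (μ.colLen 0) => T.content j) = fun j : Fin (μ.colLen 0) => T'.content j) :
    T = T' := by
  refine Subtype.ext (SemistandardYoungTableau.ext fun r p => ?_)
  by_cases hm : (r, p) ∈ μ
  · have hr : r < μ.colLen 0 :=
      (YoungDiagram.mem_iff_lt_colLen.1 hm).trans_le (μ.colLen_anti 0 _ (Nat.zero_le _))
    have h1 := congrFun h ⟨r, hr⟩
    simp only at h1
    have h2 := T.row_eq r
    rw [h1, ← T'.row_eq r] at h2
    have h3 := List.map_inj_left.1 h2 p (by simpa using YoungDiagram.mem_iff_lt_rowLen.1 hm)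
    exact congrArg Fin.val h3
  · rw [T.1.zeros hm, T'.1.zeros hm]

theorem Tableau.reading_injective :
    Function.Injective (Tableau.reading (n := n) (μ := μ)) := by
  intro T T' h
  rw [T.reading_eq, T'.reading_eq] at h
  exact T.content_injective
    (arrayReading_injective (fun j => T.sum_content j) (fun j => T'.sum_content j) h)

theorem Tableau.minus (T : Tableau n μ) {i : Fin n} {s : Fin (μ.colLen 0)}
    (hs : minusPos (fun j : Fin (μ.colLen 0) => T.content j) i = some s) :
    ∃ T' : Tableau n μ, (fun j : Fin (μ.colLen 0) => T'.content j) =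
      replaceEntry (fun j : Fin (μ.colLen 0) => T.content j) s i.succ i.castSucc :=
  exists_tableau (fun j => (sum_replaceEntry (wordE_arrayReading hs).1 j).trans (T.sum_content j))
    (T.isStrictArray.replaceEntry_minus hs)

theorem Tableau.plus (T : Tableau n μ) {i : Fin n} {s : Fin (μ.colLen 0)}
    (hs : plusPos (fun j : Fin (μ.colLen 0) => T.content j) i = some s) :
    ∃ T' : Tableau n μ, (fun j : Fin (μ.colLen 0) => T'.content j) =
      replaceEntry (fun j : Fin (μ.colLen 0) => T.content j) s i.castSucc i.succ :=
  exists_tableau (fun j => (sum_replaceEntry (wordF_arrayReading hs).1 j).trans (T.sum_content j))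
    (T.isStrictArray.replaceEntry_plus hs)

theorem Tableau.exists_wordE (T : Tableau n μ) {i : Fin n} {w : List (Fin (n + 1))}
    (h : wordE i T.reading = some w) : ∃ T' : Tableau n μ, T'.reading = w := by
  rw [T.reading_eq] at h
  rcases hs : minusPos (fun j : Fin (μ.colLen 0) => T.content j) i with _ | s
  · rw [wordE_arrayReading_eq_none hs] at h
    exact absurd h (by simp)
  · obtain ⟨T', hT'⟩ := T.minus hs
    rw [(wordE_arrayReading hs).2, ← hT', ← T'.reading_eq] at h
    exact ⟨T', Option.some.inj h⟩

theorem Tableau.exists_wordF (T : Tableau n μ) {i : Fin n} {w : List (Fin (n + 1))}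
    (h : wordF i T.reading = some w) : ∃ T' : Tableau n μ, T'.reading = w := by
  rw [T.reading_eq] at h
  rcases hs : plusPos (fun j : Fin (μ.colLen 0) => T.content j) i with _ | s
  · rw [wordF_arrayReading_eq_none hs] at h
    exact absurd h (by simp)
  · obtain ⟨T', hT'⟩ := T.plus hs
    rw [(wordF_arrayReading hs).2, ← hT', ← T'.reading_eq] at h
    exact ⟨T', Option.some.inj h⟩

-- The `dite` in the structure of `tableaux` never discards a nonzero value, because the operators
-- on words preserve the set of readings.
open Classical in
theorem reading_isStrictMorphism (n : ℕ) (μ : YoungDiagram) :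
    (tableaux n μ).IsStrictMorphism (words n) Tableau.reading where
  wt _ := rfl
  ε _ _ := rfl
  φ _ _ := rfl
  e i T := by
    change wordE i (Tableau.reading T) = Option.map Tableau.reading (if h : ∃ T' : Tableau n μ,
      wordE i (Tableau.reading T) = some T'.reading then some h.choose else none)
    split_ifs with h
    · exact h.choose_spec
    · rcases h1 : wordE i (Tableau.reading T) with _ | w
      · rfl
      · obtain ⟨T', rfl⟩ := Tableau.exists_wordE T h1
        exact absurd ⟨T', h1⟩ h
  f i T := by
    change wordF i (Tableau.reading T) = Option.map Tableau.reading (if h : ∃ T' : Tableau n μ,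
      wordF i (Tableau.reading T) = some T'.reading then some h.choose else none)
    split_ifs with h
    · exact h.choose_spec
    · rcases h1 : wordF i (Tableau.reading T) with _ | w
      · rfl
      · obtain ⟨T', rfl⟩ := Tableau.exists_wordF T h1
        exact absurd ⟨T', h1⟩ h

theorem tableaux_isCrystal (n : ℕ) (μ : YoungDiagram) : (tableaux n μ).IsCrystal :=
  (reading_isStrictMorphism n μ).isCrystal Tableau.reading_injective (words_isCrystal n)

end Tableaux

/-! ### Systems of primitive idempotents -/

/-- A decomposition of the identity into primitive idempotents of a split semisimple algebra; two of
them belong to the same simple module if and only if they have the same type. -/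
structure IdemSystem (A : Type) [Ring A] [Algebra ℂ A] {Ω L : Type} [Fintype Ω]
    (type : Ω → L) where
  p : Ω → A
  sum_eq : ∑ w, p w = 1
  mul_self : ∀ w, p w * p w = p w
  ne_zero : ∀ w, p w ≠ 0
  corner : ∀ w a, ∃ z : ℂ, p w * a * p w = z • p w
  link : ∀ v w, type v = type w → ∃ a b, p v * a * p w * b * p v = p v
  unlink : ∀ v w, type v ≠ type w → ∀ a, p v * a * p w = 0

namespace IdemSystem

variable {A : Type} [Ring A] [Algebra ℂ A] {Ω L : Type} [Fintype Ω] {type : Ω → L}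

/-- `M` is generated by a non-zero vector that is fixed by the idempotent `p w`. -/
def IsStd (S : IdemSystem A type) (M : FDMod A) (w : Ω) : Prop :=
  ∃ y : M.carrier, y ≠ 0 ∧ S.p w • y = y ∧ ∀ z, ∃ a : A, a • y = z

theorem exists_mul_ne_zero (S : IdemSystem A type) {a : A} (h : a ≠ 0) : ∃ v, S.p v * a ≠ 0 := by
  by_contra! h'
  apply h
  rw [← one_mul a, ← S.sum_eq, Finset.sum_mul]
  exact Finset.sum_eq_zero fun v _ => h' v

theorem exists_smul_ne_zero (S : IdemSystem A type) {M : FDMod A} {y : M.carrier} (h : y ≠ 0) :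
    ∃ v, S.p v • y ≠ 0 := by
  by_contra! h'
  apply h
  rw [← one_smul A y, ← S.sum_eq, Finset.sum_smul]
  exact Finset.sum_eq_zero fun v _ => h' v

/-- Since the corner at `w` consists of scalars and `v`, `w` are linked, `p v * a * p w` is a
multiple of the linking element. A nonzero multiple can be undone by rescaling the reverse link. -/
theorem exists_mul_eq (S : IdemSystem A type) {a : A} {v w : Ω} (h : S.p v * a * S.p w ≠ 0) :
    ∃ b, S.p w * b * S.p v * a * S.p w = S.p w := by
  have ht : type v = type w := by
    by_contra ht
    exact h (S.unlink v w ht a)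
  obtain ⟨c, d, hcd⟩ := S.link v w ht
  obtain ⟨z, hz⟩ := S.corner w (d * S.p v * a)
  have h1 : S.p v * a * S.p w = z • (S.p v * c * S.p w) := by
    calc S.p v * a * S.p w = S.p v * c * S.p w * d * S.p v * a * S.p w := by rw [hcd]
      _ = S.p v * c * (S.p w * S.p w) * d * S.p v * a * S.p w := by rw [S.mul_self]
      _ = S.p v * c * S.p w * (S.p w * (d * S.p v * a) * S.p w) := by noncomm_ring
      _ = z • (S.p v * c * (S.p w * S.p w)) := by rw [hz, mul_smul_comm]; noncomm_ring
      _ = _ := by rw [S.mul_self]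
  have hz0 : z ≠ 0 := by
    rintro rfl
    exact h (by rw [h1, zero_smul])
  refine ⟨z⁻¹ • d, ?_⟩
  have h2 : S.p w * (z⁻¹ • d) * S.p v * a * S.p w = z⁻¹ • (S.p w * (d * S.p v * a) * S.p w) := by
    simp only [mul_smul_comm, smul_mul_assoc, mul_assoc]
  rw [h2, hz, smul_smul, inv_mul_cancel₀ hz0, one_smul]

theorem exists_left_inverse (S : IdemSystem A type) {a : A} {w : Ω} (h : a * S.p w ≠ 0) :
    ∃ b, b * (a * S.p w) = S.p w := by
  obtain ⟨v, hv⟩ := S.exists_mul_ne_zero h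
  rw [← mul_assoc] at hv
  obtain ⟨b, hb⟩ := S.exists_mul_eq hv
  exact ⟨S.p w * b * S.p v, by simpa only [mul_assoc] using hb⟩

/-- By `exists_left_inverse` every nonzero `a • y` can be multiplied back to `y`, hence generates
the module. -/
theorem IsStd.isSimple {S : IdemSystem A type} {M : FDMod A} {w : Ω} (h : S.IsStd M w) :
    IsSimpleModule A M.carrier := by
  obtain ⟨y, hy, hw, hg⟩ := h
  rw [isSimpleModule_iff_toSpanSingleton_surjective]
  refine ⟨⟨y, 0, hy⟩, fun z hz t => ?_⟩
  obtain ⟨a, rfl⟩ := hg z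
  obtain ⟨c, rfl⟩ := hg t
  have h1 : a * S.p w ≠ 0 := by
    intro h0
    apply hz
    rw [← hw, smul_smul, h0, zero_smul]
  obtain ⟨b, hb⟩ := S.exists_left_inverse h1
  refine ⟨c * b, ?_⟩
  rw [LinearMap.toSpanSingleton_apply]
  calc (c * b) • a • y = c • (b * (a * S.p w)) • y := by rw [mul_smul, mul_smul, mul_smul, hw]
    _ = c • y := by rw [hb, hw]

theorem exists_isStd (S : IdemSystem A type) (M : FDMod A) [hM : IsSimpleModule A M.carrier] :
    ∃ w, S.IsStd M w := by
  rw [isSimpleModule_iff_toSpanSingleton_surjective] at hM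
  obtain ⟨hn, h⟩ := hM
  obtain ⟨y, hy⟩ := exists_ne (0 : M.carrier)
  obtain ⟨w, hw⟩ := S.exists_smul_ne_zero hy
  exact ⟨w, _, hw, by rw [smul_smul, S.mul_self], h _ hw⟩

theorem IsStd.of_type_eq {S : IdemSystem A type} {M : FDMod A} {v w : Ω} (h : S.IsStd M w)
    (ht : type w = type v) : S.IsStd M v := by
  obtain ⟨y, hy, hw, hg⟩ := h
  obtain ⟨a, b, hab⟩ := S.link w v ht
  have h1 : (S.p w * a) • (S.p v * b) • y = y := by
    conv_lhs => rw [← hw]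
    rw [smul_smul, smul_smul]
    conv_rhs => rw [← hw, ← hab]
    simp only [mul_assoc]
  refine ⟨(S.p v * b) • y, ?_, ?_, fun z => ?_⟩
  · intro h0
    rw [h0, smul_zero] at h1
    exact hy h1.symm
  · rw [smul_smul, ← mul_assoc, S.mul_self]
  · obtain ⟨c, rfl⟩ := hg z
    exact ⟨c * (S.p w * a), by rw [mul_smul, h1]⟩

/-- If the types differed, `p w * a * p v` would vanish, but it carries one generator to the other.
-/
theorem IsStd.type_eq {S : IdemSystem A type} {M : FDMod A} {v w : Ω} (h : S.IsStd M w)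
    (h' : S.IsStd M v) : type w = type v := by
  obtain ⟨y, hy, hw, hg⟩ := h
  obtain ⟨y', hy', hv, hg'⟩ := h'
  obtain ⟨a, rfl⟩ := hg' y
  by_contra ht
  apply hy
  rw [← hw, ← hv, smul_smul, smul_smul, S.unlink w v ht, zero_smul]

/-- The annihilator of the generator depends only on the idempotent, so the idempotent determines
the module up to isomorphism. -/
theorem IsStd.ker_eq {S : IdemSystem A type} {M : FDMod A} {w : Ω} {y : M.carrier} (hy : y ≠ 0)
    (hw : S.p w • y = y) (a : A) : a • y = 0 ↔ a * S.p w = 0 := by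
  refine ⟨fun h => ?_, fun h => by rw [← hw, smul_smul, h, zero_smul]⟩
  by_contra h0
  obtain ⟨b, hb⟩ := S.exists_left_inverse h0
  apply hy
  rw [← hw, ← hb, mul_smul, mul_smul, hw, h, smul_zero]

theorem IsStd.nonempty_equiv {S : IdemSystem A type} {M N : FDMod A} {v w : Ω} (h : S.IsStd M w)
    (h' : S.IsStd N v) (ht : type w = type v) : Nonempty (M.carrier ≃ₗ[A] N.carrier) := by
  obtain ⟨y, hy, hw, hg⟩ := h.of_type_eq ht
  obtain ⟨y', hy', hv, hg'⟩ := h'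
  have hk : LinearMap.ker (LinearMap.toSpanSingleton A M.carrier y)
      = LinearMap.ker (LinearMap.toSpanSingleton A N.carrier y') := by
    ext a
    rw [LinearMap.mem_ker, LinearMap.mem_ker, LinearMap.toSpanSingleton_apply,
      LinearMap.toSpanSingleton_apply, IsStd.ker_eq hy hw, IsStd.ker_eq hy' hv]
  exact ⟨(LinearMap.quotKerEquivOfSurjective (LinearMap.toSpanSingleton A M.carrier y) hg).symm.trans
    ((Submodule.quotEquivOfEq _ _ hk).trans (LinearMap.quotKerEquivOfSurjective
      (LinearMap.toSpanSingleton A N.carrier y') hg'))⟩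

theorem IsStd.of_equiv {S : IdemSystem A type} {M N : FDMod A} {w : Ω} (h : S.IsStd M w)
    (e : M.carrier ≃ₗ[A] N.carrier) : S.IsStd N w := by
  obtain ⟨y, hy, hw, hg⟩ := h
  refine ⟨e y, fun h0 => hy (e.map_eq_zero_iff.1 h0), by rw [← map_smul, hw], fun z => ?_⟩
  obtain ⟨a, ha⟩ := hg (e.symm z)
  exact ⟨a, by rw [← map_smul, ha, e.apply_symm_apply]⟩

/-! ### Tensor products of idempotent systems and of their modules -/

section Tensor

open scoped TensorProduct

variable {k : ℕ}

/-- Linear functionals that do not vanish on the factors multiply to one that does not vanish on the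
pure tensor. -/
theorem tprod_ne_zero {V : Fin k → Type} [∀ j, AddCommGroup (V j)] [∀ j, Module ℂ (V j)]
    {a : ∀ j, V j} (h : ∀ j, a j ≠ 0) : PiTensorProduct.tprod ℂ a ≠ 0 := by
  have : ∀ j, ∃ f : V j →ₗ[ℂ] ℂ, f (a j) ≠ 0 := by
    intro j
    by_contra! h'
    exact h j ((Module.forall_dual_apply_eq_zero_iff ℂ (a j)).1 h')
  choose f hf using this
  intro h0
  have h1 := congrArg (PiTensorProduct.lift
    ((MultilinearMap.mkPiAlgebra ℂ (Fin k) ℂ).compLinearMap f)) h0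
  rw [PiTensorProduct.lift.tprod, map_zero] at h1
  simp only [MultilinearMap.compLinearMap_apply, MultilinearMap.mkPiAlgebra_apply] at h1
  exact Finset.prod_ne_zero_iff.2 (fun j _ => hf j) h1

variable {A : Fin k → Type} [∀ j, Ring (A j)] [∀ j, Algebra ℂ (A j)]
  {Ω : Fin k → Type} {L : Type} [∀ j, Fintype (Ω j)] {type : ∀ j, Ω j → L}

/-- The idempotents `p_{w_1} ⊗ ⋯ ⊗ p_{w_k}` of `A_1 ⊗ ⋯ ⊗ A_k`. -/
noncomputable def tensor (S : ∀ j, IdemSystem (A j) (type j)) :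
    IdemSystem (⨂[ℂ] j, A j) (fun (w : ∀ j, Ω j) j => type j (w j)) where
  p w := PiTensorProduct.tprod ℂ fun j => (S j).p (w j)
  sum_eq := by
    rw [PiTensorProduct.one_def, ← MultilinearMap.map_sum]
    congr 1
    funext j
    exact (S j).sum_eq
  mul_self w := by
    rw [PiTensorProduct.tprod_mul_tprod]
    congr 1
    funext j
    exact (S j).mul_self (w j)
  ne_zero w := tprod_ne_zero fun j => (S j).ne_zero (w j)
  corner w a := by
    induction a using PiTensorProduct.induction_on with
    | smul_tprod r a =>
      choose z hz using fun j => (S j).corner (w j) (a j)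
      refine ⟨r * ∏ j, z j, ?_⟩
      rw [mul_smul_comm, smul_mul_assoc, PiTensorProduct.tprod_mul_tprod,
        PiTensorProduct.tprod_mul_tprod, mul_smul, ← MultilinearMap.map_smul_univ]
      congr 2
      funext j
      exact hz j
    | add a b ha hb =>
      obtain ⟨z, hz⟩ := ha
      obtain ⟨z', hz'⟩ := hb
      exact ⟨z + z', by rw [mul_add, add_mul, hz, hz', add_smul]⟩
  link v w h := by
    choose a b hab using fun j => (S j).link (v j) (w j) (congrFun h j)
    refine ⟨PiTensorProduct.tprod ℂ a, PiTensorProduct.tprod ℂ b, ?_⟩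
    simp only [PiTensorProduct.tprod_mul_tprod]
    congr 1
    funext j
    exact hab j
  unlink v w h a := by
    obtain ⟨j, hj⟩ := Function.ne_iff.1 h
    induction a using PiTensorProduct.induction_on with
    | smul_tprod r a =>
      rw [mul_smul_comm, smul_mul_assoc, PiTensorProduct.tprod_mul_tprod,
        PiTensorProduct.tprod_mul_tprod, MultilinearMap.map_coord_zero _ j, smul_zero]
      exact (S j).unlink _ _ hj (a j)
    | add a b ha hb => rw [mul_add, add_mul, ha, hb, add_zero]

theorem IsStd.tensor {S : ∀ j, IdemSystem (A j) (type j)} {M : ∀ j, FDMod (A j)} {w : ∀ j, Ω j}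
    (h : ∀ j, (S j).IsStd (M j) (w j)) : (IdemSystem.tensor S).IsStd (tensorMod M) w := by
  choose y hy hw hg using h
  refine ⟨(PiTensorProduct.tprod ℂ y : ⨂[ℂ] j, (M j).carrier), tprod_ne_zero hy, ?_, ?_⟩
  · refine (tensorAction_tprod M _ y).trans ?_
    simp only [hw]
  · intro z
    change ⨂[ℂ] j, (M j).carrier at z
    change ∃ a, tensorAction M a (PiTensorProduct.tprod ℂ y) = z
    induction z using PiTensorProduct.induction_on with
    | smul_tprod r x =>
      choose a ha using fun j => hg j (x j)
      refine ⟨r • PiTensorProduct.tprod ℂ a, ?_⟩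
      rw [map_smul, LinearMap.smul_apply, tensorAction_tprod]
      simp only [ha]
    | add x x' hx hx' =>
      obtain ⟨a, ha⟩ := hx
      obtain ⟨a', ha'⟩ := hx'
      exact ⟨a + a', by rw [map_add, LinearMap.add_apply, ha, ha']⟩

end Tensor

end IdemSystem

/-! ### The idempotents of the coloured planar rook algebra -/

section Diagrams

variable {n m : ℕ}

/-- The entry of a diagram that an element of `{0, …, n}` stands for. -/
def clr (b : Fin (n + 1)) : Fin n → ZMod 2 := colour (finSuccEquiv n b)

theorem clr_zero : clr (0 : Fin (n + 1)) = 0 := by simp [clr, colour]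

theorem clr_succ (i : Fin n) : clr i.succ = u i := by simp [clr, colour]

theorem clr_eq_zero {b : Fin (n + 1)} : clr b = 0 ↔ b = 0 := by
  refine ⟨fun h => ?_, fun h => h ▸ clr_zero⟩
  by_contra hb
  obtain ⟨i, rfl⟩ := Fin.exists_succ_eq.2 hb
  exact u_ne_zero i (clr_succ i ▸ h)

theorem clr_injective : Function.Injective (clr (n := n)) := by
  intro a b h
  by_cases hb : b = 0
  · subst hb
    rwa [clr_zero, clr_eq_zero] at h
  · by_cases ha : a = 0
    · subst ha
      rw [clr_zero, eq_comm, clr_eq_zero] at h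
      exact absurd h hb
    · obtain ⟨i, rfl⟩ := Fin.exists_succ_eq.2 ha
      obtain ⟨j, rfl⟩ := Fin.exists_succ_eq.2 hb
      rw [clr_succ, clr_succ] at h
      rw [u_inj h]

theorem clr_mul_clr (a b : Fin (n + 1)) : clr a * clr b = if a = b then clr a else 0 := by
  by_cases hb : b = 0
  · subst hb
    rw [clr_zero, mul_zero]
    split_ifs with h
    · rw [h, clr_zero]
    · rfl
  · by_cases ha : a = 0
    · subst ha
      rw [clr_zero, zero_mul, ite_self]
    · obtain ⟨i, rfl⟩ := Fin.exists_succ_eq.2 ha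
      obtain ⟨j, rfl⟩ := Fin.exists_succ_eq.2 hb
      rw [clr_succ, clr_succ, u_mul_u]
      simp

theorem P.exists_clr (d : P n m) (r c : Fin m) : ∃ b, d.mat r c = clr b := by
  rcases d.isPlanar.entry r c with h | ⟨i, h⟩
  · exact ⟨0, h.trans clr_zero.symm⟩
  · exact ⟨i.succ, h.trans (clr_succ i).symm⟩

theorem P.mul_eq_clr_iff (d d' : P n m) (r c : Fin m) {b : Fin (n + 1)} (hb : b ≠ 0) :
    (d * d').mat r c = clr b ↔ ∃ k, d.mat r k = clr b ∧ d'.mat k c = clr b := by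
  obtain ⟨i, rfl⟩ := Fin.exists_succ_eq.2 hb
  rw [clr_succ]
  exact (d.isPlanar.mul_eq_u_iff d'.isPlanar r c).2 i

/-- The diagram turned upside down. -/
def P.transpose (d : P n m) : P n m where
  mat := d.mat.transpose
  isPlanar := ⟨fun r c => d.isPlanar.entry c r, fun r c c' h h' => d.isPlanar.col c c' r h h',
    fun r r' c h h' => d.isPlanar.row c r r' h h',
    fun i r s c e hrs hce ⟨h1, h2, h3, h4⟩ => d.isPlanar.planar i c e r s hce hrs ⟨h1, h3, h2, h4⟩⟩

theorem P.exists_botWord (d : P n m) :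
    ∃ w : Fin m → Fin (n + 1), ∀ c b, b ≠ 0 → (w c = b ↔ ∃ r, d.mat r c = clr b) := by
  have : ∀ c, ∃ a : Fin (n + 1), ∀ b, b ≠ 0 → (a = b ↔ ∃ r, d.mat r c = clr b) := by
    intro c
    by_cases h : ∃ r, d.mat r c ≠ 0
    · obtain ⟨r, hr⟩ := h
      obtain ⟨a, ha⟩ := d.exists_clr r c
      refine ⟨a, fun b hb => ⟨fun h => ⟨r, h ▸ ha⟩, ?_⟩⟩
      rintro ⟨r', hr'⟩
      have := d.isPlanar.col r r' c hr (by rw [hr']; exact mt clr_eq_zero.1 hb)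
      subst this
      exact clr_injective (ha.symm.trans hr')
    · push Not at h
      refine ⟨0, fun b hb => ⟨fun h => absurd h.symm hb, ?_⟩⟩
      rintro ⟨r, hr⟩
      rw [h] at hr
      exact absurd (clr_eq_zero.1 hr.symm) hb
  choose w hw using this
  exact ⟨w, hw⟩

/-- The colours of the bottom vertices; `0` for the isolated ones. -/
noncomputable def P.botWord (d : P n m) : Fin m → Fin (n + 1) := d.exists_botWord.choose

/-- The colours of the top vertices; `0` for the isolated ones. -/
noncomputable def P.topWord (d : P n m) : Fin m → Fin (n + 1) := d.transpose.botWord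

theorem P.botWord_eq_iff (d : P n m) {c : Fin m} {b : Fin (n + 1)} (hb : b ≠ 0) :
    d.botWord c = b ↔ ∃ r, d.mat r c = clr b := d.exists_botWord.choose_spec c b hb

theorem P.topWord_eq_iff (d : P n m) {r : Fin m} {b : Fin (n + 1)} (hb : b ≠ 0) :
    d.topWord r = b ↔ ∃ c, d.mat r c = clr b := d.transpose.botWord_eq_iff hb

theorem P.topWord_eq (d : P n m) {r c : Fin m} {b : Fin (n + 1)} (hb : b ≠ 0)
    (h : d.mat r c = clr b) : d.topWord r = b := (d.topWord_eq_iff hb).2 ⟨c, h⟩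

theorem P.botWord_eq (d : P n m) {r c : Fin m} {b : Fin (n + 1)} (hb : b ≠ 0)
    (h : d.mat r c = clr b) : d.botWord c = b := (d.botWord_eq_iff hb).2 ⟨r, h⟩

theorem word_ext {v w : Fin m → Fin (n + 1)} (h : ∀ t, ∀ b ≠ 0, v t = b ↔ w t = b) : v = w := by
  funext t
  by_cases hw : w t = 0
  · by_contra hv
    have hv' : v t ≠ 0 := fun h => hv (h.trans hw.symm)
    exact hv ((h t (v t) hv').1 rfl).symm
  · exact (h t (w t) hw).2 rfl

theorem bottom_eq (d : P n m) (i : Fin (n + 1)) :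
    bottom d i = Finset.univ.filter fun t => d.botWord t = i := by
  classical
  ext t
  by_cases hi : i = 0
  · subst hi
    simp only [bottom, Fin.cases_zero, Finset.mem_filter, Finset.mem_univ, true_and]
    constructor
    · intro h
      by_contra h'
      obtain ⟨r, hr⟩ := (d.botWord_eq_iff h').1 rfl
      rw [h, eq_comm, clr_eq_zero] at hr
      exact h' hr
    · intro h r
      obtain ⟨b, hb⟩ := d.exists_clr r t
      by_cases hb0 : b = 0
      · rw [hb, hb0, clr_zero]
      · exact absurd ((d.botWord_eq hb0 hb).symm.trans h) hb0
  · have h1 := d.botWord_eq_iff (c := t) hi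
    obtain ⟨i, rfl⟩ := Fin.exists_succ_eq.2 hi
    simp only [bottom, Fin.cases_succ, Finset.mem_filter, Finset.mem_univ, true_and, h1, clr_succ]

theorem botWord_eq_of_bottom {d d' : P n m} (h : bottom d = bottom d') :
    d.botWord = d'.botWord := by
  funext t
  have h1 := congrFun h (d'.botWord t)
  rw [bottom_eq, bottom_eq] at h1
  have h2 : t ∈ Finset.univ.filter fun s => d'.botWord s = d'.botWord t := by simp
  rw [← h1] at h2
  simpa using h2

/-- The diagram with vertical edges of the given colours. -/
def vert (w : Fin m → Fin (n + 1)) : P n m := vertical fun t => finSuccEquiv n (w t)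

theorem vert_mat (w : Fin m → Fin (n + 1)) : (vert w).mat = Matrix.diagonal fun t => clr (w t) := rfl

theorem botWord_vert (w : Fin m → Fin (n + 1)) : (vert w).botWord = w := by
  refine word_ext fun t b hb => ?_
  rw [P.botWord_eq_iff _ hb, vert_mat]
  constructor
  · rintro ⟨r, hr⟩
    by_cases h : r = t
    · subst h
      rw [Matrix.diagonal_apply_eq] at hr
      exact clr_injective hr
    · rw [Matrix.diagonal_apply_ne _ h] at hr
      exact absurd (clr_eq_zero.1 hr.symm) hb
  · rintro rfl
    exact ⟨t, Matrix.diagonal_apply_eq _ _⟩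

theorem topWord_vert (w : Fin m → Fin (n + 1)) : (vert w).topWord = w := by
  have : (vert w).transpose = vert w := P.ext (Matrix.diagonal_transpose _)
  rw [P.topWord, this, botWord_vert]

theorem mem_supp_iff {d : P n m} {c : Fin m} : c ∈ supp d ↔ d.botWord c ≠ 0 := by
  rw [mem_supp]
  constructor
  · rintro ⟨r, hr⟩
    obtain ⟨b, hb⟩ := d.exists_clr r c
    have hb0 : b ≠ 0 := fun h => hr (by rw [hb, h, clr_zero])
    rwa [d.botWord_eq hb0 hb]
  · intro h
    obtain ⟨r, hr⟩ := (d.botWord_eq_iff h).1 rfl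
    exact ⟨r, by rw [hr]; exact mt clr_eq_zero.1 h⟩

/-- The number of letters of each kind. -/
def wordType (w : Fin m → Fin (n + 1)) (b : Fin (n + 1)) : ℕ :=
  (Finset.univ.filter fun t => w t = b).card

theorem sum_wordType (w : Fin m → Fin (n + 1)) : ∑ b, wordType w b = m := by
  have := Finset.card_eq_sum_card_fiberwise (f := w) (s := Finset.univ) (t := Finset.univ)
    (fun _ _ => Finset.mem_coe.2 (Finset.mem_univ _))
  rw [Finset.card_univ, Fintype.card_fin] at this
  exact this.symm

theorem wordType_ext {v w : Fin m → Fin (n + 1)}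
    (h : ∀ b ≠ 0, wordType v b = wordType w b) : wordType v = wordType w := by
  funext b
  by_cases hb : b = 0
  · subst hb
    have h1 := (sum_wordType v).trans (sum_wordType w).symm
    rw [Fin.sum_univ_succ, Fin.sum_univ_succ,
      Finset.sum_congr rfl fun i _ => h _ (Fin.succ_ne_zero i)] at h1
    omega
  · exact h b hb

/-- The edges of a given nonzero colour match top vertices with bottom vertices; the count of
isolated vertices follows from the total. -/
theorem wordType_topWord (d : P n m) : wordType d.topWord = wordType d.botWord := by
  refine wordType_ext fun b hb => ?_
  have hne : clr b ≠ 0 := mt clr_eq_zero.1 hb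
  choose! f hf using fun r (h : d.topWord r = b) => (d.topWord_eq_iff hb).1 h
  refine Finset.card_bij (fun r _ => f r) (fun r hr => ?_) (fun r hr r' hr' h => ?_) fun c hc => ?_
  · simp only [Finset.mem_filter, Finset.mem_univ, true_and] at hr ⊢
    exact d.botWord_eq hb (hf r hr)
  · simp only [Finset.mem_filter, Finset.mem_univ, true_and] at hr hr'
    have h1 := hf r hr
    have h2 := hf r' hr'
    rw [h] at h1
    exact d.isPlanar.col r r' _ (h1 ▸ hne) (h2 ▸ hne)
  · simp only [Finset.mem_filter, Finset.mem_univ, true_and] at hc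
    obtain ⟨r, hr⟩ := (d.botWord_eq_iff hb).1 hc
    have h1 := d.topWord_eq hb hr
    exact ⟨r, by simp [h1], d.isPlanar.row r _ _ (hf r h1 ▸ hne) (hr ▸ hne)⟩

theorem P.lt_of_lt (d : P n m) {b : Fin (n + 1)} (hb : b ≠ 0) {r s c e : Fin m}
    (hr : d.mat r c = clr b) (hs : d.mat s e = clr b) (h : r < s) : c < e := by
  have hne : clr b ≠ 0 := mt clr_eq_zero.1 hb
  have z : ∀ {x y y'}, d.mat x y = clr b → y' ≠ y → d.mat x y' = 0 := by
    intro x y y' h hy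
    by_contra h'
    exact hy (d.isPlanar.row x y' y h' (h ▸ hne))
  obtain ⟨i, rfl⟩ := Fin.exists_succ_eq.2 hb
  rcases lt_trichotomy c e with hce | hce | hce
  · exact hce
  · subst hce
    exact absurd (d.isPlanar.col r s c (hr ▸ hne) (hs ▸ hne)) h.ne
  · exact absurd ⟨z hr hce.ne, hr.trans (clr_succ i), hs.trans (clr_succ i), z hs hce.ne'⟩
      (d.isPlanar.planar i r s e c h hce)

/-- Edges of one colour do not cross, so they join the vertices of that colour in increasing order;
if these occupy the same places above and below, every edge is vertical. -/
theorem P.eq_vert {d : P n m} (h : d.topWord = d.botWord) : d = vert d.botWord := by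
  have key : ∀ b ≠ 0, ∀ r c, d.mat r c = clr b → r = c := by
    intro b hb r
    have hne : clr b ≠ 0 := mt clr_eq_zero.1 hb
    induction r using WellFoundedLT.induction with
    | ind r ih =>
    intro c hc
    rcases lt_trichotomy r c with hrc | hrc | hrc
    · -- the edge that ends in `r` starts to the right of `r`
      have h1 := d.topWord_eq hb hc
      rw [h] at h1
      obtain ⟨s, hs⟩ := (d.botWord_eq_iff hb).1 h1
      rcases lt_trichotomy s r with hsr | hsr | hsr
      · exact absurd (ih s hsr r hs) hsr.ne
      · subst hsr
        exact d.isPlanar.row s s c (hs ▸ hne) (hc ▸ hne)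
      · exact absurd (d.lt_of_lt hb hc hs hsr) hrc.asymm
    · exact hrc
    · have h1 := d.botWord_eq hb hc
      rw [← h] at h1
      obtain ⟨e, he⟩ := (d.topWord_eq_iff hb).1 h1
      have := ih c hrc e he
      subst this
      exact d.isPlanar.col r c c (hc ▸ hne) (he ▸ hne)
  apply P.ext
  ext1 r c
  rw [vert_mat]
  obtain ⟨b, hb⟩ := d.exists_clr r c
  by_cases hb0 : b = 0
  · rw [hb, hb0, clr_zero]
    by_cases hrc : r = c
    · subst hrc
      rw [Matrix.diagonal_apply_eq]
      by_contra h0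
      have h1 : d.botWord r ≠ 0 := fun h => h0 (by rw [h, clr_zero])
      obtain ⟨s, hs⟩ := (d.botWord_eq_iff h1).1 rfl
      have h2 := key _ h1 s r hs
      subst h2
      rw [hb] at hs
      exact h1 ((clr_injective hs).symm.trans hb0)
    · rw [Matrix.diagonal_apply_ne _ hrc]
  · have hrc := key b hb0 r c hb
    subst hrc
    rw [Matrix.diagonal_apply_eq, hb, d.botWord_eq hb0 hb]

/-- The number of vertices with the same letter to the left of a vertex. -/
def letterRank (w : Fin m → Fin (n + 1)) (t : Fin m) : ℕ :=
  (Finset.univ.filter fun s => s < t ∧ w s = w t).card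

theorem letterRank_lt {w : Fin m → Fin (n + 1)} {s t : Fin m} (h : s < t) (hw : w s = w t) :
    letterRank w s < letterRank w t := by
  refine Finset.card_lt_card (Finset.ssubset_iff_of_subset ?_ |>.2 ⟨s, by simp [h, hw], by simp⟩)
  intro r hr
  simp only [Finset.mem_filter, Finset.mem_univ, true_and] at hr ⊢
  exact ⟨hr.1.trans h, hr.2.trans hw⟩

theorem letterRank_inj {w : Fin m → Fin (n + 1)} {s t : Fin m} (hw : w s = w t)
    (h : letterRank w s = letterRank w t) : s = t := by
  rcases lt_trichotomy s t with hst | hst | hst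
  · exact absurd h (letterRank_lt hst hw).ne
  · exact hst
  · exact absurd h (letterRank_lt hst hw.symm).ne'

theorem image_letterRank (w : Fin m → Fin (n + 1)) (b : Fin (n + 1)) :
    (Finset.univ.filter fun t => w t = b).image (letterRank w) = Finset.range (wordType w b) := by
  refine Finset.eq_of_subset_of_card_le (fun x hx => ?_) ?_
  · obtain ⟨t, ht, rfl⟩ := Finset.mem_image.1 hx
    simp only [Finset.mem_filter, Finset.mem_univ, true_and] at ht
    subst ht
    rw [Finset.mem_range]
    refine Finset.card_lt_card (Finset.ssubset_iff_of_subset ?_ |>.2 ⟨t, by simp, by simp⟩)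
    intro r hr
    simp only [Finset.mem_filter, Finset.mem_univ, true_and] at hr ⊢
    exact hr.2
  · rw [Finset.card_range, Finset.card_image_of_injOn]
    · rfl
    · intro s hs t ht h
      simp only [Finset.coe_filter, Finset.mem_univ, true_and, Set.mem_ofPred_eq] at hs ht
      exact letterRank_inj (hs.trans ht.symm) h

theorem exists_letterRank_eq {v w : Fin m → Fin (n + 1)} (h : wordType v = wordType w)
    (r : Fin m) : ∃ c, w c = v r ∧ letterRank w c = letterRank v r := by
  have h1 : letterRank v r ∈ Finset.range (wordType w (v r)) := by
    rw [← h, ← image_letterRank]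
    exact Finset.mem_image_of_mem _ (by simp)
  rw [← image_letterRank] at h1
  obtain ⟨c, hc, hc'⟩ := Finset.mem_image.1 h1
  exact ⟨c, by simpa using hc, hc'⟩

-- Vertices with the same letter are joined according to their rank among these letters. For the
-- letter `0` the entry `clr 0` is zero, so no edge appears.
open Classical in
theorem exists_diagram {v w : Fin m → Fin (n + 1)} (h : wordType v = wordType w) :
    ∃ d : P n m, d.topWord = v ∧ d.botWord = w := by
  obtain ⟨d, hd⟩ : ∃ d : P n m, ∀ r c, d.mat r c =
      if v r = w c ∧ letterRank v r = letterRank w c then clr (v r) else 0 := by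
    have key : ∀ r c, (if v r = w c ∧ letterRank v r = letterRank w c then clr (v r) else 0) ≠ 0 →
        v r = w c ∧ letterRank v r = letterRank w c := by
      intro r c h
      by_contra h'
      exact h (if_neg h')
    refine ⟨⟨Matrix.of fun r c =>
      if v r = w c ∧ letterRank v r = letterRank w c then clr (v r) else 0, ?_, ?_, ?_, ?_⟩,
      fun _ _ => rfl⟩
    · intro r c
      simp only [Matrix.of_apply]
      split_ifs
      · exact colour_cases _
      · exact Or.inl rfl
    · intro r c c' h1 h2
      obtain ⟨h3, h4⟩ := key _ _ h1
      obtain ⟨h5, h6⟩ := key _ _ h2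
      exact letterRank_inj (h3.symm.trans h5) (h4.symm.trans h6)
    · intro r r' c h1 h2
      obtain ⟨h3, h4⟩ := key _ _ h1
      obtain ⟨h5, h6⟩ := key _ _ h2
      exact letterRank_inj (h3.trans h5.symm) (h4.trans h6.symm)
    · rintro i r s c e hrs hce ⟨-, h1, h2, -⟩
      simp only [Matrix.of_apply] at h1 h2
      obtain ⟨h3, h4⟩ := key _ _ (h1 ▸ u_ne_zero i)
      obtain ⟨h5, h6⟩ := key _ _ (h2 ▸ u_ne_zero i)
      rw [if_pos ⟨h3, h4⟩] at h1
      rw [if_pos ⟨h5, h6⟩] at h2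
      -- Both edges have the same colour, and ranks increase along equal letters, so a crossing
      -- would give contradictory inequalities of ranks.
      have h7 := clr_injective (h1.trans h2.symm)
      have h8 := letterRank_lt hrs h7
      have h9 := letterRank_lt hce (h5.symm.trans (h7.symm.trans h3))
      omega
  have hd' : ∀ {r c b}, b ≠ 0 → d.mat r c = clr b →
      v r = b ∧ w c = b ∧ letterRank v r = letterRank w c := by
    intro r c b hb h
    rw [hd] at h
    split_ifs at h with h1
    · have h2 := clr_injective h
      exact ⟨h2, h1.1.symm.trans h2, h1.2⟩
    · exact absurd (clr_eq_zero.1 h.symm) hb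
  refine ⟨d, word_ext fun t b hb => ?_, word_ext fun t b hb => ?_⟩
  · rw [d.topWord_eq_iff hb]
    refine ⟨fun ⟨c, hc⟩ => (hd' hb hc).1, ?_⟩
    rintro rfl
    obtain ⟨c, h1, h2⟩ := exists_letterRank_eq h t
    exact ⟨c, by rw [hd, if_pos ⟨h1.symm, h2.symm⟩]⟩
  · rw [d.botWord_eq_iff hb]
    refine ⟨fun ⟨c, hc⟩ => (hd' hb hc).2.1, ?_⟩
    rintro rfl
    obtain ⟨c, h1, h2⟩ := exists_letterRank_eq h.symm t
    exact ⟨c, by rw [hd, if_pos ⟨h1, h2⟩, h1]⟩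

/-- When the colours match in the middle, no edge is lost in the product. -/
theorem mul_of_botWord_eq {d d' : P n m} (h : d.botWord = d'.topWord) :
    supp (d * d') = supp d' ∧ (d * d').topWord = d.topWord ∧ (d * d').botWord = d'.botWord := by
  have hs : supp (d * d') = supp d' := by
    refine (supp_mul_subset d d').antisymm fun c hc => ?_
    obtain ⟨k, hk⟩ := (d'.botWord_eq_iff (mem_supp_iff.1 hc)).1 rfl
    have h1 := d'.topWord_eq (mem_supp_iff.1 hc) hk
    rw [← h] at h1
    obtain ⟨r, hr⟩ := (d.botWord_eq_iff (mem_supp_iff.1 hc)).1 h1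
    refine mem_supp.2 ⟨r, ?_⟩
    rw [(P.mul_eq_clr_iff d d' r c (mem_supp_iff.1 hc)).2 ⟨k, hr, hk⟩]
    exact mt clr_eq_zero.1 (mem_supp_iff.1 hc)
  refine ⟨hs, word_ext fun r b hb => ?_, botWord_eq_of_bottom (bottom_mul hs)⟩
  rw [P.topWord_eq_iff _ hb, P.topWord_eq_iff _ hb]
  constructor
  · rintro ⟨c, hc⟩
    obtain ⟨k, hk, -⟩ := (P.mul_eq_clr_iff d d' r c hb).1 hc
    exact ⟨k, hk⟩
  · rintro ⟨k, hk⟩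
    have h1 := d.botWord_eq hb hk
    rw [h] at h1
    obtain ⟨c, hc⟩ := (d'.topWord_eq_iff hb).1 h1
    exact ⟨c, (P.mul_eq_clr_iff d d' r c hb).2 ⟨k, hk, hc⟩⟩

end Diagrams

/-! ### The idempotents of words and their products with the basis elements -/

section Algebra

variable {n m : ℕ}

/-- The coefficients of the idempotents `I_0` and `I_i - I_0`. -/
def idemCoeff (b a : Fin (n + 1)) : ℂ :=
  (if a = b then 1 else 0) - if b ≠ 0 ∧ a = 0 then 1 else 0

/-- The tensor product of the idempotents `I_0` and `I_i - I_0` that belong to the letters of a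
word. -/
noncomputable def wordIdem (w : Fin m → Fin (n + 1)) : CP n m :=
  ∑ o : Fin m → Fin (n + 1), MonoidAlgebra.single (vert o) (∏ t, idemCoeff (w t) (o t))

theorem sum_idemCoeff_left (a : Fin (n + 1)) :
    ∑ b, idemCoeff b a = unitCoeff (finSuccEquiv n a) := by
  simp only [idemCoeff, Finset.sum_sub_distrib, Finset.sum_ite_eq, Finset.mem_univ, if_true]
  refine Fin.cases ?_ (fun i => ?_) a
  · simp [unitCoeff, Fin.sum_univ_succ]
  · simp [unitCoeff]

theorem sum_idemCoeff_right (b t : Fin (n + 1)) :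
    (∑ a, if t = 0 ∨ a = t then idemCoeff b a else 0) = if b = t then 1 else 0 := by
  by_cases ht : t = 0
  · subst ht
    simp only [true_or, if_true, idemCoeff, Finset.sum_sub_distrib, Finset.sum_ite_eq',
      Finset.mem_univ]
    by_cases hb : b = 0 <;> simp [hb]
  · simp only [ht, false_or, Finset.sum_ite_eq', Finset.mem_univ, if_true, idemCoeff]
    simp [eq_comm]

/-- After exchanging the sums, the coefficients factor over the vertices and reproduce those of
`unit`, the identity element of the algebra. -/
theorem sum_wordIdem : ∑ w, (wordIdem w : CP n m) = 1 := by
  simp only [wordIdem]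
  rw [Finset.sum_comm]
  change _ = unit n m
  rw [unit, ← Equiv.sum_comp (Equiv.arrowCongr (Equiv.refl (Fin m)) (finSuccEquiv n))]
  refine Finset.sum_congr rfl fun o _ => ?_
  have h := Finset.prod_univ_sum (fun _ : Fin m => (Finset.univ : Finset (Fin (n + 1))))
    (fun t b => idemCoeff b (o t))
  simp only [Fintype.piFinset_univ, sum_idemCoeff_left] at h
  refine (map_sum (MonoidAlgebra.singleAddHom (R := ℂ) (vert o)) _ _).symm.trans ?_
  rw [← h]
  rfl

/-- A vertical diagram keeps the edges whose colours match at the top and deletes the others; losing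
any edge annihilates `x d`. -/
theorem single_vert_mul_x (w : Fin m → Fin (n + 1)) (z : ℂ) (d : P n m) :
    MonoidAlgebra.single (vert w) z * x d =
      (if ∀ t, d.topWord t = 0 ∨ w t = d.topWord t then z else 0) • x d := by
  have hm : ∀ r c, (vert w * d).mat r c = clr (w r) * d.mat r c := fun r c => by
    rw [P.mul_mat, vert_mat, Matrix.diagonal_mul]
  rw [single_mul_x]
  by_cases h : ∀ t, d.topWord t = 0 ∨ w t = d.topWord t
  · have hd : vert w * d = d := by
      apply P.ext
      ext1 r c
      rw [hm]
      obtain ⟨b, hb⟩ := d.exists_clr r c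
      by_cases hb0 : b = 0
      · rw [hb, hb0, clr_zero, mul_zero]
      · have h1 := d.topWord_eq hb0 hb
        have h2 := (h r).resolve_left (h1 ▸ hb0)
        rw [h2, h1, hb, clr_mul_clr, if_pos rfl]
    rw [if_pos h, hd, if_pos rfl]
  · rw [if_neg h, zero_smul, if_neg]
    push Not at h
    obtain ⟨t, h1, h2⟩ := h
    obtain ⟨c, hc⟩ := (d.topWord_eq_iff h1).1 rfl
    intro hs
    have hcs : c ∈ supp (vert w * d) := by
      rw [hs, mem_supp]
      exact ⟨t, by rw [hc]; exact mt clr_eq_zero.1 h1⟩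
    obtain ⟨r, hr⟩ := mem_supp.1 hcs
    rw [hm] at hr
    have hrt : r = t := d.isPlanar.col r t c (right_ne_zero_of_mul hr)
      (by rw [hc]; exact mt clr_eq_zero.1 h1)
    subst hrt
    rw [hc, clr_mul_clr, if_neg h2] at hr
    exact hr rfl

/-- The sum factors over the top vertices. At each vertex the coefficients of the admissible letters
add up to one if the letter of `w` is the right one, and to zero otherwise. -/
theorem wordIdem_mul_x (w : Fin m → Fin (n + 1)) (d : P n m) :
    wordIdem w * x d = if w = d.topWord then x d else 0 := by
  classical
  have h := Finset.prod_univ_sum (fun _ : Fin m => (Finset.univ : Finset (Fin (n + 1))))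
    (fun t a => if d.topWord t = 0 ∨ a = d.topWord t then idemCoeff (w t) a else 0)
  simp only [Fintype.piFinset_univ, sum_idemCoeff_right, Finset.prod_ite_zero, Finset.mem_univ,
    true_imp_iff, Finset.prod_const_one] at h
  simp only [wordIdem, Finset.sum_mul, single_vert_mul_x, ← Finset.sum_smul]
  rw [← h]
  simp only [funext_iff]
  split_ifs <;> simp

/-- Expanding the product of the `I_i - I_0` is the inclusion-exclusion sum over the edges of the
vertical diagram: choosing `-I_0` at a vertex deletes its edge. -/
theorem wordIdem_eq_x (w : Fin m → Fin (n + 1)) : wordIdem w = x (vert w) := by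
  classical
  have hsupp : ∀ t, t ∈ supp (vert w) ↔ w t ≠ 0 := fun t => by rw [mem_supp_iff, botWord_vert]
  rw [x_eq, wordIdem]
  symm
  refine Finset.sum_of_injOn (fun C t => if t ∈ C then w t else 0) ?_ (by simp) ?_ ?_
  · intro C hC C' hC' h
    have hC := Finset.mem_powerset.1 (Finset.mem_coe.1 hC)
    have hC' := Finset.mem_powerset.1 (Finset.mem_coe.1 hC')
    ext t
    have h1 := congrFun h t
    simp only at h1
    by_cases h2 : t ∈ C <;> by_cases h3 : t ∈ C' <;> simp only [h2, h3, if_true, if_false] at h1 ⊢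
    · exact absurd h1 ((hsupp t).1 (hC h2))
    · exact absurd h1.symm ((hsupp t).1 (hC' h3))
  · intro o _ ho
    by_contra h0
    have h1 : ∏ t, idemCoeff (w t) (o t) ≠ 0 := fun h => h0 (by rw [h, MonoidAlgebra.single_zero])
    have h2 : ∀ t, o t = w t ∨ (w t ≠ 0 ∧ o t = 0) := by
      intro t
      have h3 := Finset.prod_ne_zero_iff.1 h1 t (Finset.mem_univ t)
      by_contra h4
      push Not at h4
      exact h3 (by simp only [idemCoeff, h4.1, if_false]; rw [if_neg (fun h => h4.2 h.1 h.2), sub_zero])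
    refine ho ⟨Finset.univ.filter fun t => o t ≠ 0, ?_, ?_⟩
    · refine Finset.mem_coe.2 (Finset.mem_powerset.2 fun t ht => (hsupp t).2 ?_)
      have h5 : o t ≠ 0 := by simpa using ht
      rcases h2 t with h | h
      · rwa [← h]
      · exact h.1
    · funext t
      simp only [Finset.mem_filter, Finset.mem_univ, true_and]
      split_ifs with h5
      · exact ((h2 t).resolve_right fun h => h5 h.2).symm
      · push Not at h5
        exact h5.symm
  · intro C hC
    have hC := Finset.mem_powerset.1 hC
    have hk : keep (vert w) C = vert fun t => if t ∈ C then w t else 0 := by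
      apply P.ext
      ext1 r c
      rw [keep_mat, vert_mat, vert_mat]
      by_cases hrc : r = c
      · subst hrc
        rw [Matrix.diagonal_apply_eq, Matrix.diagonal_apply_eq]
        split_ifs
        · rfl
        · exact clr_zero.symm
      · rw [Matrix.diagonal_apply_ne _ hrc, Matrix.diagonal_apply_ne _ hrc, ite_self]
    have hp : ∀ t, idemCoeff (w t) (if t ∈ C then w t else 0) =
        if t ∈ supp (vert w) \ C then -1 else 1 := by
      intro t
      have := hsupp t
      simp only [Finset.mem_sdiff, this, idemCoeff]
      by_cases h1 : t ∈ C
      · have h2 := this.1 (hC h1)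
        simp [h1]
      · by_cases h2 : w t = 0
        · simp [h2]
        · simp [h1, h2, Ne.symm h2]
    rw [hk]
    congr 1
    rw [Finset.prod_congr rfl fun t _ => hp t, Finset.prod_ite_mem, Finset.univ_inter,
      Finset.prod_const, Finset.card_sdiff_of_subset hC]

theorem single_mul_wordIdem (d : P n m) (z : ℂ) (w : Fin m → Fin (n + 1)) :
    MonoidAlgebra.single d z * wordIdem w = 0 ∨
      ∃ d' : P n m, d'.botWord = w ∧ MonoidAlgebra.single d z * wordIdem w = z • x d' := by
  rw [wordIdem_eq_x, single_mul_x]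
  split_ifs with h
  · exact Or.inr ⟨_, (botWord_eq_of_bottom (bottom_mul h)).trans (botWord_vert w), rfl⟩
  · exact Or.inl rfl

theorem single_mul_x_of_eq {d d' : P n m} (h : d.botWord = d'.topWord) :
    MonoidAlgebra.single d 1 * x d' = x (d * d') := by
  rw [single_mul_x, if_pos (mul_of_botWord_eq h).1, one_smul]

theorem mul_vert_botWord (d : P n m) : d * vert d.botWord = d := by
  apply P.ext
  ext1 r c
  rw [P.mul_mat, vert_mat, Matrix.mul_diagonal]
  obtain ⟨b, hb⟩ := d.exists_clr r c
  by_cases hb0 : b = 0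
  · rw [hb, hb0, clr_zero, zero_mul]
  · rw [hb, d.botWord_eq hb0 hb, clr_mul_clr, if_pos rfl]

theorem single_mul_wordIdem_botWord (d : P n m) :
    MonoidAlgebra.single d 1 * wordIdem d.botWord = x d := by
  rw [wordIdem_eq_x, single_mul_x_of_eq (topWord_vert _).symm, mul_vert_botWord]

theorem x_ne_zero (d : P n m) : x d ≠ 0 := by
  classical
  intro h
  have h1 := congrArg (fun a : CP n m => a.coeff d) h
  simp only [x, MonoidAlgebra.coeff_sum, Finsupp.finsetSum_apply, MonoidAlgebra.coeff_single] at h1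
  rw [Finset.sum_eq_single d] at h1
  · simp at h1
  · intro d' _ hd'
    exact Finsupp.single_eq_of_ne hd'.symm
  · intro hd
    exact absurd (Finset.mem_filter.2 ⟨Finset.mem_univ d, fun r c => Or.inr rfl⟩) hd

theorem wordIdem_mul_self (w : Fin m → Fin (n + 1)) : wordIdem w * wordIdem w = wordIdem w := by
  conv_lhs => rw [wordIdem_eq_x w, ← wordIdem_eq_x w]
  nth_rewrite 2 [wordIdem_eq_x w]
  rw [wordIdem_mul_x, topWord_vert, if_pos rfl, wordIdem_eq_x]

/-- The primitive idempotents of `ℂP_m`. -/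
noncomputable def cpSystem (n m : ℕ) :
    IdemSystem (CP n m) (wordType : (Fin m → Fin (n + 1)) → Fin (n + 1) → ℕ) where
  p := wordIdem
  sum_eq := sum_wordIdem
  mul_self := wordIdem_mul_self
  ne_zero w := by
    rw [wordIdem_eq_x]
    exact x_ne_zero _
  corner w a := by
    induction a using MonoidAlgebra.induction_linear with
    | zero => exact ⟨0, by simp⟩
    | add f g hf hg =>
      obtain ⟨z, hz⟩ := hf
      obtain ⟨z', hz'⟩ := hg
      exact ⟨z + z', by rw [mul_add, add_mul, hz, hz', add_smul]⟩
    | single d z =>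
      rw [mul_assoc]
      rcases single_mul_wordIdem d z w with h | ⟨d', h1, h2⟩
      · exact ⟨0, by rw [h, mul_zero, zero_smul]⟩
      · rw [h2, mul_smul_comm, wordIdem_mul_x]
        split_ifs with h3
        · refine ⟨z, ?_⟩
          -- The diagram `d'` has the word `w` at the top and at the bottom, so it is vertical; this
          -- makes the corner one-dimensional.
          rw [P.eq_vert (h3.symm.trans h1.symm), h1, ← wordIdem_eq_x]
        · exact ⟨0, by rw [smul_zero, zero_smul]⟩
  link v w h := by
    obtain ⟨d, h1, h2⟩ := exists_diagram h
    obtain ⟨d', h3, h4⟩ := exists_diagram h.symm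
    refine ⟨MonoidAlgebra.single d 1, MonoidAlgebra.single d' 1, ?_⟩
    have h5 : MonoidAlgebra.single d' (1 : ℂ) * wordIdem v = x d' := by
      rw [← h4]
      exact single_mul_wordIdem_botWord d'
    have h6 : d * d' = vert v := by
      obtain ⟨-, h7, h8⟩ := mul_of_botWord_eq (h2.trans h3.symm)
      have h9 := P.eq_vert (h7.trans (h1.trans (h4.symm.trans h8.symm)))
      rwa [h8, h4] at h9
    simp only [mul_assoc]
    rw [h5, wordIdem_mul_x, if_pos h3.symm, single_mul_x_of_eq (h2.trans h3.symm), h6,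
      wordIdem_mul_x, topWord_vert, if_pos rfl, wordIdem_eq_x]
  unlink v w h a := by
    induction a using MonoidAlgebra.induction_linear with
    | zero => simp
    | add f g hf hg => rw [mul_add, add_mul, hf, hg, add_zero]
    | single d z =>
      rw [mul_assoc]
      rcases single_mul_wordIdem d z w with h1 | ⟨d', h1, h2⟩
      · rw [h1, mul_zero]
      · rw [h2, mul_smul_comm, wordIdem_mul_x, if_neg, smul_zero]
        -- A nonzero product would give a diagram joining the two words, which then have equal
        -- letter counts.
        rintro rfl
        exact h (by rw [wordType_topWord, h1])

theorem juxt_vert (w : Fin m → Fin (n + 1)) (b : Fin (n + 1)) :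
    juxt (vert w) (vert fun _ : Fin 1 => b) = vert (Fin.snoc (α := fun _ => Fin (n + 1)) w b) := by
  apply P.ext
  simp only [juxt, vert_mat, Matrix.fromBlocks_diagonal, Matrix.submatrix_diagonal_equiv]
  congr 1
  funext t
  refine Fin.lastCases ?_ (fun t => ?_) t
  · have : Fin.last m = Fin.natAdd m (0 : Fin 1) := rfl
    rw [Fin.snoc_last, this]
    simp only [Function.comp_apply, finSumFinEquiv_symm_apply_natAdd, Sum.elim_inr]
  · have : t.castSucc = Fin.castAdd 1 t := rfl
    rw [Fin.snoc_castSucc, this]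
    simp only [Function.comp_apply, finSumFinEquiv_symm_apply_castAdd, Sum.elim_inl]

theorem idem_eq (b : Fin (n + 1)) :
    idem b = ∑ a, MonoidAlgebra.single (vert fun _ : Fin 1 => a) (idemCoeff b a) := by
  have h0 : (vert fun _ : Fin 1 => (0 : Fin (n + 1))) = dot none := by
    simp [vert, dot]
  have hs : ∀ i : Fin n, (vert fun _ : Fin 1 => i.succ) = dot (some i) := by
    intro i
    simp [vert, dot]
  rw [Fin.sum_univ_succ, h0]
  simp only [hs]
  refine Fin.cases ?_ (fun i => ?_) b
  · simp [idem, idemCoeff]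
  · have h1 : ∀ j : Fin n, idemCoeff i.succ j.succ = if j = i then 1 else 0 := by
      intro j; simp [idemCoeff]
    have h2 : idemCoeff i.succ 0 = -1 := by simp [idemCoeff, (Fin.succ_ne_zero i).symm]
    rw [Finset.sum_eq_single i, h1, if_pos rfl, h2]
    · simp only [idem, Fin.cases_succ, MonoidAlgebra.single_neg]
      abel
    · intro j _ hj
      rw [h1, if_neg hj, MonoidAlgebra.single_zero]
    · simp

/-- The dictionary between the embeddings and the words: both sides expand over the colours of the
first `m` vertices and of the last one. -/
theorem psi_wordIdem (w : Fin m → Fin (n + 1)) (b : Fin (n + 1)) :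
    psi m b (wordIdem w) = wordIdem (Fin.snoc (α := fun _ => Fin (n + 1)) w b) := by
  change tens (wordIdem w) (idem b) = _
  rw [idem_eq, wordIdem, wordIdem]
  simp only [map_sum, LinearMap.sum_apply, tens_single, juxt_vert]
  rw [← (Fin.snocEquiv fun _ : Fin (m + 1) => Fin (n + 1)).sum_comp, Fintype.sum_prod_type]
  refine Finset.sum_congr rfl fun a _ => Finset.sum_congr rfl fun o _ => ?_
  simp only [Fin.snocEquiv_apply, Fin.prod_univ_castSucc, Fin.snoc_castSucc, Fin.snoc_last]
  rfl

end Algebra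

/-! ### Standard modules, induction and restriction -/

section Functors

variable {A B : Type} [Ring A] [Algebra ℂ A] [Ring B] [Algebra ℂ B] {Ω Ω' L L' : Type}
  [Fintype Ω] [Fintype Ω'] {type : Ω → L} {type' : Ω' → L'}

/-- The generator is `1 ⊗ y`. It is fixed by the new idempotent because `ψ (p w)` moves across the
tensor sign. That it is nonzero is detected by the map `b ⊗ z ↦ b * g z`, which exists since `g`
intertwines the actions. -/
theorem IdemSystem.isStd_Ind [FiniteDimensional ℂ B] (S : IdemSystem A type)
    (S' : IdemSystem B type') (ψ : A →ₙₐ[ℂ] B) {M : FDMod A} {w : Ω} {w' : Ω'} {y : M.carrier}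
    (hw : S.p w • y = y) (hy : ∀ z, ∃ a : A, a • y = z) (hψ : ψ (S.p w) = S'.p w')
    (g : M.carrier →ₗ[ℂ] B) (hg : ∀ (a : A) z, g (a • z) = ψ a * g z) (hgy : g y ≠ 0) :
    S'.IsStd (Ind ψ M) w' := by
  have hrel : ∀ (b : B) (a : A) (z : M.carrier),
      (indRel ψ M).mkQ (TensorProduct.tmul ℂ (b * ψ a) z)
        = (indRel ψ M).mkQ (TensorProduct.tmul ℂ b (a • z)) := by
    intro b a z
    rw [← sub_eq_zero, ← map_sub, Submodule.mkQ_apply, Submodule.Quotient.mk_eq_zero]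
    exact Submodule.subset_span ⟨b, a, z, rfl⟩
  let f : TensorProduct ℂ B M.carrier →ₗ[ℂ] B :=
    TensorProduct.lift ((LinearMap.mul ℂ B).compl₂ g)
  have hf : ∀ b z, f (TensorProduct.tmul ℂ b z) = b * g z := fun b z => by
    simp [f]
  have hfs : ∀ (b : B) t, f (b • t) = b * f t := by
    intro b t
    induction t using TensorProduct.induction_on with
    | zero => simp
    | tmul c z => rw [TensorProduct.smul_tmul', hf, hf, smul_eq_mul, mul_assoc]
    | add t t' h h' => rw [smul_add, map_add, map_add, mul_add, h, h']
  have hker : ∀ t ∈ indRel ψ M, f t = 0 := by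
    intro t ht
    induction ht using Submodule.span_induction with
    | zero => exact map_zero f
    | add t t' _ _ h h' => rw [map_add, h, h', add_zero]
    | smul b t _ h => rw [hfs, h, mul_zero]
    | mem t ht =>
      obtain ⟨b, a, z, rfl⟩ := ht
      rw [map_sub, hf, hf, hg, mul_assoc, sub_self]
  refine ⟨(indRel ψ M).mkQ (TensorProduct.tmul ℂ 1 y), ?_, ?_, ?_⟩
  · intro h
    rw [Submodule.mkQ_apply] at h
    have h1 := hker _ ((Submodule.Quotient.mk_eq_zero _).1 h)
    rw [hf, one_mul] at h1
    exact hgy h1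
  · change S'.p w' • (indRel ψ M).mkQ (TensorProduct.tmul ℂ 1 y) = _
    rw [← map_smul, TensorProduct.smul_tmul', smul_eq_mul, mul_one, ← hψ]
    conv_lhs => rw [← one_mul (ψ _)]
    rw [hrel, hw]
  · intro z
    change ∃ b : B, b • (indRel ψ M).mkQ (TensorProduct.tmul ℂ 1 y) = z
    obtain ⟨t, rfl⟩ := Submodule.mkQ_surjective _ z
    induction t using TensorProduct.induction_on with
    | zero => exact ⟨0, by rw [zero_smul, map_zero]⟩
    | tmul b z =>
      obtain ⟨a, rfl⟩ := hy z
      refine ⟨b * ψ a, ?_⟩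
      rw [← hrel, ← map_smul, TensorProduct.smul_tmul', smul_eq_mul, mul_one]
    | add t t' h h' =>
      obtain ⟨b, hb⟩ := h
      obtain ⟨b', hb'⟩ := h'
      exact ⟨b + b', by rw [add_smul, hb, hb', map_add]⟩

/-- Split `ψ 1` into the idempotents `p (ι v)`. Each piece either vanishes because the types differ,
or is a scalar multiple of a link that already exists in `A`. Thus the image of `A` suffices to
generate `ψ(1) N`. -/
theorem IdemSystem.exists_mul_eq_psi_mul (S : IdemSystem A type) (S' : IdemSystem B type')
    (ψ : A →ₙₐ[ℂ] B) (ι : Ω → Ω') (hψ : ∀ w, ψ (S.p w) = S'.p (ι w))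
    (hι' : ∀ v w, type' (ι v) = type' (ι w) → type v = type w) (w : Ω) (b : B) :
    ∃ a, ψ 1 * b * S'.p (ι w) = ψ a * S'.p (ι w) := by
  have key : ∀ v, ∃ a, S'.p (ι v) * b * S'.p (ι w) = ψ a * S'.p (ι w) := by
    intro v
    by_cases hv : type v = type w
    · obtain ⟨c, d, hcd⟩ := S.link v w hv
      obtain ⟨z, hz⟩ := S'.corner (ι w) (ψ d * S'.p (ι v) * b)
      refine ⟨z • (S.p v * c), ?_⟩
      calc S'.p (ι v) * b * S'.p (ι w)
          = ψ (S.p v * c * S.p w * d * S.p v) * b * S'.p (ι w) := by rw [hcd, hψ]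
        _ = ψ (S.p v * c * (S.p w * S.p w) * d * S.p v) * b * S'.p (ι w) := by rw [S.mul_self]
        _ = ψ (S.p v * c) * S'.p (ι w) *
              (S'.p (ι w) * (ψ d * S'.p (ι v) * b) * S'.p (ι w)) := by
            simp only [map_mul, hψ]; noncomm_ring
        _ = z • (ψ (S.p v * c) * (S'.p (ι w) * S'.p (ι w))) := by
            rw [hz, mul_smul_comm, mul_assoc]
        _ = ψ (z • (S.p v * c)) * S'.p (ι w) := by
            rw [S'.mul_self, map_smul, smul_mul_assoc]
    · exact ⟨0, by rw [S'.unlink _ _ (fun h => hv (hι' v w h)), map_zero, zero_mul]⟩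
  choose a ha using key
  refine ⟨∑ v, a v, ?_⟩
  rw [← S.sum_eq, map_sum, map_sum, Finset.sum_mul, Finset.sum_mul, Finset.sum_mul]
  exact Finset.sum_congr rfl fun v _ => by rw [hψ, ha]

theorem IdemSystem.IsStd.res {S : IdemSystem A type} {S' : IdemSystem B type'}
    {ψ : A →ₙₐ[ℂ] B} {ι : Ω → Ω'} (hψ : ∀ w, ψ (S.p w) = S'.p (ι w))
    (hι' : ∀ v w, type' (ι v) = type' (ι w) → type v = type w) {N : FDMod B} {w : Ω}
    (h : S'.IsStd N (ι w)) : S.IsStd (Res ψ N) w := by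
  obtain ⟨y, hy, hw, hg⟩ := h
  have h1 : ψ 1 • y = y := by
    rw [← hw, ← hψ, smul_smul, ← map_mul, one_mul]
  refine ⟨(⟨y, y, h1⟩ : resSpace ψ N), fun h0 => hy (congrArg Subtype.val h0), ?_, ?_⟩
  · refine Subtype.ext ?_
    change ψ (S.p w) • y = y
    rw [hψ, hw]
  · intro z
    change resSpace ψ N at z
    obtain ⟨z, hz⟩ := z
    obtain ⟨b, rfl⟩ := hg z
    obtain ⟨a, ha⟩ := S.exists_mul_eq_psi_mul S' ψ ι hψ hι' w b
    refine ⟨a, Subtype.ext ?_⟩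
    change ψ a • y = b • y
    have h2 := psi_one_smul ψ N hz
    rw [← h2]
    calc ψ a • y = (ψ a * S'.p (ι w)) • y := by rw [mul_smul, hw]
      _ = ψ 1 • b • y := by rw [← ha, mul_smul, mul_smul, hw]

end Functors

/-! ### The words of the standard modules and the effect of the functors -/

section Standard

variable {n m : ℕ}

theorem partialSum_wordType (w : Fin m → Fin (n + 1)) (t : ℕ) :
    partialSum (wordType w) t = (Finset.univ.filter fun s => (w s : ℕ) < t).card := by
  rw [Finset.card_eq_sum_card_fiberwise (f := w)
    (t := Finset.univ.filter fun b : Fin (n + 1) => (b : ℕ) < t), Finset.sum_filter]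
  · refine Finset.sum_congr rfl fun b _ => ?_
    split_ifs with hb
    · rw [wordType, Finset.filter_filter]
      congr 1
      refine Finset.filter_congr fun c _ => ⟨fun h => ⟨?_, h⟩, fun h => h.2⟩
      rwa [h]
    · rfl
  · intro c hc
    simp only [Finset.coe_filter, Set.mem_ofPred_eq, Finset.mem_univ, true_and] at hc ⊢
    exact hc

/-- The weakly increasing word with the given letter counts; its level sets are the consecutive
blocks. -/
theorem exists_blockWord {c : Fin (n + 1) → ℕ} (hc : ∑ b, c b = m) :
    ∃ w : Fin m → Fin (n + 1), wordType w = c ∧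
      blocks m c = fun i => Finset.univ.filter fun t => w t = i := by
  have hlt : ∀ t : Fin m, rowEntry c t < n + 1 := by
    intro t
    rw [rowEntry_lt_iff le_rfl, partialSum_last, hc]
    exact t.2
  refine ⟨fun t => ⟨rowEntry c t, hlt t⟩, ext_of_partialSum fun t ht => ?_, ?_⟩
  · rw [partialSum_wordType]
    simp only [rowEntry_lt_iff ht]
    rw [Fin.card_filter_val_lt, min_eq_right]
    rw [← hc, ← partialSum_last]
    exact partialSum_mono c ht
  · funext i
    have h1 : ∑ j ∈ Finset.Iio i, c j = partialSum c i := by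
      rw [partialSum, ← Finset.sum_filter]
      refine Finset.sum_congr ?_ fun _ _ => rfl
      ext j
      simp only [Finset.mem_Iio, Finset.mem_filter, Finset.mem_univ, true_and]
      rfl
    have h2 : ∑ j ∈ Finset.Iic i, c j = partialSum c (i + 1) := by
      rw [partialSum, ← Finset.sum_filter]
      refine Finset.sum_congr ?_ fun _ _ => rfl
      ext j
      simp only [Finset.mem_Iic, Finset.mem_filter, Finset.mem_univ, true_and]
      exact Nat.lt_succ_iff.symm
    rw [blocks, h1, h2]
    refine Finset.filter_congr fun t _ => ?_
    have h3 := rowEntry_lt_iff (v := c) (p := t) i.2.le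
    have h4 := rowEntry_lt_iff (v := c) (p := t) (t := i + 1) i.2
    rw [Fin.ext_iff]
    simp only
    omega

/-- The module is generated by the idempotent of the block word, because each of its spanning
elements `x d` is `d` times that idempotent (`single_mul_wordIdem_botWord`). -/
theorem exists_generator {c : Fin (n + 1) → ℕ} {w : Fin m → Fin (n + 1)}
    (hw : blocks m c = fun i => Finset.univ.filter fun t => w t = i) :
    ∃ y : stdW m c, (y : CP n m) = wordIdem w ∧ wordIdem w • y = y ∧
      ∀ z, ∃ a : CP n m, a • y = z := by
  have hb : bottom (vert w) = blocks m c := by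
    rw [hw]
    funext i
    rw [bottom_eq, botWord_vert]
  have hmem : wordIdem w ∈ stdW m c := by
    rw [wordIdem_eq_x]
    exact Submodule.subset_span ⟨vert w, hb, rfl⟩
  refine ⟨⟨wordIdem w, hmem⟩, rfl, Subtype.ext (wordIdem_mul_self w), ?_⟩
  rintro ⟨z, hz⟩
  suffices ∃ a : CP n m, a * wordIdem w = z by
    obtain ⟨a, ha⟩ := this
    exact ⟨a, Subtype.ext ha⟩
  change z ∈ Submodule.span ℂ _ at hz
  induction hz using Submodule.span_induction with
  | zero => exact ⟨0, zero_mul _⟩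
  | add z z' _ _ h h' =>
    obtain ⟨a, rfl⟩ := h
    obtain ⟨a', rfl⟩ := h'
    exact ⟨a + a', add_mul _ _ _⟩
  | smul r z _ h =>
    obtain ⟨a, rfl⟩ := h
    exact ⟨r • a, smul_mul_assoc _ _ _⟩
  | mem z hz =>
    obtain ⟨d, hd, rfl⟩ := hz
    have := botWord_eq_of_bottom (hd.trans hb.symm)
    rw [botWord_vert] at this
    subst this
    exact ⟨_, single_mul_wordIdem_botWord d⟩

theorem wordIdem_ne_zero (w : Fin m → Fin (n + 1)) : wordIdem w ≠ 0 := (cpSystem n m).ne_zero w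

theorem isStd_stdMod {c : Fin (n + 1) → ℕ} {w : Fin m → Fin (n + 1)} (hw : wordType w = c) :
    (cpSystem n m).IsStd (stdMod m c) w := by
  obtain ⟨w', h1, h2⟩ := exists_blockWord (m := m) (c := c) (by rw [← hw, sum_wordType])
  obtain ⟨y, hy, hy', hg⟩ := exists_generator h2
  refine IdemSystem.IsStd.of_type_eq (w := w') ⟨y, ?_, hy', hg⟩ (h1.trans hw.symm)
  intro h0
  refine wordIdem_ne_zero w' ?_
  rw [← hy]
  exact congrArg Subtype.val h0

theorem wordType_snoc (w : Fin m → Fin (n + 1)) (b : Fin (n + 1)) :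
    wordType (Fin.snoc (α := fun _ => Fin (n + 1)) w b) = wordType w + Pi.single b 1 := by
  funext a
  simp only [wordType, Finset.card_filter, Pi.add_apply, Fin.sum_univ_castSucc, Fin.snoc_castSucc,
    Fin.snoc_last, Pi.single_apply, eq_comm]

theorem isStd_Ind_stdMod {c : Fin (n + 1) → ℕ} {w : Fin m → Fin (n + 1)} (hw : wordType w = c)
    (b : Fin (n + 1)) : (cpSystem n (m + 1)).IsStd (Ind (psi m b) (stdMod m c))
      (Fin.snoc (α := fun _ => Fin (n + 1)) w b) := by
  obtain ⟨w', h1, h2⟩ := exists_blockWord (m := m) (c := c) (by rw [← hw, sum_wordType])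
  obtain ⟨y, hy, hy', hg⟩ := exists_generator h2
  -- The standard module is a left ideal of `ℂP_m`, so the embedding itself, restricted to it, is
  -- the intertwining map that detects the generator.
  let g : (stdMod (n := n) m c).carrier →ₗ[ℂ] CP n (m + 1) :=
    { toFun := fun z => psi m b ((show stdW m c from z) : CP n m)
      map_add' := fun z z' => map_add (psi m b) _ _
      map_smul' := fun r z => map_smul (psi m b) r _ }
  refine IdemSystem.IsStd.of_type_eq (w := Fin.snoc (α := fun _ => Fin (n + 1)) w' b)
    ((cpSystem n m).isStd_Ind (cpSystem n (m + 1)) (psi m b) (M := stdMod m c) (w := w') (y := y)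
      hy' hg (psi_wordIdem w' b) g (fun a z => map_mul (psi m b) _ _) ?_) ?_
  · change psi m b (y : CP n m) ≠ 0
    rw [hy, psi_wordIdem]
    exact wordIdem_ne_zero _
  · rw [wordType_snoc, wordType_snoc, h1, hw]

theorem isStd_Res_Ind_stdMod {c : Fin (n + 1) → ℕ} {w v : Fin m → Fin (n + 1)}
    (hw : wordType w = c) {a b : Fin (n + 1)} (ha : 0 < c a)
    (hv : wordType v = c - Pi.single a 1 + Pi.single b 1) :
    (cpSystem n m).IsStd (Res (psi m a) (Ind (psi m b) (stdMod m c))) v := by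
  have hs : Pi.single a 1 ≤ c := by
    intro d
    by_cases hd : d = a
    · subst hd; simpa using Nat.succ_le_of_lt ha
    · simp [hd]
  refine IdemSystem.IsStd.res (S' := cpSystem n (m + 1))
    (ι := fun w => Fin.snoc (α := fun _ => Fin (n + 1)) w a) (fun w => psi_wordIdem w a)
    (fun v w h => by rw [wordType_snoc, wordType_snoc] at h; exact add_right_cancel h)
    ((isStd_Ind_stdMod hw b).of_type_eq ?_)
  -- One letter `b` added to `c` equals one letter `a` added to the counts of `v`; the truncated
  -- subtraction is exact because `a` occurs in `c`.
  rw [wordType_snoc, wordType_snoc, hv, hw, add_right_comm, tsub_add_cancel_of_le hs]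

end Standard

/-! ### The crystal of isomorphism classes -/

section Classes

variable {n k : ℕ} {l : Fin k → ℕ}

theorem IdemSystem.IsStd.cls_eq {A : Type} [Ring A] [Algebra ℂ A] {Ω L : Type} [Fintype Ω]
    {type : Ω → L} {S : IdemSystem A type} {M N : FDMod A} {v w : Ω} (h : S.IsStd M w)
    (h' : S.IsStd N v) (ht : type w = type v) : ∃ X, M.cls = some X ∧ N.cls = some X := by
  have h1 : N.cls = M.cls := by
    rw [FDMod.cls, FDMod.cls, dif_pos h.isSimple, dif_pos h'.isSimple]
    exact congrArg some (Quotient.sound (h'.nonempty_equiv h ht.symm))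
  rw [h1, FDMod.cls, dif_pos h.isSimple]
  exact ⟨_, rfl, rfl⟩

theorem FDMod.cls_eq_some {A : Type} [Ring A] [Algebra ℂ A] {M : FDMod A} {X : IrrClass A}
    (h : M.cls = some X) : ∃ hM : IsSimpleModule A M.carrier,
      X = Quotient.mk (irrSetoid A) ⟨M, hM⟩ := by
  rw [FDMod.cls] at h
  split_ifs at h with hM
  exact ⟨hM, (Option.some.inj h).symm⟩

/-- The primitive idempotents of `ℂP_λ`. -/
noncomputable def cplSystem (n : ℕ) (l : Fin k → ℕ) :
    IdemSystem (CPl n l) fun (w : ∀ j, Fin (l j) → Fin (n + 1)) j => wordType (w j) :=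
  IdemSystem.tensor fun j => cpSystem n (l j)

theorem exists_words {c : Fin k → Fin (n + 1) → ℕ} (hc : ∀ j, ∑ b, c j b = l j) :
    ∃ w : ∀ j, Fin (l j) → Fin (n + 1), ∀ j, wordType (w j) = c j := by
  choose w hw _ using fun j => exists_blockWord (hc j)
  exact ⟨w, hw⟩

theorem isStd_clsW {c : Fin k → Fin (n + 1) → ℕ} {w : ∀ j, Fin (l j) → Fin (n + 1)}
    (hw : ∀ j, wordType (w j) = c j) :
    (cplSystem n l).IsStd (tensorMod fun j => stdMod (l j) (c j)) w :=
  IdemSystem.IsStd.tensor fun j => isStd_stdMod (hw j)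

/-- Some idempotent does not kill the module, and the letter counts of its words are a label. -/
theorem exists_isLabel (X : Cls n l) : ∃ c, IsLabel X c := by
  induction X using Quotient.inductionOn with
  | h M =>
    obtain ⟨M, hM⟩ := M
    obtain ⟨w, hw⟩ := (cplSystem n l).exists_isStd M
    refine ⟨fun j => wordType (w j), fun j => sum_wordType (w j), ?_⟩
    obtain ⟨X, h1, h2⟩ := hw.cls_eq (isStd_clsW (w := w) fun j => rfl) rfl
    rw [clsW, h2, ← h1, FDMod.cls, dif_pos hM]

theorem exists_cls {c : Fin k → Fin (n + 1) → ℕ} (hc : ∀ j, ∑ b, c j b = l j) :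
    ∃ X : Cls n l, IsLabel X c := by
  obtain ⟨w, hw⟩ := exists_words hc
  obtain ⟨X, hX, -⟩ := (isStd_clsW hw).cls_eq (isStd_clsW hw) rfl
  exact ⟨X, hc, hX⟩

theorem IsLabel.unique {X : Cls n l} {c c' : Fin k → Fin (n + 1) → ℕ} (h : IsLabel X c)
    (h' : IsLabel X c') : c = c' := by
  obtain ⟨w, hw⟩ := exists_words h.1
  obtain ⟨w', hw'⟩ := exists_words h'.1
  obtain ⟨h1, h2⟩ := FDMod.cls_eq_some h.2
  obtain ⟨h3, h4⟩ := FDMod.cls_eq_some h'.2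
  obtain ⟨e⟩ := Quotient.exact (h2.symm.trans h4)
  have h5 := ((isStd_clsW hw).of_equiv e).type_eq (isStd_clsW hw')
  funext j
  rw [← hw, ← hw']
  exact congrFun h5 j

theorem isLabel_label (X : Cls n l) : IsLabel X (label X) := by
  rw [label, dif_pos (exists_isLabel X)]
  exact (exists_isLabel X).choose_spec

theorem IsLabel.label_eq {X : Cls n l} {c : Fin k → Fin (n + 1) → ℕ} (h : IsLabel X c) :
    label X = c :=
  (isLabel_label X).unique h

theorem label_injective : Function.Injective (label : Cls n l → Fin k → Fin (n + 1) → ℕ) := by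
  intro X Y h
  have h1 := (isLabel_label X).2
  rw [h, (isLabel_label Y).2] at h1
  exact (Option.some.inj h1).symm

/-- Applying restriction after induction in one tensor factor replaces one letter `a` by `b` in that
row of the label and leaves the other rows alone. -/
theorem exists_replaceEntry (X : Cls n l) {s : Fin k} {a b : Fin (n + 1)}
    (h : 0 < label X s a) : ∃ Y : Cls n l, label Y = replaceEntry (label X) s a b ∧
      (tensorMod (Function.update (fun j => stdMod (l j) (label X j)) s
        (Res (psi (l s) a) (Ind (psi (l s) b) (stdMod (l s) (label X s)))))).cls = some Y := by
  have hc : ∀ j, ∑ d, replaceEntry (label X) s a b j d = l j := fun j =>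
    (sum_replaceEntry h j).trans ((isLabel_label X).1 j)
  obtain ⟨w, hw⟩ := exists_words (isLabel_label X).1
  obtain ⟨v, hv⟩ := exists_words hc
  have h1 : (cplSystem n l).IsStd (tensorMod (Function.update
      (fun j => stdMod (l j) (label X j)) s
        (Res (psi (l s) a) (Ind (psi (l s) b) (stdMod (l s) (label X s)))))) v := by
    refine IdemSystem.IsStd.tensor fun j => ?_
    have h2 := hv j
    by_cases hj : j = s
    · subst hj
      rw [replaceEntry, Function.update_self] at h2
      rw [Function.update_self]
      exact isStd_Res_Ind_stdMod (hw j) h h2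
    · rw [replaceEntry, Function.update_of_ne hj] at h2
      rw [Function.update_of_ne hj]
      exact isStd_stdMod h2
  obtain ⟨Y, hY, hY'⟩ := h1.cls_eq (isStd_clsW hv) rfl
  exact ⟨Y, IsLabel.label_eq ⟨hc, hY'⟩, hY⟩

/-- The word of an isomorphism class. -/
noncomputable def classReading (X : Cls n l) : List (Fin (n + 1)) := arrayReading (label X)

theorem classReading_injective :
    Function.Injective (classReading : Cls n l → List (Fin (n + 1))) := fun X Y h =>
  label_injective (arrayReading_injective (isLabel_label X).1 (isLabel_label Y).1 h)

theorem wordE_classReading (i : Fin n) (X : Cls n l) :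
    wordE i (classReading X) = (opE i X).map classReading := by
  rcases h : minusPos (label X) i with _ | s
  · rw [opE, h, classReading, wordE_arrayReading_eq_none h]
    rfl
  · obtain ⟨h1, h2⟩ := wordE_arrayReading h
    obtain ⟨Y, h3, h4⟩ := exists_replaceEntry (b := i.castSucc) X h1
    rw [opE, h, Option.bind_some, classReading, h2, ← h3]
    exact (congrArg (Option.map classReading) h4).symm

theorem wordF_classReading (i : Fin n) (X : Cls n l) :
    wordF i (classReading X) = (opF i X).map classReading := by
  rcases h : plusPos (label X) i with _ | s
  · rw [opF, h, classReading, wordF_arrayReading_eq_none h]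
    rfl
  · obtain ⟨h1, h2⟩ := wordF_arrayReading h
    obtain ⟨Y, h3, h4⟩ := exists_replaceEntry (b := i.succ) X h1
    rw [opF, h, Option.bind_some, classReading, h2, ← h3]
    exact (congrArg (Option.map classReading) h4).symm

/-- A function that vanishes where `g` stops and drops by one at each step counts how often `g` can
be applied; used with `ε` and `φ` of the associated word. -/
theorem sSup_iter {β : Type*} (g : β → Option β) (N : β → ℕ)
    (h0 : ∀ b, g b = none → N b = 0) (h1 : ∀ b b', g b = some b' → N b = N b' + 1) (b : β) :
    sSup {j : ℕ | iter g j b ≠ none} = N b := by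
  have key : ∀ j, (∃ b', iter g j b = some b' ∧ N b = N b' + j) ∨ (iter g j b = none ∧ N b < j) := by
    intro j
    induction j with
    | zero => exact Or.inl ⟨b, rfl, rfl⟩
    | succ j ih =>
      rcases ih with ⟨b', h2, h3⟩ | ⟨h2, h3⟩
      · rcases h4 : g b' with _ | b''
        · have := h0 b' h4
          exact Or.inr ⟨by rw [iter, h2, Option.bind_some, h4], by omega⟩
        · have := h1 b' b'' h4
          exact Or.inl ⟨b'', by rw [iter, h2, Option.bind_some, h4], by omega⟩
      · exact Or.inr ⟨by rw [iter, h2, Option.bind_none], by omega⟩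
  have : {j : ℕ | iter g j b ≠ none} = Set.Iic (N b) := by
    ext j
    rw [Set.mem_ofPred_eq, Set.mem_Iic]
    rcases key j with ⟨b', h2, h3⟩ | ⟨h2, h3⟩
    · simp [h2]; omega
    · simp [h2]; omega
  rw [this, csSup_Iic]

theorem wordEps_classReading (i : Fin n) (X : Cls n l) : wordEps i (classReading X) =
    (((sSup {j : ℕ | iter (opE i) j X ≠ none} : ℕ) : ℤ) : WithBot ℤ) := by
  rw [sSup_iter (opE i) fun X : Cls n l => epsNat i (classReading X), wordEps_eq]
  · intro Y hY
    rw [← wordE_eq_none, wordE_classReading, hY]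
    rfl
  · intro Y Y' hY
    refine (of_wordE ?_).1
    rw [wordE_classReading, hY]
    rfl

theorem wordPhi_classReading (i : Fin n) (X : Cls n l) : wordPhi i (classReading X) =
    (((sSup {j : ℕ | iter (opF i) j X ≠ none} : ℕ) : ℤ) : WithBot ℤ) := by
  rw [sSup_iter (opF i) fun X : Cls n l => phiNat i (classReading X), wordPhi_eq]
  · intro Y hY
    rw [← wordF_eq_none, wordF_classReading, hY]
    rfl
  · intro Y Y' hY
    refine phiNat_of_wordF ?_
    rw [wordF_classReading, hY]
    rfl

theorem classes_isStrictMorphism (n : ℕ) (l : Fin k → ℕ) :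
    (classes n l).IsStrictMorphism (words n) classReading where
  wt X := funext fun b => wordWt_arrayReading (label X) b
  ε := wordEps_classReading
  φ := wordPhi_classReading
  e := wordE_classReading
  f := wordF_classReading

theorem classes_isCrystal (n : ℕ) (l : Fin k → ℕ) : (classes n l).IsCrystal :=
  (classes_isStrictMorphism n l).isCrystal classReading_injective (words_isCrystal n)

end Classes

/-! ### Strict morphisms and connected components -/

/-- A map is a strict morphism if its composition with a strict embedding is one. -/
theorem CrystalData.IsStrictMorphism.of_comp.{v, w, x} {n : ℕ} {C : CrystalData.{v} n}
    {D : CrystalData.{w} n} {E : CrystalData.{x} n} {ψ : D.B → E.B} {χ : C.B → D.B}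
    (h : D.IsStrictMorphism E ψ) (hψ : Function.Injective ψ)
    (h' : C.IsStrictMorphism E (ψ ∘ χ)) : C.IsStrictMorphism D χ where
  wt b := by rw [← h.wt, ← h'.wt]; rfl
  ε i b := by rw [← h.ε, ← h'.ε]; rfl
  φ i b := by rw [← h.φ, ← h'.φ]; rfl
  e i b := Option.map_injective hψ (by
    rw [← h.e, Option.map_map, ← h'.e]; rfl)
  f i b := Option.map_injective hψ (by
    rw [← h.f, Option.map_map, ← h'.f]; rfl)

/-- A strict morphism whose image is a connected component. -/
theorem CrystalData.IsStrictMorphism.component.{v, w} {n : ℕ} {C : CrystalData.{v} n}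
    {D : CrystalData.{w} n} {χ : C.B → D.B} (h : C.IsStrictMorphism D χ) (d₀ : D.B)
    (hd : ∀ b, D.Connected d₀ (χ b)) :
    C.IsStrictMorphism (D.component d₀) fun b => ⟨χ b, hd b⟩ where
  wt b := h.wt b
  ε i b := h.ε i b
  φ i b := h.φ i b
  e i b := by
    simp only [CrystalData.component]
    rw [h.e]
    rcases C.e i b with _ | b'
    · rfl
    · simp only [Option.map_some, Option.bind_some]
      rw [dif_pos (hd b')]
  f i b := by
    simp only [CrystalData.component]
    rw [h.f]
    rcases C.f i b with _ | b'
    · rfl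
    · simp only [Option.map_some, Option.bind_some]
      rw [dif_pos (hd b')]

/-- The image of a strict morphism is a union of connected components. -/
theorem CrystalData.IsStrictMorphism.range_of_connected.{v, w} {n : ℕ} {C : CrystalData.{v} n}
    {D : CrystalData.{w} n} {χ : C.B → D.B} (h : C.IsStrictMorphism D χ) (hD : D.IsCrystal)
    {d d' : D.B} (hd : D.Connected d d') : d ∈ Set.range χ ↔ d' ∈ Set.range χ := by
  induction hd with
  | refl d => exact Iff.rfl
  | symm d d' _ ih => exact ih.symm
  | trans d d' d'' _ _ ih ih' => exact ih.trans ih'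
  | rel d d' hr =>
    obtain ⟨i, hi⟩ := hr
    constructor
    · rintro ⟨b, rfl⟩
      rw [h.f] at hi
      obtain ⟨b', -, hb'⟩ := Option.map_eq_some_iff.1 hi
      exact ⟨b', hb'⟩
    · rintro ⟨b, rfl⟩
      rw [hD.f_iff_e, h.e] at hi
      obtain ⟨b', -, hb'⟩ := Option.map_eq_some_iff.1 hi
      exact ⟨b', hb'⟩

/-- The sum of the letters of a word. -/
def height {n : ℕ} (w : List (Fin (n + 1))) : ℕ := (w.map Fin.val).sum

/-- The height is a linear function of the weight, and it takes the value `-1` on every simple root.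
-/
theorem height_of_wordE {n : ℕ} {i : Fin n} {w w' : List (Fin (n + 1))}
    (h : wordE i w = some w') : height w = height w' + 1 := by
  have key : ∀ w : List (Fin (n + 1)), (height w : ℤ) = ∑ b : Fin (n + 1), (b : ℤ) * wordWt w b := by
    intro w
    induction w with
    | nil => simp [height, wordWt]
    | cons a w ih =>
      simp only [height] at ih
      simp only [height, List.map_cons, List.sum_cons, wordWt, Pi.add_apply, mul_add,
        Finset.sum_add_distrib, boxes, Nat.cast_add, ih]
      simp [Pi.single_apply]
  have h1 := key w
  have h2 := key w'
  rw [(of_wordE h).2.1] at h2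
  simp only [Pi.add_apply, root, Pi.sub_apply, mul_add, mul_sub, Finset.sum_add_distrib,
    Finset.sum_sub_distrib, Pi.single_apply, mul_ite, mul_one, mul_zero, Finset.sum_ite_eq',
    Finset.mem_univ, if_true, Fin.val_succ, Fin.val_castSucc, ← h1] at h2
  push_cast at h2
  omega

/-! ### From tableaux to isomorphism classes -/

section Main

variable {n : ℕ} {μ : YoungDiagram}

theorem Tableau.content_of_wordE_eq_none (T : Tableau n μ) (hμ : μ.colLen 0 ≤ n + 1)
    (h : ∀ i : Fin n, wordE i T.reading = none) (j : Fin (μ.colLen 0)) :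
    T.content j = Pi.single (Fin.castLE hμ j) (μ.rowLen j) := by
  rw [← T.sum_content]
  refine T.isStrictArray.eq_single hμ (fun i => ?_) j
  rcases hs : minusPos (fun j : Fin (μ.colLen 0) => T.content j) i with _ | s
  · rfl
  · have h1 := (wordE_arrayReading hs).2
    rw [← T.reading_eq, h i] at h1
    exact absurd h1 (by simp)

/-- The isomorphism class that belongs to a tableau. -/
noncomputable def Tableau.toClass (T : Tableau n μ) :
    Cls n fun j : Fin (μ.colLen 0) => μ.rowLen j :=
  (exists_cls (c := fun j : Fin (μ.colLen 0) => T.content j) fun j => T.sum_content j).choose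

theorem Tableau.isLabel_toClass (T : Tableau n μ) :
    IsLabel T.toClass fun j : Fin (μ.colLen 0) => T.content j :=
  (exists_cls (c := fun j : Fin (μ.colLen 0) => T.content j)
    fun j => T.sum_content j).choose_spec

theorem Tableau.classReading_toClass (T : Tableau n μ) : classReading T.toClass = T.reading := by
  rw [classReading, T.isLabel_toClass.label_eq, T.reading_eq]

theorem toClass_isStrictMorphism (n : ℕ) (μ : YoungDiagram) : (tableaux n μ).IsStrictMorphism
    (classes n fun j : Fin (μ.colLen 0) => μ.rowLen j) Tableau.toClass := by
  refine (classes_isStrictMorphism n _).of_comp classReading_injective ?_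
  have : classReading ∘ Tableau.toClass = Tableau.reading (n := n) (μ := μ) :=
    funext Tableau.classReading_toClass
  exact this ▸ reading_isStrictMorphism n μ

theorem Tableau.toClass_injective : Function.Injective (Tableau.toClass (n := n) (μ := μ)) := by
  intro T T' h
  refine T.reading_injective ?_
  rw [← T.classReading_toClass, h, T'.classReading_toClass]

/-- Raising operators lower the height, so they lead from any tableau to one that they all kill, and
there is only one such tableau. -/
theorem Tableau.connected_toClass (hμ : μ.colLen 0 ≤ n + 1)
    {X₀ : Cls n fun j : Fin (μ.colLen 0) => μ.rowLen j}
    (hX : IsLabel X₀ fun j => Pi.single (Fin.castLE hμ j) (μ.rowLen j)) (T : Tableau n μ) :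
    (classes n fun j : Fin (μ.colLen 0) => μ.rowLen j).Connected X₀ T.toClass := by
  induction hN : height T.reading using Nat.strong_induction_on generalizing T with
  | _ N ih =>
  subst hN
  by_cases h : ∀ i : Fin n, wordE i T.reading = none
  · have h1 : (fun j : Fin (μ.colLen 0) => T.content j) =
        fun j => Pi.single (Fin.castLE hμ j) (μ.rowLen j) :=
      funext (T.content_of_wordE_eq_none hμ h)
    have h2 : X₀ = T.toClass := label_injective (by
      rw [hX.label_eq, T.isLabel_toClass.label_eq, h1])
    rw [h2]
    exact Relation.EqvGen.refl _
  · push Not at h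
    obtain ⟨i, hi⟩ := h
    have h1 : wordE i T.reading = ((tableaux n μ).e i T).map Tableau.reading :=
      (reading_isStrictMorphism n μ).e i T
    rcases h2 : (tableaux n μ).e i T with _ | T'
    · rw [h2] at h1
      exact absurd h1 hi
    · rw [h2] at h1
      have h3 := height_of_wordE h1
      refine (ih _ (by omega) T' rfl).trans _ _ _ (Relation.EqvGen.rel _ _ ⟨i, ?_⟩)
      exact ((classes_isCrystal n _).f_iff_e i _ _).2 (((toClass_isStrictMorphism n μ).e i T).trans (by rw [h2]; rfl))

end Main

end PlanarRook

theorem mainTheorem8 (n : ℕ) (hn : 1 ≤ n) (μ : YoungDiagram) (hμ : μ.colLen 0 ≤ n + 1) :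
    (PlanarRook.tableaux n μ).IsCrystal ∧
    (Function.Injective (PlanarRook.Tableau.reading (n := n) (μ := μ)) ∧
      (PlanarRook.tableaux n μ).IsStrictMorphism (PlanarRook.words n)
        PlanarRook.Tableau.reading) ∧
    (PlanarRook.classes n fun j : Fin (μ.colLen 0) => μ.rowLen j).IsCrystal ∧
    ∃ X₀ : PlanarRook.Cls n fun j : Fin (μ.colLen 0) => μ.rowLen j,
      PlanarRook.clsW (fun j : Fin (μ.colLen 0) => μ.rowLen j)
        (fun j => Pi.single (Fin.castLE hμ j) (μ.rowLen j)) = some X₀ ∧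
      ∃ Φ : PlanarRook.Tableau n μ ≃
          ((PlanarRook.classes n fun j : Fin (μ.colLen 0) => μ.rowLen j).component X₀).B,
        (PlanarRook.tableaux n μ).IsStrictMorphism
          ((PlanarRook.classes n fun j : Fin (μ.colLen 0) => μ.rowLen j).component X₀) Φ ∧
        ∀ T : PlanarRook.Tableau n μ,
          PlanarRook.clsW (fun j : Fin (μ.colLen 0) => μ.rowLen j) (fun j => T.content j)
            = some (Φ T).1 := by
  refine ⟨PlanarRook.tableaux_isCrystal n μ, ⟨PlanarRook.Tableau.reading_injective,
    PlanarRook.reading_isStrictMorphism n μ⟩, PlanarRook.classes_isCrystal n _, ?_⟩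
  have hsum : ∀ j : Fin (μ.colLen 0),
      ∑ b, Pi.single (M := fun _ : Fin (n + 1) => ℕ) (Fin.castLE hμ j) (μ.rowLen j) b
        = μ.rowLen j := fun j => by simp
  -- The tableau with `j` throughout row `j`; its class is the distinguished one.
  obtain ⟨T₀, hT₀⟩ := PlanarRook.exists_tableau hsum
    (PlanarRook.isStrictArray_single hμ fun i j h => μ.rowLen_anti i j h)
  have hX := T₀.isLabel_toClass
  rw [hT₀] at hX
  have hconn := PlanarRook.Tableau.connected_toClass hμ hX
  refine ⟨T₀.toClass, hX.2, Equiv.ofBijective (fun T => ⟨T.toClass, hconn T⟩) ⟨?_, ?_⟩,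
    (PlanarRook.toClass_isStrictMorphism n μ).component _ hconn, fun T => T.isLabel_toClass.2⟩
  · intro T T' h
    exact PlanarRook.Tableau.toClass_injective (congrArg Subtype.val h)
  · rintro ⟨X, h⟩
    -- Surjectivity: the image of the tableaux is a union of components and contains the class of
    -- `T₀`.
    obtain ⟨T, hT⟩ := ((PlanarRook.toClass_isStrictMorphism n μ).range_of_connected
      (PlanarRook.classes_isCrystal n _) h).1 ⟨T₀, rfl⟩
    exact ⟨T, Subtype.ext hT⟩
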